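/- **Setting.** Let $(M^4,g)$ be an oriented and time-oriented smooth Lorentzian 4-manifold (signature $(-,+,+,+)$). Let $\Omega$ be a spacelike domain in $M$, i.e. an embedded 3-dimensional manifold with boundary on which $g$ induces a Riemannian metric, and suppose that its boundary $S=\partial\Omega$ is a closed (compact) surface; $\iota:S\to M$ is the inclusion and $\nu$ the outward unit normal of $S$ in $\Omega$. Let $N$ be a smooth vector field defined near $S$ that along $S$ is timelike, future-directed and orthogonal to $\Omega$. Orient $S$ so that $N$, $\nu$ and the orientation of $S$ form the orientation of $M$. **Reference.** Let $\hat M$ be the unit sphere $\mathbb S^3\subset\mathbb R^4$ or the hyperbolic space $\mathbb H^3=\{x_0=\sqrt{1+x_1^2+x_2^2+x_3^2}\}\subset\mathbb R^{1,3}$, with its standard metric $\hat g$ of curvature $\pm1$, and let $V$ be a static potential on $\hat M$, i.e. the restriction to $\hat M$ of a linear function on the ambient $\mathbb R^4$ (the usual choice is $V=x_0$). The de Sitter, respectively anti-de Sitter, reference is $$\overline M=\{(T,x)\in\mathbb R\times\hat M : V(x)\neq0\},\qquad \overline g=-V^2\,dT^2+\hat g,$$ with either orientation and with $\partial/\partial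 T$ future-directed. A *reference* is a smooth embedding $\varphi:U\to\overline M$ of an open neighbourhood $U$ of $S$ in $M$ that preserves the orientation and the time orientation; it is *4D isometric matching* if $\varphi^*\overline g=g$ on $T_pM$ for all $p\in S$. **Energy.** With $\kappa=8\pi$, $$E(S,N,\varphi)=\frac1{2\kappa}\int_S\iota^*\Big[(\omega^a{}_b-\overline\omega^a{}_b)\wedge i_N\eta_a{}^b+\overline D_bN^a\,(\eta_a{}^b-\overline\eta_a{}^b)\Big],$$ where $\omega^a{}_b$ are the Levi-Civita connection forms of $g$, $\eta_a{}^b=\tfrac12\sqrt{-\det g}\,g^{b\beta}\epsilon_{a\beta\mu\nu}\,dx^\mu\wedge dx^\nu$ in positively oriented coordinates ($\epsilon_{0123}=1$), and $\overline\omega^a{}_b,\overline D_b,\overline\eta_a{}^b$ are the connection forms, the covariant derivative and the 2-forms of $\varphi^*\overline g$. **Claim.** Let $\varphi$ be any 4D isometric matching reference such that 1. $\varphi_*N=\partial/\partial T$ along $S$, and 2. $\varphi(S)\subset\hat M$, i.e. $\varphi(S)$ lies in a slice $\{T=T_0\}\cong\hat M$. Then $$E(S,N,\varphi)=\frac1{8\pi}\int_S|V|\,(k_0-k)\,dV_S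 .$$ Here $V$ is evaluated at the image point under $\varphi$; $dV_S$ is the area element of $S$; $k$ is the mean curvature (trace of the second fundamental form, positive for round spheres in Euclidean space with respect to the outward normal) of $S$ in $\Omega$ with respect to $\nu$; and $k_0$ is the mean curvature of the embedded surface $\varphi(S)$ in $(\hat M,\hat g)$ with respect to its outward unit normal $\nu_0$, where the outward side of $\varphi(S)$ is fixed by the same orientation convention: $\partial/\partial T$, $\nu_0$ and the orientation of $S$ carried over by $\varphi$ form the orientation of $\overline M$. -/

import Mathlib

open scoped Manifold ContDiff Topology
open MeasureTheory Set

noncomputable section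

namespace QuasiLocal

/-! ### Tensor fields, orientations and time orientations on manifolds

Mathlib's `TangentSpace I p` is the model vector space, and a tangent vector at `p` is identified
with its coordinates in the preferred chart `extChartAt I p`.  The vector
`tangentCoordChange I p q q v` is the tangent vector at `q` whose coordinates in the chart
centred at `p` are `v`. -/

section General

variable {E : Type*} [NormedAddCommGroup E] [NormedSpace ℝ E]
  {H : Type*} [TopologicalSpace H] (I : ModelWithCorners ℝ E H)
  (M : Type*) [TopologicalSpace M] [ChartedSpace H M]

/-- Fields of bilinear forms (covariant 2-tensor fields) on `M`. -/
abbrev TwoTensor : Type _ := ∀ p : M, LinearMap.BilinForm ℝ (TangentSpace I p)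

/-- A choice of orientation of each tangent space of `M`. -/
abbrev OrientationField (n : ℕ) : Type _ := ∀ p : M, Orientation ℝ (TangentSpace I p) (Fin n)

variable {I M}

/-- `v` is a positively oriented basis. -/
def IsPositiveFrame {V : Type*} [AddCommGroup V] [Module ℝ V] {n : ℕ}
    (o : Orientation ℝ V (Fin n)) (v : Fin n → V) : Prop :=
  ∃ b : Module.Basis (Fin n) ℝ V, ⇑b = v ∧ b.orientation = o

/-- The pointwise orientations `o` form an orientation of `W`: in each chart they are
locally constant. -/
def IsOrientationOn [IsManifold I 1 M] {n : ℕ} (o : OrientationField I M n) (W : Set M) : Prop :=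
  ∀ p ∈ W, ∀ᶠ q in 𝓝 p, ∀ v : Fin n → TangentSpace I p, IsPositiveFrame (o p) v →
    IsPositiveFrame (o q) (fun i => (tangentCoordChange I p q q (v i) : TangentSpace I q))

/-- The coefficient `g(u, v)` of `g` at the point with coordinates `y` in the chart centred at
`p`, where `u`, `v` are constant coordinate vectors of that chart. -/
def inChart [IsManifold I 1 M] (g : TwoTensor I M) (p : M) (y u v : E) : ℝ :=
  g ((extChartAt I p).symm y)
    (tangentCoordChange I p ((extChartAt I p).symm y) ((extChartAt I p).symm y) u)
    (tangentCoordChange I p ((extChartAt I p).symm y) ((extChartAt I p).symm y) v)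

/-- `g` has smooth coefficients in every chart. -/
def IsSmooth [IsManifold I 1 M] (g : TwoTensor I M) : Prop :=
  ∀ (p : M) (u v : E), ContDiffOn ℝ ∞ (fun y => inChart g p y u v) (extChartAt I p).target

/-- `g` is a smooth Lorentz metric of signature `(-, +, +, +)`. -/
structure IsLorentzMetric [IsManifold I 1 M] (g : TwoTensor I M) : Prop where
  smooth : IsSmooth g
  signature : ∀ p, ∃ e : Module.Basis (Fin 4) ℝ (TangentSpace I p), ∀ i j,
    g p (e i) (e j) = if i = j then (if i = 0 then -1 else 1) else 0

/-- `τ` is a continuous timelike vector field; it defines a time orientation. -/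
structure IsTimeOrientation [IsManifold I 1 M] (g : TwoTensor I M)
    (τ : ∀ p : M, TangentSpace I p) : Prop where
  continuous : Continuous (fun p => (⟨p, τ p⟩ : TangentBundle I M))
  timelike : ∀ p, g p (τ p) (τ p) < 0

/-- The tangent vector `v` at `p` is timelike and future-directed, where the time orientation is
given by the timelike vector field `τ`. -/
def IsFutureTimelike (g : TwoTensor I M) (τ : ∀ p : M, TangentSpace I p) (p : M)
    (v : TangentSpace I p) : Prop :=
  g p v v < 0 ∧ g p v (τ p) < 0

variable {E' : Type*} [NormedAddCommGroup E'] [NormedSpace ℝ E']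
  {H' : Type*} [TopologicalSpace H'] {I' : ModelWithCorners ℝ E' H'}
  {M' : Type*} [TopologicalSpace M'] [ChartedSpace H' M']

/-- The pull-back `f^* g`. -/
def pullback (I : ModelWithCorners ℝ E H) (f : M → M') (g : TwoTensor I' M') : TwoTensor I M :=
  fun p => (g (f p)).compl₁₂ (mfderiv I I' f p).toLinearMap (mfderiv I I' f p).toLinearMap

variable (I I') in
/-- Smooth embeddings: smooth injective immersions that are homeomorphisms onto their image. -/
structure IsEmbedded (f : M → M') : Prop where
  smooth : ContMDiff I I' ∞ f
  immersion : ∀ p, Function.Injective (mfderiv I I' f p)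
  embedding : Topology.IsEmbedding f

/-- `φ`, restricted to the open neighbourhood `U` of `A`, is a reference for the spacetime
`(M, g, o, τ)` in the spacetime `(W, g', o', τ')`, `W` an open subset of `M'`: a smooth embedding
`U → W` that preserves the orientation and the time orientation. -/
structure IsReference (g : TwoTensor I M) {n : ℕ} (o : OrientationField I M n)
    (τ : ∀ p : M, TangentSpace I p)
    (g' : TwoTensor I' M') (o' : OrientationField I' M' n) (τ' : ∀ p : M', TangentSpace I' p)
    (W : Set M') (A U : Set M) (φ : M → M') : Prop where
  isOpen : IsOpen U
  subset : A ⊆ U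
  mapsTo : MapsTo φ U W
  smooth : ContMDiffOn I I' ∞ φ U
  immersion : ∀ p ∈ U, Function.Injective (mfderiv I I' φ p)
  embedding : Topology.IsEmbedding (U.domRestrict φ)
  orientation : ∀ p ∈ U, ∀ v : Fin n → TangentSpace I p, IsPositiveFrame (o p) v →
    IsPositiveFrame (o' (φ p)) (fun i => mfderiv I I' φ p (v i))
  time : ∀ p ∈ U, ∀ v : TangentSpace I p, IsFutureTimelike g τ p v →
    g' (φ p) (mfderiv I I' φ p v) (mfderiv I I' φ p v) < 0 →
    IsFutureTimelike g' τ' (φ p) (mfderiv I I' φ p v)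

/-- 4D isometric matching on the set `A`: `φ^* g' = g` as bilinear forms on `T_p M`, `p ∈ A`. -/
def IsIsometricMatching (g : TwoTensor I M) (g' : TwoTensor I' M') (A : Set M) (φ : M → M') :
    Prop :=
  ∀ p ∈ A, pullback I φ g' p = g p

end General

/-! ### The Levi-Civita connection in coordinates -/

section LeviCivita

variable {n : ℕ} {H : Type*} [TopologicalSpace H]
  {I : ModelWithCorners ℝ (EuclideanSpace ℝ (Fin n)) H}
  {M : Type*} [TopologicalSpace M] [ChartedSpace H M]

/-- The `i`-th coordinate vector `∂_i`. -/
def stdVec {n : ℕ} (i : Fin n) : EuclideanSpace ℝ (Fin n) := EuclideanSpace.single i 1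

/-- The `i`-th component of a tangent vector at `p` in the chart centred at `p`. -/
def comp {p : M} (v : TangentSpace I p) (i : Fin n) : ℝ :=
  (show EuclideanSpace ℝ (Fin n) from v) i

/-- The matrix `g_{ij}` in the chart centred at `p`, as a function of the coordinates `y`. -/
def gram [IsManifold I 1 M] (g : TwoTensor I M) (p : M) (y : EuclideanSpace ℝ (Fin n)) :
    Matrix (Fin n) (Fin n) ℝ :=
  Matrix.of fun i j => inChart g p y (stdVec i) (stdVec j)

/-- The matrix `g_{ij}` at the point `p` itself. -/
def gramAt [IsManifold I 1 M] (g : TwoTensor I M) (p : M) : Matrix (Fin n) (Fin n) ℝ :=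
  gram g p (extChartAt I p p)

/-- The derivative `∂_k g_{ij}` at `p`, in the chart centred at `p`.  (At a boundary point the
derivative is taken within the half-space.) -/
def dGram [IsManifold I 1 M] (g : TwoTensor I M) (p : M) (k i j : Fin n) : ℝ :=
  fderivWithin ℝ (fun y => gram g p y i j) (range I) (extChartAt I p p) (stdVec k)

/-- The Christoffel symbol `Γ^a_{bc}` of `g` at `p`, in the chart centred at `p`. -/
def christoffel [IsManifold I 1 M] (g : TwoTensor I M) (p : M) (a b c : Fin n) : ℝ :=
  (1 / 2) * ∑ d, (gramAt g p)⁻¹ a d * (dGram g p b d c + dGram g p c d b - dGram g p d b c)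

/-- The connection 1-form `ω^a_b = Γ^a_{cb} dx^c` of the coordinate frame of the chart centred
at `p`, evaluated at `u ∈ T_p M`. -/
def connectionForm [IsManifold I 1 M] (g : TwoTensor I M) (p : M) (a b : Fin n)
    (u : TangentSpace I p) : ℝ :=
  ∑ c, comp u c * christoffel g p a c b

/-- The component `D_b N^a = ∂_b N^a + Γ^a_{bc} N^c` at `p` of the covariant derivative of the
vector field `N`, in the chart centred at `p`. -/
def covDeriv [IsManifold I 1 M] (g : TwoTensor I M) (N : ∀ p : M, TangentSpace I p) (p : M)
    (a b : Fin n) : ℝ :=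
  fderivWithin ℝ
      (fun y => (tangentCoordChange I ((extChartAt I p).symm y) p ((extChartAt I p).symm y)
        (N ((extChartAt I p).symm y))) a)
      (range I) (extChartAt I p p) (stdVec b)
    + ∑ c, christoffel g p a b c * comp (N p) c

end LeviCivita

/-! ### The quasi-local energy -/

section Energy

variable {M : Type*} [TopologicalSpace M] [ChartedSpace (EuclideanSpace ℝ (Fin 4)) M]
  [IsManifold (𝓡 4) 1 M]

open Classical in
/-- `+1` if the frame is positively oriented and `-1` otherwise. -/
def frameSign {V : Type*} [AddCommGroup V] [Module ℝ V] {n : ℕ}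
    (o : Orientation ℝ V (Fin n)) (v : Fin n → V) : ℝ :=
  if IsPositiveFrame o v then 1 else -1

/-- The volume form `√(-det g) dx^0 ∧ dx^1 ∧ dx^2 ∧ dx^3` (in positively oriented coordinates;
with the opposite sign in negatively oriented ones) of a Lorentz metric, at `p`. -/
def volumeForm (g : TwoTensor (𝓡 4) M) (o : OrientationField (𝓡 4) M 4) (p : M)
    (v : Fin 4 → TangentSpace (𝓡 4) p) : ℝ :=
  frameSign (o p) (fun i => (stdVec i : TangentSpace (𝓡 4) p)) * √(-(gramAt g p).det) *
    (Matrix.of fun i j => comp (v j) i).det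

/-- The 2-form `η_a^b = (1/2) √(-det g) g^{bβ} ε_{aβμν} dx^μ ∧ dx^ν` at `p`, in the chart centred
at `p`, evaluated at `(x, y)`. -/
def eta (g : TwoTensor (𝓡 4) M) (o : OrientationField (𝓡 4) M 4) (p : M) (a b : Fin 4)
    (x y : TangentSpace (𝓡 4) p) : ℝ :=
  ∑ β, (gramAt g p)⁻¹ b β * volumeForm g o p
    ![(stdVec a : TangentSpace (𝓡 4) p), (stdVec β : TangentSpace (𝓡 4) p), x, y]

/-- The 2-form `(ω^a_b - ω̄^a_b) ∧ i_N η_a^b + D̄_b N^a (η_a^b - η̄_a^b)` at `p`, evaluated at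
`(x, y)`; the barred quantities belong to the metric `g'`.  (The expression is independent of the
frame; the frame used at `p` is the coordinate frame of the chart centred at `p`.) -/
def cntForm (g g' : TwoTensor (𝓡 4) M) (o : OrientationField (𝓡 4) M 4)
    (N : ∀ p : M, TangentSpace (𝓡 4) p) (p : M) (x y : TangentSpace (𝓡 4) p) : ℝ :=
  ∑ a, ∑ b,
    ((connectionForm g p a b x - connectionForm g' p a b x) * eta g o p a b (N p) y
      - (connectionForm g p a b y - connectionForm g' p a b y) * eta g o p a b (N p) x
      + covDeriv g' N p a b * (eta g o p a b x y - eta g' o p a b x y))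

variable {S : Type*} [TopologicalSpace S] [ChartedSpace (EuclideanSpace ℝ (Fin 2)) S]
  [IsManifold (𝓡 2) ∞ S] [T2Space S] [CompactSpace S]

/-- A smooth partition of unity subordinate to the chart domains of a closed surface. -/
def chartPartition (S : Type*) [TopologicalSpace S] [ChartedSpace (EuclideanSpace ℝ (Fin 2)) S]
    [IsManifold (𝓡 2) ∞ S] [T2Space S] [CompactSpace S] :
    SmoothPartitionOfUnity S (𝓡 2) S univ :=
  Classical.choose (SmoothPartitionOfUnity.exists_isSubordinate_chartAt_source (𝓡 2) S)

/-- The tangent vector `∂_i` of the chart centred at `c`, at the point with coordinates `y`. -/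
def coordVec (c : S) (y : EuclideanSpace ℝ (Fin 2)) (i : Fin 2) :
    TangentSpace (𝓡 2) ((extChartAt (𝓡 2) c).symm y) :=
  tangentCoordChange (𝓡 2) c ((extChartAt (𝓡 2) c).symm y) ((extChartAt (𝓡 2) c).symm y)
    (stdVec i)

/-- The integral of a 2-form over an oriented closed surface, through a partition of unity. -/
def integralForm (oS : OrientationField (𝓡 2) S 2)
    (α : ∀ s : S, TangentSpace (𝓡 2) s → TangentSpace (𝓡 2) s → ℝ) : ℝ :=
  ∑ᶠ c : S, ∫ y in (extChartAt (𝓡 2) c).target,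
    chartPartition S c ((extChartAt (𝓡 2) c).symm y) *
      (frameSign (oS ((extChartAt (𝓡 2) c).symm y)) (coordVec c y) *
        α ((extChartAt (𝓡 2) c).symm y) (coordVec c y 0) (coordVec c y 1))

/-- The integral `∫_S f dV` of a function over a closed surface, with respect to the area element
`dV = √(det h_{ij}) dy^1 dy^2` of the Riemannian metric `h`, through a partition of unity. -/
def integralArea (h : TwoTensor (𝓡 2) S) (f : S → ℝ) : ℝ :=
  ∑ᶠ c : S, ∫ y in (extChartAt (𝓡 2) c).target,
    chartPartition S c ((extChartAt (𝓡 2) c).symm y) *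
      (√(gram h c y).det * f ((extChartAt (𝓡 2) c).symm y))

/-- The CNT quasi-local energy `E(S, N, φ)`, with `κ = 8π`, of the oriented closed surface
`ι : S → M` in `(M, g)` with orientation `o`, for the reference `φ` into a manifold with
metric `g'`. -/
def cntEnergy {E' : Type*} [NormedAddCommGroup E'] [NormedSpace ℝ E']
    {H' : Type*} [TopologicalSpace H'] {I' : ModelWithCorners ℝ E' H'}
    {M' : Type*} [TopologicalSpace M'] [ChartedSpace H' M']
    (g : TwoTensor (𝓡 4) M) (o : OrientationField (𝓡 4) M 4) (g' : TwoTensor I' M')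
    (ι : S → M) (oS : OrientationField (𝓡 2) S 2)
    (N : ∀ p : M, TangentSpace (𝓡 4) p) (φ : M → M') : ℝ :=
  1 / (2 * (8 * Real.pi)) * integralForm oS (fun s u v =>
    cntForm g (pullback (𝓡 4) φ g') o N (ι s)
      (mfderiv (𝓡 2) (𝓡 4) ι s u) (mfderiv (𝓡 2) (𝓡 4) ι s v))

end Energy

/-! ### Mean curvature of surfaces in Riemannian 3-manifolds -/

section MeanCurvature

variable {S : Type*} [TopologicalSpace S] [ChartedSpace (EuclideanSpace ℝ (Fin 2)) S]
  {H : Type*} [TopologicalSpace H] {I : ModelWithCorners ℝ (EuclideanSpace ℝ (Fin 3)) H}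
  {P : Type*} [TopologicalSpace P] [ChartedSpace H P]

/-- `ν` is a unit normal vector field along `f : S → P`. -/
def IsUnitNormal (h : TwoTensor I P) (f : S → P) (ν : ∀ s : S, TangentSpace I (f s)) : Prop :=
  ∀ s, h (f s) (ν s) (ν s) = 1 ∧ ∀ u, h (f s) (ν s) (mfderiv (𝓡 2) I f s u) = 0

/-- The coordinate expression of `f` in the charts centred at `s` and `f s`. -/
def coordMap (I : ModelWithCorners ℝ (EuclideanSpace ℝ (Fin 3)) H) (f : S → P) (s : S)
    (y : EuclideanSpace ℝ (Fin 2)) : EuclideanSpace ℝ (Fin 3) :=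
  extChartAt I (f s) (f ((extChartAt (𝓡 2) s).symm y))

/-- The coordinate vector field `∂_i f` along the surface, in coordinates. -/
def dCoordMap (I : ModelWithCorners ℝ (EuclideanSpace ℝ (Fin 3)) H) (f : S → P) (s : S)
    (i : Fin 2) (y : EuclideanSpace ℝ (Fin 2)) : EuclideanSpace ℝ (Fin 3) :=
  fderiv ℝ (coordMap I f s) y (stdVec i)

/-- The covariant derivative `∇_{∂_i f} ∂_j f` at `f s` along the surface `f`, with components
`∂_i ∂_j f^a + Γ^a_{bc} ∂_i f^b ∂_j f^c`. -/
def covHessian [IsManifold I 1 P] (h : TwoTensor I P) (f : S → P) (s : S) (i j : Fin 2) :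
    EuclideanSpace ℝ (Fin 3) :=
  WithLp.toLp 2 fun a =>
    (fderiv ℝ (dCoordMap I f s j) (extChartAt (𝓡 2) s s) (stdVec i)) a +
      ∑ b, ∑ c, christoffel h (f s) a b c *
        dCoordMap I f s i (extChartAt (𝓡 2) s s) b * dCoordMap I f s j (extChartAt (𝓡 2) s s) c

/-- The mean curvature `k = -∑_{ij} h^{ij} ⟨∇_{∂_i f} ∂_j f, ν⟩` of the surface `f : S → P` with
respect to the unit normal `ν`, where `h^{ij}` is the inverse of the induced metric.  The sign is
such that a round sphere in Euclidean space has positive mean curvature with respect to the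
outward normal. -/
def meanCurvature [IsManifold (𝓡 2) 1 S] [IsManifold I 1 P] (h : TwoTensor I P) (f : S → P)
    (ν : ∀ s : S, TangentSpace I (f s)) (s : S) : ℝ :=
  -∑ i, ∑ j, (gramAt (pullback (𝓡 2) f h) s)⁻¹ i j *
    h (f s) (covHessian h f s i j : TangentSpace I (f s)) (ν s)

end MeanCurvature

/-! ### Domains enclosed by a surface -/

section Domain

variable {M : Type*} [TopologicalSpace M] [ChartedSpace (EuclideanSpace ℝ (Fin 4)) M]
  {S : Type*} [TopologicalSpace S] [ChartedSpace (EuclideanSpace ℝ (Fin 2)) S]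
  {Ω : Type*} [TopologicalSpace Ω] [ChartedSpace (EuclideanHalfSpace 3) Ω]

/-- `j : Ω → M` is an embedded spacelike 3-dimensional manifold with boundary in `(M, g)`, and
`b : S → Ω` identifies `S` with its boundary: `S`, embedded by `j ∘ b`, encloses the spacelike
domain `Ω`. -/
structure IsSpacelikeDomain (g : TwoTensor (𝓡 4) M) (j : Ω → M) (b : S → Ω) : Prop where
  embedded : IsEmbedded (𝓡∂ 3) (𝓡 4) j
  spacelike : ∀ (x : Ω) (w : TangentSpace (𝓡∂ 3) x), w ≠ 0 → 0 < pullback (𝓡∂ 3) j g x w w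
  boundary_embedded : IsEmbedded (𝓡 2) (𝓡∂ 3) b
  boundary : range b = (𝓡∂ 3).boundary Ω

/-- `ν` is the outward unit normal of the boundary `b : S → Ω` for the metric `h` of `Ω`.  (`Ω` is
modelled on the half-space `{x | 0 ≤ x 0}`.) -/
def IsOutwardUnitNormal (h : TwoTensor (𝓡∂ 3) Ω) (b : S → Ω)
    (ν : ∀ s : S, TangentSpace (𝓡∂ 3) (b s)) : Prop :=
  IsUnitNormal h b ν ∧ ∀ s, comp (ν s) 0 < 0

end Domain

/-! ### de Sitter and anti-de Sitter space in static form -/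

section Static

variable {P : Type*} [TopologicalSpace P] [ChartedSpace (EuclideanSpace ℝ (Fin 3)) P]

/-- The model of the product manifold `ℝ × P`. -/
abbrev staticModel : ModelWithCorners ℝ (ℝ × EuclideanSpace ℝ (Fin 3))
    (ModelProd ℝ (EuclideanSpace ℝ (Fin 3))) :=
  𝓘(ℝ, ℝ).prod (𝓡 3)

/-- The tangent vector `t ∂/∂T + w` of `ℝ × P`. -/
def staticVec (x : ℝ × P) (t : ℝ) (w : TangentSpace (𝓡 3) x.2) : TangentSpace staticModel x :=
  (t, w)

/-- The vector field `∂/∂T`. -/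
def timeField (x : ℝ × P) : TangentSpace staticModel x := staticVec x 1 0

/-- The time component of a tangent vector of `ℝ × P`. -/
def timePart (x : ℝ × P) : TangentSpace staticModel x →ₗ[ℝ] ℝ :=
  LinearMap.fst ℝ ℝ (EuclideanSpace ℝ (Fin 3))

/-- The component tangent to `P` of a tangent vector of `ℝ × P`. -/
def spacePart (x : ℝ × P) : TangentSpace staticModel x →ₗ[ℝ] TangentSpace (𝓡 3) x.2 :=
  LinearMap.snd ℝ ℝ (EuclideanSpace ℝ (Fin 3))

/-- The metric `-V² dT² + h` on `ℝ × P`. -/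
def staticMetric (h : TwoTensor (𝓡 3) P) (V : P → ℝ) : TwoTensor staticModel (ℝ × P) :=
  fun x => (-(V x.2) ^ 2) • (LinearMap.mul ℝ ℝ).compl₁₂ (timePart x) (timePart x)
    + (h x.2).compl₁₂ (spacePart x) (spacePart x)

/-- The open set on which `-V² dT² + h` is a Lorentz metric. -/
def staticRegion (V : P → ℝ) : Set (ℝ × P) := {x | V x.2 ≠ 0}

/-- The unit 3-sphere in `ℝ⁴`. -/
abbrev Sphere3 : Type := Metric.sphere (0 : EuclideanSpace ℝ (Fin 4)) 1

/-- The round metric of the unit 3-sphere, induced from `ℝ⁴`. -/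
def sphereMetric : TwoTensor (𝓡 3) Sphere3 := fun x =>
  (innerₗ (EuclideanSpace ℝ (Fin 4))).compl₁₂
    (mfderiv (𝓡 3) 𝓘(ℝ, EuclideanSpace ℝ (Fin 4))
      ((↑) : Sphere3 → EuclideanSpace ℝ (Fin 4)) x).toLinearMap
    (mfderiv (𝓡 3) 𝓘(ℝ, EuclideanSpace ℝ (Fin 4))
      ((↑) : Sphere3 → EuclideanSpace ℝ (Fin 4)) x).toLinearMap

/-- The static potentials of the 3-sphere: restrictions of linear functions on `ℝ⁴`. -/
def spherePotential (a : EuclideanSpace ℝ (Fin 4)) (x : Sphere3) : ℝ :=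
  inner ℝ a (x : EuclideanSpace ℝ (Fin 4))

/-- Hyperbolic 3-space, the hyperboloid `{(x₀, x) | x₀ = √(1 + |x|²)}` in Minkowski space, in the
global chart `(x₀, x) ↦ x`. -/
abbrev Hyperbolic3 : Type := EuclideanSpace ℝ (Fin 3)

/-- The hyperbolic metric `|dx|² - (d√(1 + |x|²))²`, induced from Minkowski space. -/
def hyperbolicMetric : TwoTensor (𝓡 3) Hyperbolic3 := fun x =>
  (innerₗ (EuclideanSpace ℝ (Fin 3)) -
    (1 + ‖x‖ ^ 2)⁻¹ • (LinearMap.mul ℝ ℝ).compl₁₂ (innerₗ (EuclideanSpace ℝ (Fin 3)) x)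
      (innerₗ (EuclideanSpace ℝ (Fin 3)) x) : LinearMap.BilinForm ℝ (EuclideanSpace ℝ (Fin 3)))

/-- The static potentials of hyperbolic space: restrictions of linear functions on Minkowski
space.  The usual one is `a₀ = 1`, `a = 0`, that is `x₀ = √(1 + |x|²)`. -/
def hyperbolicPotential (a₀ : ℝ) (a : EuclideanSpace ℝ (Fin 3)) (x : Hyperbolic3) : ℝ :=
  a₀ * √(1 + ‖x‖ ^ 2) + inner ℝ a x

end Static

end QuasiLocal

end

/-! Along S the metric g and the pulled back reference metric k coincide, so their 2-forms η agree
there and the term containing the covariant derivative of N vanishes. What is left is the difference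
of the two Levi-Civita connections in directions x tangent to S. Lower its index: A(x)(u, v) = ⟨∇_x
u, v⟩ for g minus the same for k. Both connections are metric, and g and k, being equal on S, have
equal derivatives along S; hence A(x) is skew in u, v (`lowerConnection_sub_skew`).

Contract A with i_N η in the frame (N, n, z₀, z₁), where n is the outward normal and z₀, z₁ are
tangent to S. Its Gram matrix is diag(-V², 1, h), because N is orthogonal to Ω and goes to ∂/∂T. N
and one of the z's already occupy two slots of the volume form, so only the components of A that
pair n with a z survive, and the form has the value 2 vol(N, n, z₀, z₁) h^{ij} A(z_i)(z_j, n)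
(`sum_inv_contraction_eq_trace`, `cntForm_eq`). The volume is ±|V| √det h, which is the origin of
the weight |V|.

It remains to see that this trace is k₀ - k. The covariant second derivative of the surface, paired
with n, is a second coordinate derivative plus a Christoffel term; the first part is the same for g
and k, so A(z_i)(z_j, n) is the difference of the two covariant second derivatives
(`surfaceHessian_sub`). These are natural under pull-back (`lowerHessian_pullback`). For g, the
inclusion of Ω gives the second fundamental form of S in Ω. For k, the normal n goes to ν₀
(`differential_normal`), and -V² dT² contributes nothing on vectors killed by dT
(`lowerHessian_add_sq_of_ker`): the slices are totally geodesic. What is left is the second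
fundamental form of the image in the slice.

Indices stay lowered throughout, so naturality holds even for degenerate pull-backs such as that of
the spatial metric under the projection of φ. The argument takes place for a static metric -V² dT² +
h with h Riemannian and V differentiable (`IsStaticReference`); sphere and hyperbolic space are then
special cases. -/

noncomputable section

namespace QuasiLocal

/-! ### Christoffel symbols and covariant second derivatives under pull-back. -/

section VectorSpace

variable {E : Type*} [NormedAddCommGroup E] [NormedSpace ℝ E]
  {E' : Type*} [NormedAddCommGroup E'] [NormedSpace ℝ E']
  {E'' : Type*} [NormedAddCommGroup E''] [NormedSpace ℝ E'']
  {F : Type*} [NormedAddCommGroup F] [NormedSpace ℝ F]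

/-- A family of continuous linear maps on a finite-dimensional space is differentiable if it is
so pointwise. -/
theorem differentiableWithinAt_of_clm_apply [FiniteDimensional ℝ E] {f : F → E →L[ℝ] E'}
    {s : Set F} {x : F} (h : ∀ v, DifferentiableWithinAt ℝ (fun y => f y v) s x) :
    DifferentiableWithinAt ℝ f s x := by
  let d := Module.finrank ℝ E
  have hd : d = Module.finrank ℝ (Fin d → ℝ) := (Module.finrank_fin_fun ℝ).symm
  let e₁ := ContinuousLinearEquiv.ofFinrankEq hd
  let e₂ := (e₁.arrowCongr (1 : E' ≃L[ℝ] E')).trans (ContinuousLinearEquiv.piRing (Fin d))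
  -- In finite dimension a linear map is the tuple of its values on a basis.
  rw [← Function.id_comp f, ← e₂.symm_comp_self]
  exact e₂.symm.differentiableAt.comp_differentiableWithinAt x
    (differentiableWithinAt_pi.mpr fun i => h _)

/-- The Christoffel symbols of the first kind `⟨∇_u v, w⟩` of the metric with coefficients `G`. -/
def lowerChristoffel (G : E → E →L[ℝ] E →L[ℝ] ℝ) (s : Set E) (x u v w : E) : ℝ :=
  1 / 2 * (fderivWithin ℝ G s x u w v + fderivWithin ℝ G s x v w u - fderivWithin ℝ G s x w u v)

/-- The pairing `⟨∇_u ∂_v f, w⟩` of the covariant second derivative of `f` with `w`. -/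
def lowerHessian (G : E → E →L[ℝ] E →L[ℝ] ℝ) (s : Set E) (f : F → E) (z u v : F) (w : E) : ℝ :=
  G (f z) (fderiv ℝ (fun y => fderiv ℝ f y v) z u) w
    + lowerChristoffel G s (f z) (fderiv ℝ f z u) (fderiv ℝ f z v) w

theorem fderivWithin_clm_apply₂ {G : F → E →L[ℝ] E →L[ℝ] ℝ} {s : Set F} {x : F}
    (hs : UniqueDiffWithinAt ℝ s x) (hG : DifferentiableWithinAt ℝ G s x) (u v : E) :
    fderivWithin ℝ (fun y => G y u v) s x = ((fderivWithin ℝ G s x).flip u).flip v := by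
  have h := ((hG.hasFDerivWithinAt.clm_apply (hasFDerivWithinAt_const u x s)).clm_apply
    (hasFDerivWithinAt_const v x s)).fderivWithin hs
  rw [h]
  ext w
  simp

/-- The product rule: two terms differentiate the factors DJ, the third differentiates the
coefficients of G along J. Derivatives are taken within a set so that boundary points of a
half-space are covered. -/
theorem hasFDerivWithinAt_pullback {G : E' → E' →L[ℝ] E' →L[ℝ] ℝ} {s : Set E} {s' : Set E'}
    {J : E → E'} {x : E} (hs : UniqueDiffOn ℝ s) (hx : x ∈ s) (hJ : ContDiffWithinAt ℝ 2 J s x)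
    (hJs : MapsTo J s s') (hG : DifferentiableWithinAt ℝ G s' (J x)) (u v : E) :
    HasFDerivWithinAt
      (fun y => G (J y) (fderivWithin ℝ J s y u) (fderivWithin ℝ J s y v))
      (((G (J x)).flip (fderivWithin ℝ J s x v)).comp
          ((fderivWithin ℝ (fderivWithin ℝ J s) s x).flip u)
        + (G (J x) (fderivWithin ℝ J s x u)).comp
          ((fderivWithin ℝ (fderivWithin ℝ J s) s x).flip v)
        + (((fderivWithin ℝ G s' (J x)).comp (fderivWithin ℝ J s x)).flip
            (fderivWithin ℝ J s x u)).flip (fderivWithin ℝ J s x v)) s x := by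
  have h1 : HasFDerivWithinAt (fderivWithin ℝ J s) (fderivWithin ℝ (fderivWithin ℝ J s) s x) s x :=
    ((hJ.fderivWithin_right hs (m := 1) (by norm_num) hx).differentiableWithinAt
      one_ne_zero).hasFDerivWithinAt
  have h0 : HasFDerivWithinAt J (fderivWithin ℝ J s x) s x :=
    (hJ.differentiableWithinAt two_ne_zero).hasFDerivWithinAt
  have h2 : HasFDerivWithinAt (fun y => G (J y)) _ s x :=
    HasFDerivWithinAt.comp (g := G) (f := J) x hG.hasFDerivWithinAt h0 hJs
  have h3 := (h2.clm_apply (h1.clm_apply (hasFDerivWithinAt_const u x s))).clm_apply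
    (h1.clm_apply (hasFDerivWithinAt_const v x s))
  refine h3.congr_fderiv ?_
  ext w
  simp
  ring

theorem differentiableWithinAt_pullback [FiniteDimensional ℝ E] {G : E' → E' →L[ℝ] E' →L[ℝ] ℝ}
    {s : Set E} {s' : Set E'}
    {J : E → E'} {x : E} (hs : UniqueDiffOn ℝ s) (hx : x ∈ s) (hJ : ContDiffWithinAt ℝ 2 J s x)
    (hJs : MapsTo J s s') (hG : DifferentiableWithinAt ℝ G s' (J x))
    {K : E → E →L[ℝ] E →L[ℝ] ℝ}
    (hK : ∀ᶠ y in 𝓝[s] x, ∀ u v,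
      K y u v = G (J y) (fderivWithin ℝ J s y u) (fderivWithin ℝ J s y v)) :
    DifferentiableWithinAt ℝ K s x :=
  differentiableWithinAt_of_clm_apply fun u => differentiableWithinAt_of_clm_apply fun v =>
    (hasFDerivWithinAt_pullback hs hx hJ hJs hG u v).differentiableWithinAt.congr_of_eventuallyEq
      (hK.mono fun _ h => h u v) (hK.self_of_nhdsWithin hx u v)

/-- Christoffel symbols of a pulled back metric. -/
theorem lowerChristoffel_pullback [FiniteDimensional ℝ E] {G : E' → E' →L[ℝ] E' →L[ℝ] ℝ}
    {s : Set E} {s' : Set E'}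
    {J : E → E'} {x : E} (hs : UniqueDiffOn ℝ s) (hx : x ∈ s) (hx' : x ∈ closure (interior s))
    (hJ : ContDiffWithinAt ℝ 2 J s x)
    (hJs : MapsTo J s s') (hG : DifferentiableWithinAt ℝ G s' (J x))
    (hGs : ∀ u v, G (J x) u v = G (J x) v u)
    {K : E → E →L[ℝ] E →L[ℝ] ℝ}
    (hK : ∀ᶠ y in 𝓝[s] x, ∀ u v,
      K y u v = G (J y) (fderivWithin ℝ J s y u) (fderivWithin ℝ J s y v)) (u v w : E) :
    lowerChristoffel K s x u v w =
      G (J x) (fderivWithin ℝ (fderivWithin ℝ J s) s x u v) (fderivWithin ℝ J s x w)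
      + lowerChristoffel G s' (J x) (fderivWithin ℝ J s x u) (fderivWithin ℝ J s x v)
        (fderivWithin ℝ J s x w) := by
  have hKd := differentiableWithinAt_pullback hs hx hJ hJs hG hK
  have key : ∀ a b c : E, fderivWithin ℝ K s x a b c =
      G (J x) (fderivWithin ℝ (fderivWithin ℝ J s) s x a b) (fderivWithin ℝ J s x c)
      + G (J x) (fderivWithin ℝ J s x b) (fderivWithin ℝ (fderivWithin ℝ J s) s x a c)
      + fderivWithin ℝ G s' (J x) (fderivWithin ℝ J s x a) (fderivWithin ℝ J s x b)
        (fderivWithin ℝ J s x c) := by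
    intro a b c
    have h1 := fderivWithin_clm_apply₂ (hs x hx) hKd b c
    have h2 := ((hasFDerivWithinAt_pullback hs hx hJ hJs hG b c).congr_of_eventuallyEq
      (f₁ := fun y => K y b c)
      (hK.mono fun _ h => h b c) (hK.self_of_nhdsWithin hx b c)).fderivWithin (hs x hx)
    have h3 := congrArg (fun L : E →L[ℝ] ℝ => L a) (h1.symm.trans h2)
    simpa using h3
  -- In the Koszul combination six terms contain second derivatives of J. By the symmetry of the
  -- second derivative and of G four of them cancel, and the other two coincide.
  have hsym : IsSymmSndFDerivWithinAt ℝ J s x :=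
    hJ.isSymmSndFDerivWithinAt (by simp) hs hx' hx
  unfold lowerChristoffel
  rw [key, key, key, hsym.eq v u, hsym.eq u w, hsym.eq v w,
    hGs (fderivWithin ℝ J s x w) (fderivWithin ℝ (fderivWithin ℝ J s) s x u v),
    hGs (fderivWithin ℝ J s x u) (fderivWithin ℝ (fderivWithin ℝ J s) s x w v)]
  ring

/-- Covariant second derivatives are natural under isometric immersions. -/
theorem lowerHessian_pullback [FiniteDimensional ℝ E] {G : E' → E' →L[ℝ] E' →L[ℝ] ℝ}
    {s : Set E} {s' : Set E'} {J : E → E'} {f : F → E} {z : F}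
    (hs : UniqueDiffOn ℝ s) (hx' : f z ∈ closure (interior s))
    (hf : ContDiffAt ℝ 2 f z) (hfs : ∀ y, f y ∈ s)
    (hJ : ContDiffWithinAt ℝ 2 J s (f z))
    (hJs : MapsTo J s s') (hG : DifferentiableWithinAt ℝ G s' (J (f z)))
    (hGs : ∀ u v, G (J (f z)) u v = G (J (f z)) v u)
    {K : E → E →L[ℝ] E →L[ℝ] ℝ}
    (hK : ∀ᶠ y in 𝓝[s] f z, ∀ u v,
      K y u v = G (J y) (fderivWithin ℝ J s y u) (fderivWithin ℝ J s y v))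
    {f' : F → E'} (hf' : f' =ᶠ[𝓝 z] J ∘ f) (u v : F) (w : E) :
    lowerHessian K s f z u v w = lowerHessian G s' f' z u v (fderivWithin ℝ J s (f z) w) := by
  have hft : Filter.Tendsto f (𝓝 z) (𝓝[s] f z) :=
    tendsto_nhdsWithin_iff.mpr ⟨hf.continuousAt, Filter.Eventually.of_forall hfs⟩
  have hfd : ∀ᶠ y in 𝓝 z, DifferentiableAt ℝ f y :=
    (hf.eventually (by simp)).mono fun y hy => hy.differentiableAt two_ne_zero
  have hJd : ∀ᶠ y in 𝓝[s] f z, DifferentiableWithinAt ℝ J s y := by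
    have := hJ.eventually (by simp)
    rw [insert_eq_of_mem (hfs z)] at this
    exact this.mono fun y hy => hy.differentiableWithinAt two_ne_zero
  have hcomp : ∀ y, DifferentiableAt ℝ f y → DifferentiableWithinAt ℝ J s (f y) →
      fderiv ℝ (J ∘ f) y = (fderivWithin ℝ J s (f y)).comp (fderiv ℝ f y) := by
    intro y h1 h2
    have h3 := h2.hasFDerivWithinAt.comp y (hasFDerivWithinAt_univ.mpr h1.hasFDerivAt)
      (fun a _ => hfs a)
    exact (hasFDerivWithinAt_univ.mp h3).fderiv
  have h1 : ∀ᶠ y in 𝓝 z, fderiv ℝ f' y = (fderivWithin ℝ J s (f y)).comp (fderiv ℝ f y) := by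
    filter_upwards [hf'.eventuallyEq_nhds, hfd, hft.eventually hJd] with y h2 h3 h4
    rw [h2.fderiv_eq, hcomp y h3 h4]
  have hz := h1.self_of_nhds
  have hA : HasFDerivWithinAt (fderivWithin ℝ J s)
      (fderivWithin ℝ (fderivWithin ℝ J s) s (f z)) s (f z) :=
    ((hJ.fderivWithin_right hs (m := 1) (by norm_num) (hfs z)).differentiableWithinAt
      one_ne_zero).hasFDerivWithinAt
  have hB : DifferentiableAt ℝ (fun y => fderiv ℝ f y v) z :=
    ((hf.fderiv_right (m := 1) (by norm_num)).differentiableAt one_ne_zero).clm_apply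
      (differentiableAt_const v)
  have hA' : HasFDerivAt (fun y => fderivWithin ℝ J s (f y))
      ((fderivWithin ℝ (fderivWithin ℝ J s) s (f z)).comp (fderiv ℝ f z)) z :=
    hasFDerivWithinAt_univ.mp (hA.comp z (hasFDerivWithinAt_univ.mpr
      hfd.self_of_nhds.hasFDerivAt) (fun a _ => hfs a))
  -- The second derivative of J ∘ f exceeds the image of that of f by a D²J term, which is exactly
  -- the inhomogeneous term in the transformation of the Christoffel symbols.
  have h2 : fderiv ℝ (fun y => fderiv ℝ f' y v) z u =
      fderivWithin ℝ (fderivWithin ℝ J s) s (f z) (fderiv ℝ f z u) (fderiv ℝ f z v)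
      + fderivWithin ℝ J s (f z) (fderiv ℝ (fun y => fderiv ℝ f y v) z u) := by
    have h3 : (fun y => fderiv ℝ f' y v) =ᶠ[𝓝 z]
        fun y => fderivWithin ℝ J s (f y) (fderiv ℝ f y v) :=
      h1.mono fun y hy => by simp [hy]
    rw [h3.fderiv_eq, (hA'.clm_apply hB.hasFDerivAt).fderiv]
    simp [add_comm]
  have hJz : f' z = J (f z) := hf'.self_of_nhds
  unfold lowerHessian
  rw [lowerChristoffel_pullback hs (hfs z) hx' hJ hJs hG hGs hK, h2, hz, hJz,
    hK.self_of_nhdsWithin (hfs z)]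
  simp only [map_add, add_apply, ContinuousLinearMap.comp_apply]
  ring

end VectorSpace

/-! ### Adding a multiple of the square of a 1-form to the metric. -/

section VectorSpace

variable {E : Type*} [NormedAddCommGroup E] [NormedSpace ℝ E]
  {F : Type*} [NormedAddCommGroup F] [NormedSpace ℝ F]

/-- A term `a² θ ⊗ θ` does not contribute to the covariant second derivatives in the kernel
of `θ`. -/
theorem lowerHessian_add_sq_of_ker [FiniteDimensional ℝ E] {K K₁ : E → E →L[ℝ] E →L[ℝ] ℝ}
    {s : Set E} {f : F → E} {z : F} (hs : UniqueDiffWithinAt ℝ s (f z)) (hz : f z ∈ s)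
    {a : E → ℝ} {θ : E → E →L[ℝ] ℝ} (hK₁ : DifferentiableWithinAt ℝ K₁ s (f z))
    (ha : DifferentiableWithinAt ℝ a s (f z)) (hθ : DifferentiableWithinAt ℝ θ s (f z))
    (hK : ∀ᶠ y in 𝓝[s] f z, ∀ u v, K y u v = K₁ y u v + a y * (θ y u * θ y v))
    {u v : F} {w : E} (hw : θ (f z) w = 0) (hu : θ (f z) (fderiv ℝ f z u) = 0)
    (hv : θ (f z) (fderiv ℝ f z v) = 0) :
    DifferentiableWithinAt ℝ K s (f z) ∧ lowerHessian K s f z u v w = lowerHessian K₁ s f z u v w := by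
  have h1 : ∀ b c : E, DifferentiableWithinAt ℝ
      (fun y => K₁ y b c + a y * (θ y b * θ y c)) s (f z) := by
    intro b c
    have h2 : ∀ b, DifferentiableWithinAt ℝ (fun y => θ y b) s (f z) := fun b =>
      hθ.clm_apply (differentiableWithinAt_const b)
    exact ((hK₁.clm_apply (differentiableWithinAt_const b)).clm_apply
      (differentiableWithinAt_const c)).add (ha.mul ((h2 b).mul (h2 c)))
  have hKd : DifferentiableWithinAt ℝ K s (f z) :=
    differentiableWithinAt_of_clm_apply fun b => differentiableWithinAt_of_clm_apply fun c =>
      (h1 b c).congr_of_eventuallyEq (hK.mono fun _ h => h b c) (hK.self_of_nhdsWithin hz b c)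
  refine ⟨hKd, ?_⟩
  -- Every term in the derivative of a θ(c) θ(d) keeps an undifferentiated factor θ(c) or θ(d), and
  -- both vanish at the point. Neither the derivative of a nor that of θ survives.
  have key : ∀ b c d : E, θ (f z) c = 0 → θ (f z) d = 0 →
      fderivWithin ℝ K s (f z) b c d = fderivWithin ℝ K₁ s (f z) b c d := by
    intro b c d hc hd
    have e1 := fderivWithin_clm_apply₂ hs hKd c d
    have e2 := fderivWithin_clm_apply₂ hs hK₁ c d
    have hE : (fun y => K y c d) =ᶠ[𝓝[s] f z] fun y => K₁ y c d + a y * (θ y c * θ y d) :=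
      hK.mono fun _ h => h c d
    have hθ' : ∀ b, HasFDerivWithinAt (fun y => θ y b) ((fderivWithin ℝ θ s (f z)).flip b) s (f z) :=
      fun b => (hθ.hasFDerivWithinAt.clm_apply (hasFDerivWithinAt_const b _ _)).congr_fderiv
        (by ext; simp)
    have hc1 := ((hK₁.hasFDerivWithinAt.clm_apply (hasFDerivWithinAt_const c _ _)).clm_apply
      (hasFDerivWithinAt_const d _ _)).add
        (ha.hasFDerivWithinAt.mul ((hθ' c).mul (hθ' d)))
    have e3 := (hc1.congr_of_eventuallyEq hE (hK.self_of_nhdsWithin hz c d)).fderivWithin hs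
    have e4 := congrArg (fun L : E →L[ℝ] ℝ => L b) (e1.symm.trans e3)
    simpa [hc, hd] using e4
  unfold lowerHessian lowerChristoffel
  rw [key _ _ _ hw hv, key _ _ _ hw hu, key _ _ _ hu hv, hK.self_of_nhdsWithin hz, hw]
  ring

end VectorSpace

/-! ### Metric coefficients and surfaces in charts. -/

section Charts

variable {E : Type*} [NormedAddCommGroup E] [NormedSpace ℝ E]
  {H : Type*} [TopologicalSpace H] {I : ModelWithCorners ℝ E H}
  {M : Type*} [TopologicalSpace M] [ChartedSpace H M]
  {E' : Type*} [NormedAddCommGroup E'] [NormedSpace ℝ E']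
  {H' : Type*} [TopologicalSpace H'] {I' : ModelWithCorners ℝ E' H'}
  {M' : Type*} [TopologicalSpace M'] [ChartedSpace H' M']

/-- The derivative of `f` at `x`, as a map between the model vector spaces. -/
def differential (I : ModelWithCorners ℝ E H) (I' : ModelWithCorners ℝ E' H') (f : M → M') (x : M) :
    E →L[ℝ] E' :=
  mfderiv I I' f x

/-- The bilinear form `g p` on the model vector space. -/
def metricAt [FiniteDimensional ℝ E] (g : TwoTensor I M) (p : M) : E →L[ℝ] E →L[ℝ] ℝ :=
  LinearMap.toContinuousBilinearMap (show E →ₗ[ℝ] E →ₗ[ℝ] ℝ from g p)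

/-- The expression of `f` in the charts centred at `x` and `f x`. -/
def chartRep (I : ModelWithCorners ℝ E H) (I' : ModelWithCorners ℝ E' H') (f : M → M') (x : M)
    (y : E) : E' :=
  extChartAt I' (f x) (f ((extChartAt I x).symm y))

theorem chartRep_mem_range (f : M → M') (x : M) (y : E) : chartRep I I' f x y ∈ range I' := by
  simp [chartRep, extChartAt]

theorem chartRep_self (f : M → M') (x : M) :
    chartRep I I' f x (extChartAt I x x) = extChartAt I' (f x) (f x) := by
  simp [chartRep]

theorem fderivWithin_chartRep {f : M → M'} {x : M} (hf : MDifferentiableAt I I' f x) :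
    fderivWithin ℝ (chartRep I I' f x) (range I) (extChartAt I x x) = differential I I' f x :=
  hf.mfderiv.symm

theorem contDiffWithinAt_chartRep {f : M → M'} {x : M} {n : ℕ∞ω} (hf : ContMDiffAt I I' n f x) :
    ContDiffWithinAt ℝ n (chartRep I I' f x) (range I) (extChartAt I x x) :=
  (contMDiffAt_iff.mp hf).2

theorem chartRep_comp {E'' : Type*} [NormedAddCommGroup E''] [NormedSpace ℝ E'']
    {H'' : Type*} [TopologicalSpace H''] {I'' : ModelWithCorners ℝ E'' H''}
    {M'' : Type*} [TopologicalSpace M''] [ChartedSpace H'' M'']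
    {f : M → M'} {x : M} (hf : ContinuousAt f x) (J : M' → M'') :
    chartRep I I'' (J ∘ f) x =ᶠ[𝓝[range I] (extChartAt I x x)]
      chartRep I' I'' J (f x) ∘ chartRep I I' f x := by
  have h1 : Filter.Tendsto (fun y => f ((extChartAt I x).symm y)) (𝓝[range I] (extChartAt I x x))
      (𝓝 (f x)) := by
    have h2 := (continuousAt_extChartAt_symm (I := I) x).tendsto
    rw [extChartAt_to_inv] at h2
    exact (hf.tendsto.comp h2).mono_left nhdsWithin_le_nhds
  filter_upwards [h1.eventually (extChartAt_source_mem_nhds (I := I') (f x))] with y hy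
  simp only [chartRep, Function.comp_apply, (extChartAt I' (f x)).left_inv hy]

variable {S : Type*} [TopologicalSpace S] [ChartedSpace (EuclideanSpace ℝ (Fin 2)) S]

theorem contDiffAt_chartRep {f : S → M} {s : S} {n : ℕ∞ω} (hf : ContMDiffAt (𝓡 2) I n f s) :
    ContDiffAt ℝ n (chartRep (𝓡 2) I f s) (extChartAt (𝓡 2) s s) := by
  have := contDiffWithinAt_chartRep hf
  simpa [contDiffWithinAt_univ] using this

theorem fderiv_chartRep {f : S → M} {s : S} (hf : MDifferentiableAt (𝓡 2) I f s) :
    fderiv ℝ (chartRep (𝓡 2) I f s) (extChartAt (𝓡 2) s s) = differential (𝓡 2) I f s := by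
  have := fderivWithin_chartRep hf
  simpa [fderivWithin_univ] using this

variable [IsManifold I 1 M] [IsManifold I' 1 M']

/-- The manifold derivative at q is the coordinate derivative in the charts centred at q and J q.
Passing to other charts composes it with a coordinate change on each side. -/
theorem hasFDerivWithinAt_in_charts {J : M → M'} {x : M} {p : M'} {y : E} {q : M}
    (hy : y ∈ (extChartAt I x).target) (hq : (extChartAt I x).symm y = q)
    (hp : J q ∈ (extChartAt I' p).source) (hJ : MDifferentiableAt I I' J q) :
    HasFDerivWithinAt (fun y => extChartAt I' p (J ((extChartAt I x).symm y)))
      ((tangentCoordChange I' (J q) p (J q)).comp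
        ((show E →L[ℝ] E' from mfderiv I I' J q).comp (tangentCoordChange I x q q))) (range I) y := by
  have hqx : q ∈ (extChartAt I x).source := hq ▸ (extChartAt I x).map_target hy
  have hyq : extChartAt I x q = y := by rw [← hq, (extChartAt I x).right_inv hy]
  have h1 := hasFDerivWithinAt_tangentCoordChange (I := I) (x := x) (y := q) (z := q)
    ⟨hqx, mem_extChartAt_source q⟩
  have h2 : HasFDerivWithinAt (chartRep I I' J q) (show E →L[ℝ] E' from mfderiv I I' J q)
    (range I) (extChartAt I q q) := hJ.hasMFDerivAt.2
  have h3 := hasFDerivWithinAt_tangentCoordChange (I := I') (x := J q) (y := p) (z := J q)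
    ⟨mem_extChartAt_source _, hp⟩
  rw [hyq] at h1
  have e1 : (extChartAt I q ∘ (extChartAt I x).symm) y = extChartAt I q q := by
    rw [Function.comp_apply, hq]
  rw [← e1] at h2
  have h4 := h2.comp y h1 (fun a _ => by simp [extChartAt])
  have e2 : (chartRep I I' J q ∘ (extChartAt I q ∘ (extChartAt I x).symm)) y
      = extChartAt I' (J q) (J q) := by
    simp only [chartRep, Function.comp_apply, hq, extChartAt_to_inv]
  rw [← e2] at h3
  have h5 := h3.comp y h4 (fun a _ => chartRep_mem_range _ _ _)
  have hsymm : Filter.Tendsto (extChartAt I x).symm (𝓝[range I] y) (𝓝 q) := by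
    have := (continuousAt_extChartAt_symm'' (I := I) hy).tendsto
    rw [hq] at this
    exact this.mono_left nhdsWithin_le_nhds
  refine h5.congr_of_eventuallyEq ?_ ?_
  · filter_upwards [hsymm.eventually (extChartAt_source_mem_nhds (I := I) q),
      (hJ.continuousAt.tendsto.comp hsymm).eventually
        (extChartAt_source_mem_nhds (I := I') (J q))] with a ha ha'
    simp only [Function.comp_apply] at ha'
    simp only [chartRep, Function.comp_apply, (extChartAt I q).left_inv ha, (extChartAt I' (J q)).left_inv ha']
  · simp only [chartRep, Function.comp_apply, hq, extChartAt_to_inv]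

theorem inChart_eq (g : TwoTensor I M) {p q : M} {y : E} (hq : (extChartAt I p).symm y = q)
    (u v : E) :
    inChart g p y u v = g q (tangentCoordChange I p q q u) (tangentCoordChange I p q q v) := by
  subst hq; rfl

theorem inChart_self (g : TwoTensor I M) (p : M) (u v : E) :
    inChart g p (extChartAt I p p) u v = g p u v := by
  rw [inChart_eq g (extChartAt_to_inv p), tangentCoordChange_self (mem_extChartAt_source p),
    tangentCoordChange_self (mem_extChartAt_source p)]

/-- The coordinate change into the chart at p, produced by differentiating J in fixed charts, is
undone by the one built into `inChart`. The formula is needed away from the centre of the chart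
because the coefficients are differentiated later. -/
theorem inChart_pullback (g : TwoTensor I' M') {J : M → M'} {x : M} {p : M'} {y : E}
    (hy : y ∈ (extChartAt I x).target) (hp : J ((extChartAt I x).symm y) ∈ (extChartAt I' p).source)
    (hJ : MDifferentiableAt I I' J ((extChartAt I x).symm y)) (u v : E) :
    inChart (pullback I J g) x y u v =
      inChart g p (extChartAt I' p (J ((extChartAt I x).symm y)))
        (fderivWithin ℝ (fun y => extChartAt I' p (J ((extChartAt I x).symm y))) (range I) y u)
        (fderivWithin ℝ (fun y => extChartAt I' p (J ((extChartAt I x).symm y))) (range I) y v) := by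
  rw [(hasFDerivWithinAt_in_charts hy rfl hp hJ).fderivWithin
    (I.uniqueDiffOn y (extChartAt_target_subset_range x hy)),
    inChart_eq g ((extChartAt I' p).left_inv hp)]
  have key : ∀ w : E', tangentCoordChange I' p (J ((extChartAt I x).symm y))
      (J ((extChartAt I x).symm y)) (tangentCoordChange I' (J ((extChartAt I x).symm y)) p
      (J ((extChartAt I x).symm y)) w) = w := by
    intro w
    rw [tangentCoordChange_comp ⟨⟨mem_extChartAt_source _, hp⟩, mem_extChartAt_source _⟩,
      tangentCoordChange_self (mem_extChartAt_source _)]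
  simp only [ContinuousLinearMap.comp_apply]
  rw [key, key]
  rfl

variable [FiniteDimensional ℝ E] [FiniteDimensional ℝ E']

/-- The coefficients of `g` in the chart centred at `p`, as a continuous bilinear form. -/
def metricCoeff (g : TwoTensor I M) (p : M) (y : E) : E →L[ℝ] E →L[ℝ] ℝ :=
  LinearMap.toContinuousBilinearMap (LinearMap.compl₁₂
    (show E →ₗ[ℝ] E →ₗ[ℝ] ℝ from g ((extChartAt I p).symm y))
    (tangentCoordChange I p ((extChartAt I p).symm y) ((extChartAt I p).symm y)).toLinearMap
    (tangentCoordChange I p ((extChartAt I p).symm y) ((extChartAt I p).symm y)).toLinearMap)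

theorem metricCoeff_apply (g : TwoTensor I M) (p : M) (y u v : E) :
    metricCoeff g p y u v = inChart g p y u v := rfl

theorem metricCoeff_self (g : TwoTensor I M) (p : M) :
    metricCoeff g p (extChartAt I p p) = metricAt g p := by
  ext u v
  exact inChart_self g p u v

theorem IsSmooth.differentiableWithinAt_metricCoeff {g : TwoTensor I M} (hg : IsSmooth g) (p : M) :
    DifferentiableWithinAt ℝ (metricCoeff g p) (range I) (extChartAt I p p) :=
  differentiableWithinAt_of_clm_apply fun u => differentiableWithinAt_of_clm_apply fun v =>
    ((hg p u v _ (mem_extChartAt_target p)).differentiableWithinAt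
      (by simp)).mono_of_mem_nhdsWithin (extChartAt_target_mem_nhdsWithin p)

theorem eventually_metricCoeff_pullback (g : TwoTensor I' M') {J : M → M'} {x : M}
    (hJ : ∀ᶠ q in 𝓝 x, MDifferentiableAt I I' J q) :
    ∀ᶠ y in 𝓝[range I] (extChartAt I x x), ∀ u v,
      metricCoeff (pullback I J g) x y u v = metricCoeff g (J x) (chartRep I I' J x y)
        (fderivWithin ℝ (chartRep I I' J x) (range I) y u)
        (fderivWithin ℝ (chartRep I I' J x) (range I) y v) := by
  have hsymm : Filter.Tendsto (extChartAt I x).symm (𝓝[range I] (extChartAt I x x)) (𝓝 x) := by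
    have := (continuousAt_extChartAt_symm (I := I) x).tendsto
    rw [extChartAt_to_inv] at this
    exact this.mono_left nhdsWithin_le_nhds
  filter_upwards [hsymm.eventually hJ, extChartAt_target_mem_nhdsWithin (I := I) x,
    (hJ.self_of_nhds.continuousAt.tendsto.comp hsymm).eventually
      (extChartAt_source_mem_nhds (I := I') (J x))] with y h1 h2 h3 u v
  exact inChart_pullback g h2 h3 h1 u v

/-- The pairing `⟨∇_u ∂_v f, w⟩` for a surface `f`, in the charts centred at `s` and `f s`. -/
def surfaceHessian (g : TwoTensor I M) (f : S → M) (s : S) (u v : EuclideanSpace ℝ (Fin 2))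
    (w : E) : ℝ :=
  lowerHessian (metricCoeff g (f s)) (range I) (chartRep (𝓡 2) I f s) (extChartAt (𝓡 2) s s) u v w

/-- The chart form of `lowerHessian_pullback`. No rank condition on J is imposed: it serves both for
the inclusion of Ω and for the spatial part of φ, whose pulled back form is degenerate. -/
theorem surfaceHessian_pullback (g : TwoTensor I' M') {J : M → M'} {f : S → M} {s : S}
    (hf : ContMDiffAt (𝓡 2) I ∞ f s) (hJ : ContMDiffAt I I' ∞ J (f s))
    (hJ' : ∀ᶠ q in 𝓝 (f s), MDifferentiableAt I I' J q)
    (hg : DifferentiableWithinAt ℝ (metricCoeff g (J (f s))) (range I')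
      (extChartAt I' (J (f s)) (J (f s))))
    (hgs : ∀ u v, metricAt g (J (f s)) u v = metricAt g (J (f s)) v u) (u v : EuclideanSpace ℝ (Fin 2)) (w : E) :
    surfaceHessian (pullback I J g) f s u v w =
      surfaceHessian g (J ∘ f) s u v (differential I I' J (f s) w) := by
  have hself : chartRep (𝓡 2) I f s (extChartAt (𝓡 2) s s) = extChartAt I (f s) (f s) :=
    chartRep_self _ _
  have hself' : chartRep I I' J (f s) (extChartAt I (f s) (f s)) =
    extChartAt I' (J (f s)) (J (f s)) := chartRep_self _ _
  rw [← fderivWithin_chartRep hJ'.self_of_nhds, ← hself]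
  refine lowerHessian_pullback I.uniqueDiffOn (I.range_subset_closure_interior
    (chartRep_mem_range _ _ _)) ((contDiffAt_chartRep hf).of_le ENat.LEInfty.out)
    (chartRep_mem_range _ _) ?_ (fun y _ => chartRep_mem_range _ _ _) ?_ ?_ ?_ ?_ u v w
  · rw [hself]
    exact (contDiffWithinAt_chartRep hJ).of_le ENat.LEInfty.out
  · rw [hself, hself']; exact hg
  · intro a b
    rw [hself, hself']
    simpa only [metricCoeff_self, Function.comp_apply] using hgs a b
  · rw [hself]; exact eventually_metricCoeff_pullback g hJ'
  · simpa [nhdsWithin_univ] using chartRep_comp (I := 𝓡 2) (I' := I) (I'' := I') hf.continuousAt J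

end Charts

/-! ### Contraction of a skew form with the inverse metric and the volume form. -/

section Algebra

variable {V : Type*} [AddCommGroup V] [Module ℝ V]

theorem alternating_fin_four_swap_first (D : V [⋀^Fin 4]→ₗ[ℝ] ℝ) (a b c d : V) :
    D ![b, a, c, d] = -D ![a, b, c, d] := by
  have h := D.map_swap ![a, b, c, d] (i := 0) (j := 1) (by decide)
  rw [← h]
  congr 1
  ext i
  fin_cases i <;> rfl

theorem alternating_fin_four_swap_middle (D : V [⋀^Fin 4]→ₗ[ℝ] ℝ) (a b c d : V) :
    D ![a, c, b, d] = -D ![a, b, c, d] := by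
  have h := D.map_swap ![a, b, c, d] (i := 1) (j := 2) (by decide)
  rw [← h]
  congr 1
  ext i
  fin_cases i <;> rfl

theorem alternating_fin_four_swap_last (D : V [⋀^Fin 4]→ₗ[ℝ] ℝ) (a b c d : V) :
    D ![a, b, d, c] = -D ![a, b, c, d] := by
  have h := D.map_swap ![a, b, c, d] (i := 2) (j := 3) (by decide)
  rw [← h]
  congr 1
  ext i
  fin_cases i <;> rfl

/-- A contraction with `G⁻¹` on both sides may be computed in any frame `e`. -/
theorem sum_inv_contraction_eq_sum_frame (D : V [⋀^Fin 4]→ₗ[ℝ] ℝ) (σ e : Fin 4 → V)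
    (G A E B : Matrix (Fin 4) (Fin 4) ℝ) (he : ∀ μ, e μ = ∑ a, E a μ • σ a)
    (hB : E.transpose * G * E * B = 1) (x y : V) :
    ∑ a, ∑ b, (∑ d, G⁻¹ a d * A d b) * ∑ β, G⁻¹ b β * D ![σ a, σ β, x, y]
      = ∑ μ, ∑ ν, (B * (E.transpose * A * E) * B) μ ν * D ![e μ, e ν, x, y] := by
  -- The hypothesis says that Eᵀ and G E B are inverse to each other; commuting them gives G (E B
  -- Eᵀ) = 1.
  have hG : G⁻¹ = E * B * E.transpose := by
    refine Matrix.inv_eq_right_inv ?_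
    have h : E.transpose * (G * E * B) = 1 := by simpa only [Matrix.mul_assoc] using hB
    have h' := mul_eq_one_comm.mp h
    simpa only [Matrix.mul_assoc] using h'
  set X := B * (E.transpose * A * E) * B with hX
  have h1 : G⁻¹ * A * G⁻¹ = E * X * E.transpose := by
    rw [hG, hX]
    simp only [Matrix.mul_assoc]
  let W : V →ₗ[ℝ] V →ₗ[ℝ] ℝ := LinearMap.mk₂ ℝ (fun u v => D ![u, v, x, y])
    (fun _ _ _ => D.map_vecCons_add _ _ _) (fun _ _ _ => D.map_vecCons_smul _ _ _)
    (fun u _ _ => (D.curryLeft u).map_vecCons_add _ _ _)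
    (fun _ u _ => (D.curryLeft u).map_vecCons_smul _ _ _)
  have hW : ∀ u v, D ![u, v, x, y] = W u v := fun u v => rfl
  have h2 : ∀ μ ν, W (e μ) (e ν) = ∑ a, ∑ β, E a μ * (E β ν * W (σ a) (σ β)) := by
    intro μ ν
    simp only [he, map_sum, map_smul, LinearMap.sum_apply, LinearMap.smul_apply, smul_eq_mul,
      Finset.mul_sum]
    rw [Finset.sum_comm]
    refine Finset.sum_congr rfl fun _ _ => Finset.sum_congr rfl fun _ _ => ?_
    ring
  have h3 : ∀ a β, ∑ b, (∑ d, G⁻¹ a d * A d b) * G⁻¹ b β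
      = ∑ μ, ∑ ν, E a μ * X μ ν * E β ν := by
    intro a β
    have h4 := congrFun (congrFun h1 a) β
    simp only [Matrix.mul_apply (M := G⁻¹ * A), Matrix.mul_apply (M := G⁻¹),
      Matrix.mul_apply (M := E * X), Matrix.mul_apply (M := E), Matrix.transpose_apply] at h4
    rw [h4, Finset.sum_comm]
    simp only [Finset.sum_mul]
  calc _ = ∑ a, ∑ β, (∑ b, (∑ d, G⁻¹ a d * A d b) * G⁻¹ b β) * W (σ a) (σ β) := by
        refine Finset.sum_congr rfl fun a _ => ?_
        simp only [hW, Finset.mul_sum, Finset.sum_mul]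
        rw [Finset.sum_comm]
        refine Finset.sum_congr rfl fun _ _ => Finset.sum_congr rfl fun _ _ =>
          Finset.sum_congr rfl fun _ _ => ?_
        ring
    _ = ∑ a, ∑ β, ∑ μ, ∑ ν, X μ ν * (E a μ * (E β ν * W (σ a) (σ β))) := by
        refine Finset.sum_congr rfl fun a _ => Finset.sum_congr rfl fun β _ => ?_
        rw [h3]
        simp only [Finset.sum_mul]
        refine Finset.sum_congr rfl fun _ _ => Finset.sum_congr rfl fun _ _ => ?_
        ring
    _ = ∑ μ, ∑ ν, ∑ a, ∑ β, X μ ν * (E a μ * (E β ν * W (σ a) (σ β))) := by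
        rw [Finset.sum_congr rfl fun a _ => Finset.sum_comm, Finset.sum_comm]
        refine Finset.sum_congr rfl fun μ _ => ?_
        rw [Finset.sum_congr rfl fun a _ => Finset.sum_comm, Finset.sum_comm]
    _ = _ := by
        simp only [hW, h2, Finset.mul_sum]

/-- The inverse of a Gram matrix of the form `diag(a, 1, h)`. -/
def blockInv (a : ℝ) (h : Matrix (Fin 2) (Fin 2) ℝ) : Matrix (Fin 4) (Fin 4) ℝ :=
  !![a⁻¹, 0, 0, 0; 0, 1, 0, 0; 0, 0, h⁻¹ 0 0, h⁻¹ 0 1; 0, 0, h⁻¹ 1 0, h⁻¹ 1 1]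

/-- In the application the frame is (N, n, z₀, z₁), a is the square g(N, N) and h is the induced
metric of the surface. -/
def blockGram (a : ℝ) (h : Matrix (Fin 2) (Fin 2) ℝ) : Matrix (Fin 4) (Fin 4) ℝ :=
  !![a, 0, 0, 0; 0, 1, 0, 0; 0, 0, h 0 0, h 0 1; 0, 0, h 1 0, h 1 1]

theorem blockGram_mul_blockInv {a : ℝ} (ha : a ≠ 0) {h : Matrix (Fin 2) (Fin 2) ℝ}
    (hh : h.det ≠ 0) : blockGram a h * blockInv a h = 1 := by
  have h1 : h * h⁻¹ = 1 := Matrix.mul_nonsing_inv h (isUnit_iff_ne_zero.mpr hh)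
  have e : ∀ i j, h i 0 * h⁻¹ 0 j + h i 1 * h⁻¹ 1 j = (1 : Matrix (Fin 2) (Fin 2) ℝ) i j := by
    intro i j
    rw [← h1, Matrix.mul_apply, Fin.sum_univ_two]
  have e00 := e 0 0
  have e01 := e 0 1
  have e10 := e 1 0
  have e11 := e 1 1
  ext i j
  fin_cases i <;> fin_cases j <;>
    simp [blockGram, blockInv, Matrix.mul_apply, Fin.sum_univ_four, ha] <;>
    simpa using by assumption

theorem det_blockGram (a : ℝ) (h : Matrix (Fin 2) (Fin 2) ℝ) :
    (blockGram a h).det = a * h.det := by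
  simp [blockGram, Matrix.det_succ_row_zero, Fin.sum_univ_succ]

/-- The algebraic core: the contraction of a pair of antisymmetric forms with the inverse metric
and the volume form, in a frame `e` with Gram matrix `diag(a, 1, h)`. -/
theorem sum_inv_contraction_eq_trace (D : V [⋀^Fin 4]→ₗ[ℝ] ℝ) (σ e : Fin 4 → V)
    (G E : Matrix (Fin 4) (Fin 4) ℝ) (A : Fin 2 → Matrix (Fin 4) (Fin 4) ℝ)
    (he : ∀ μ, e μ = ∑ a, E a μ • σ a)
    {a : ℝ} (ha : a ≠ 0) {h : Matrix (Fin 2) (Fin 2) ℝ} (hh : h.det ≠ 0) (hs : h.IsSymm)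
    (hG : E.transpose * G * E = blockGram a h)
    (hA : ∀ i, (A i).transpose = -A i) :
    (∑ a, ∑ b, (∑ d, G⁻¹ a d * A 0 d b) * ∑ β, G⁻¹ b β * D ![σ a, σ β, e 0, e 3])
      - (∑ a, ∑ b, (∑ d, G⁻¹ a d * A 1 d b) * ∑ β, G⁻¹ b β * D ![σ a, σ β, e 0, e 2])
      = 2 * D ![e 0, e 1, e 2, e 3] * ∑ i, ((E.transpose * A i * E) 1 2 * h⁻¹ i 0
          + (E.transpose * A i * E) 1 3 * h⁻¹ i 1) := by
  have hB : E.transpose * G * E * blockInv a h = 1 := by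
    rw [hG, blockGram_mul_blockInv ha hh]
  have hsi : h⁻¹ 1 0 = h⁻¹ 0 1 := by
    have : h⁻¹.transpose = h⁻¹ := by rw [Matrix.transpose_nonsing_inv, hs.eq]
    exact congrFun (congrFun this 0) 1
  have hA' : ∀ i μ ν, (E.transpose * A i * E) ν μ = -(E.transpose * A i * E) μ ν := by
    intro i μ ν
    have h1 : (E.transpose * A i * E).transpose = -(E.transpose * A i * E) := by
      rw [Matrix.transpose_mul, Matrix.transpose_mul, hA, Matrix.transpose_transpose]
      simp [Matrix.mul_assoc]
    exact congrFun (congrFun h1 μ) ν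
  rw [sum_inv_contraction_eq_sum_frame D σ e G (A 0) E _ he hB,
    sum_inv_contraction_eq_sum_frame D σ e G (A 1) E _ he hB]
  set C0 := E.transpose * A 0 * E with hC0
  set C1 := E.transpose * A 1 * E with hC1
  -- With e 0 and e 3 in the last two slots, only the orderings of e 1, e 2 give a nonzero value in
  -- the first two; with e 0 and e 2 there, only those of e 1, e 3.
  have z : ∀ (v : Fin 4 → V) (i j : Fin 4), v i = v j → i ≠ j → D v = 0 := fun v i j h h' =>
    D.map_eq_zero_of_eq v h h'
  have d1 : D ![e 1, e 2, e 0, e 3] = D ![e 0, e 1, e 2, e 3] := by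
    rw [alternating_fin_four_swap_middle, alternating_fin_four_swap_first, neg_neg]
  have d2 : D ![e 2, e 1, e 0, e 3] = -D ![e 0, e 1, e 2, e 3] := by
    rw [alternating_fin_four_swap_first, d1]
  have d3 : D ![e 1, e 3, e 0, e 2] = -D ![e 0, e 1, e 2, e 3] := by
    rw [alternating_fin_four_swap_middle, alternating_fin_four_swap_first,
      alternating_fin_four_swap_last, neg_neg]
  have d4 : D ![e 3, e 1, e 0, e 2] = D ![e 0, e 1, e 2, e 3] := by
    rw [alternating_fin_four_swap_first, d3, neg_neg]
  have k1 : ∀ v, D ![e 0, v, e 0, e 3] = 0 := fun v => z _ 0 2 rfl (by decide)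
  have k2 : ∀ v, D ![v, e 0, e 0, e 3] = 0 := fun v => z _ 1 2 rfl (by decide)
  have k3 : ∀ v, D ![v, e 3, e 0, e 3] = 0 := fun v => z _ 1 3 rfl (by decide)
  have k4 : ∀ v, D ![e 3, v, e 0, e 3] = 0 := fun v => z _ 0 3 rfl (by decide)
  have k5 : ∀ v, D ![e 0, v, e 0, e 2] = 0 := fun v => z _ 0 2 rfl (by decide)
  have k6 : ∀ v, D ![v, e 0, e 0, e 2] = 0 := fun v => z _ 1 2 rfl (by decide)
  have k7 : ∀ v, D ![v, e 2, e 0, e 2] = 0 := fun v => z _ 1 3 rfl (by decide)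
  have k8 : ∀ v, D ![e 2, v, e 0, e 2] = 0 := fun v => z _ 0 3 rfl (by decide)
  have k9 : ∀ v p q, D ![v, v, p, q] = 0 := fun v _ _ => z _ 0 1 rfl (by decide)
  simp only [Fin.sum_univ_four, Fin.sum_univ_two, k1, k2, k3, k4, k5, k6, k7, k8, k9, d1, d2, d3,
    d4, mul_zero, zero_add, add_zero]
  -- Only the mixed normal-tangential entries are needed. The entry a⁻¹ of the inverse does not
  -- occur in them, and skewness makes the two orderings of each pair contribute equally: this is
  -- the factor 2.
  have x12 : ∀ C : Matrix (Fin 4) (Fin 4) ℝ, (blockInv a h * C * blockInv a h) 1 2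
      = C 1 2 * h⁻¹ 0 0 + C 1 3 * h⁻¹ 1 0 := by
    intro C
    simp [blockInv, Matrix.mul_apply, Matrix.vecMul, dotProduct, Fin.sum_univ_four]
  have x21 : ∀ C : Matrix (Fin 4) (Fin 4) ℝ, (blockInv a h * C * blockInv a h) 2 1
      = h⁻¹ 0 0 * C 2 1 + h⁻¹ 0 1 * C 3 1 := by
    intro C
    simp [blockInv, Matrix.mul_apply, Matrix.vecMul, dotProduct, Fin.sum_univ_four]
  have x13 : ∀ C : Matrix (Fin 4) (Fin 4) ℝ, (blockInv a h * C * blockInv a h) 1 3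
      = C 1 2 * h⁻¹ 0 1 + C 1 3 * h⁻¹ 1 1 := by
    intro C
    simp [blockInv, Matrix.mul_apply, Matrix.vecMul, dotProduct, Fin.sum_univ_four]
  have x31 : ∀ C : Matrix (Fin 4) (Fin 4) ℝ, (blockInv a h * C * blockInv a h) 3 1
      = h⁻¹ 1 0 * C 2 1 + h⁻¹ 1 1 * C 3 1 := by
    intro C
    simp [blockInv, Matrix.mul_apply, Matrix.vecMul, dotProduct, Fin.sum_univ_four]
  rw [x12, x21, x13, x31, hsi, hC0, hC1, hA' 0 1 2, hA' 0 1 3, hA' 1 1 2, hA' 1 1 3]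
  ring

/-- The trace of `L` with respect to `h` does not depend on the basis. -/
theorem sum_inv_mul_congr {n : ℕ} (h L P : Matrix (Fin n) (Fin n) ℝ) (hP : P.det ≠ 0) :
    ∑ i, ∑ j, (P.transpose * h * P)⁻¹ i j * (P.transpose * L * P) i j
      = ∑ i, ∑ j, h⁻¹ i j * L i j := by
  -- Written as traces of products, the two sides agree by cyclicity, which cancels P against P⁻¹.
  have tr : ∀ A B : Matrix (Fin n) (Fin n) ℝ,
      ∑ i, ∑ j, A i j * B i j = (A * B.transpose).trace := by
    intro A B
    simp [Matrix.trace, Matrix.mul_apply]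
  have hu : IsUnit P.det := isUnit_iff_ne_zero.mpr hP
  have hu' : IsUnit P.transpose.det := by rwa [Matrix.det_transpose]
  rw [tr, tr, Matrix.mul_inv_rev, Matrix.mul_inv_rev, Matrix.transpose_mul, Matrix.transpose_mul,
    Matrix.transpose_transpose]
  have e : P⁻¹ * (h⁻¹ * P.transpose⁻¹) * (P.transpose * (L.transpose * P))
      = P⁻¹ * (h⁻¹ * L.transpose * P) := by
    simp only [Matrix.mul_assoc, Matrix.nonsing_inv_mul_cancel_left _ _ hu']
  rw [e, Matrix.trace_mul_comm, Matrix.mul_assoc, Matrix.mul_nonsing_inv _ hu, Matrix.mul_one]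

end Algebra

/-! ### Comparing two metrics that agree along a surface; linearity of the connection. -/

section VectorSpace

variable {E : Type*} [NormedAddCommGroup E] [NormedSpace ℝ E]
  {F : Type*} [NormedAddCommGroup F] [NormedSpace ℝ F]

/-- If two metrics agree along `f`, so do their derivatives in directions tangent to `f`. -/
theorem fderivWithin_eq_of_eq_along {G K : E → E →L[ℝ] E →L[ℝ] ℝ} {s : Set E} {f : F → E} {z : F}
    (hG : DifferentiableWithinAt ℝ G s (f z)) (hK : DifferentiableWithinAt ℝ K s (f z))
    (hf : DifferentiableAt ℝ f z) (hfs : ∀ y, f y ∈ s) (h : ∀ᶠ y in 𝓝 z, G (f y) = K (f y))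
    (u : F) : fderivWithin ℝ G s (f z) (fderiv ℝ f z u)
      = fderivWithin ℝ K s (f z) (fderiv ℝ f z u) := by
  have hf' := hasFDerivWithinAt_univ.mpr hf.hasFDerivAt
  have h1 : HasFDerivWithinAt (fun y => G (f y)) _ univ z :=
    HasFDerivWithinAt.comp (g := G) (f := f) z hG.hasFDerivWithinAt hf' (fun a _ => hfs a)
  have h2 : HasFDerivWithinAt (fun y => K (f y)) _ univ z :=
    HasFDerivWithinAt.comp (g := K) (f := f) z hK.hasFDerivWithinAt hf' (fun a _ => hfs a)
  rw [hasFDerivWithinAt_univ] at h1 h2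
  have h3 := h1.unique (h2.congr_of_eventuallyEq h)
  exact congrArg (fun L : F →L[ℝ] E →L[ℝ] E →L[ℝ] ℝ => L u) h3

/-- The Levi-Civita connection is metric. -/
theorem lowerChristoffel_add_swap {G : E → E →L[ℝ] E →L[ℝ] ℝ} {s : Set E} {x : E}
    (hs : UniqueDiffWithinAt ℝ s x) (hG : DifferentiableWithinAt ℝ G s x)
    (hsymm : ∀ y u v, G y u v = G y v u) (u v w : E) :
    lowerChristoffel G s x u v w + lowerChristoffel G s x u w v = fderivWithin ℝ G s x u v w := by
  have key : ∀ a b c, fderivWithin ℝ G s x a b c = fderivWithin ℝ G s x a c b := by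
    intro a b c
    have h1 := fderivWithin_clm_apply₂ hs hG b c
    have h2 := fderivWithin_clm_apply₂ hs hG c b
    have h3 : (fun y => G y b c) = fun y => G y c b := funext fun y => hsymm y b c
    rw [h3, h2] at h1
    exact (congrArg (fun L : E →L[ℝ] ℝ => L a) h1).symm
  unfold lowerChristoffel
  rw [key u w v, key v w u, key w u v]
  ring

theorem lowerChristoffel_sum₃ {ι : Type*} (t : Finset ι) (G : E → E →L[ℝ] E →L[ℝ] ℝ) (s : Set E)
    (x u v : E) (c : ι → ℝ) (w : ι → E) :
    lowerChristoffel G s x u v (∑ i ∈ t, c i • w i)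
      = ∑ i ∈ t, c i * lowerChristoffel G s x u v (w i) := by
  simp only [lowerChristoffel, map_sum, map_smul, sum_apply, smul_apply, smul_eq_mul, Finset.mul_sum,
    ← Finset.sum_add_distrib, ← Finset.sum_sub_distrib]
  exact Finset.sum_congr rfl fun i _ => by ring

theorem lowerChristoffel_sum₂ {ι : Type*} (t : Finset ι) (G : E → E →L[ℝ] E →L[ℝ] ℝ) (s : Set E)
    (x u w : E) (c : ι → ℝ) (v : ι → E) :
    lowerChristoffel G s x u (∑ i ∈ t, c i • v i) w
      = ∑ i ∈ t, c i * lowerChristoffel G s x u (v i) w := by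
  simp only [lowerChristoffel, map_sum, map_smul, sum_apply, smul_apply, smul_eq_mul, Finset.mul_sum,
    ← Finset.sum_add_distrib, ← Finset.sum_sub_distrib]
  exact Finset.sum_congr rfl fun i _ => by ring

theorem lowerChristoffel_sum₁ {ι : Type*} (t : Finset ι) (G : E → E →L[ℝ] E →L[ℝ] ℝ) (s : Set E)
    (x v w : E) (c : ι → ℝ) (u : ι → E) :
    lowerChristoffel G s x (∑ i ∈ t, c i • u i) v w
      = ∑ i ∈ t, c i * lowerChristoffel G s x (u i) v w := by
  simp only [lowerChristoffel, map_sum, map_smul, sum_apply, smul_apply, smul_eq_mul, Finset.mul_sum,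
    ← Finset.sum_add_distrib, ← Finset.sum_sub_distrib]
  exact Finset.sum_congr rfl fun i _ => by ring

end VectorSpace

/-! ### Christoffel symbols and connection forms in coordinates. -/

section Coordinates

variable {n : ℕ} {H : Type*} [TopologicalSpace H]
  {I : ModelWithCorners ℝ (EuclideanSpace ℝ (Fin n)) H}
  {M : Type*} [TopologicalSpace M] [ChartedSpace H M]

theorem sum_smul_stdVec (u : EuclideanSpace ℝ (Fin n)) : ∑ i, u i • stdVec i = u := by
  ext j
  simp [stdVec, Finset.sum_apply, Pi.single_apply]

theorem linearIndependent_stdVec :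
    LinearIndependent ℝ (stdVec : Fin n → EuclideanSpace ℝ (Fin n)) := by
  have h := (EuclideanSpace.basisFun (Fin n) ℝ).toBasis.linearIndependent
  have h1 : ⇑(EuclideanSpace.basisFun (Fin n) ℝ).toBasis = stdVec := by
    ext i : 1
    simp [stdVec]
  rwa [h1] at h

variable [IsManifold I 1 M]

/-- The Levi-Civita connection of `g` with lowered index, in the chart centred at `p`. -/
def lowerConnection (g : TwoTensor I M) (p : M) (u v w : EuclideanSpace ℝ (Fin n)) : ℝ :=
  lowerChristoffel (metricCoeff g p) (range I) (extChartAt I p p) u v w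

theorem gramAt_apply (g : TwoTensor I M) (p : M) (i j : Fin n) :
    gramAt g p i j = metricAt g p (stdVec i) (stdVec j) :=
  inChart_self g p _ _

theorem apply_eq_sum_gramAt (g : TwoTensor I M) (p : M) (u v : EuclideanSpace ℝ (Fin n)) :
    metricAt g p u v = ∑ i, ∑ j, u i * gramAt g p i j * v j := by
  conv_lhs => rw [← sum_smul_stdVec u, ← sum_smul_stdVec v]
  simp only [map_sum, map_smul, sum_apply, smul_apply, smul_eq_mul, Finset.mul_sum]
  rw [Finset.sum_comm]
  refine Finset.sum_congr rfl fun i _ => Finset.sum_congr rfl fun j _ => ?_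
  rw [gramAt_apply]
  ring

theorem christoffel_eq {g : TwoTensor I M} {p : M}
    (hg : DifferentiableWithinAt ℝ (metricCoeff g p) (range I) (extChartAt I p p)) (a b c : Fin n) :
    christoffel g p a b c
      = ∑ d, (gramAt g p)⁻¹ a d * lowerConnection g p (stdVec b) (stdVec c) (stdVec d) := by
  have h : ∀ k i j, dGram g p k i j
      = fderivWithin ℝ (metricCoeff g p) (range I) (extChartAt I p p) (stdVec k) (stdVec i)
        (stdVec j) := by
    intro k i j
    have := fderivWithin_clm_apply₂ (I.uniqueDiffOn _ (extChartAt_target_subset_range p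
      (mem_extChartAt_target p))) hg (stdVec i) (stdVec j)
    exact congrArg (fun L : EuclideanSpace ℝ (Fin n) →L[ℝ] ℝ => L (stdVec k)) this
  simp only [christoffel, lowerConnection, lowerChristoffel, h, Finset.mul_sum]
  exact Finset.sum_congr rfl fun d _ => by ring

theorem connectionForm_eq {g : TwoTensor I M} {p : M}
    (hg : DifferentiableWithinAt ℝ (metricCoeff g p) (range I) (extChartAt I p p)) (a b : Fin n)
    (u : EuclideanSpace ℝ (Fin n)) :
    connectionForm g p a b u
      = ∑ d, (gramAt g p)⁻¹ a d * lowerConnection g p u (stdVec b) (stdVec d) := by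
  have h : ∀ d, lowerConnection g p u (stdVec b) (stdVec d)
      = ∑ c, u c * lowerConnection g p (stdVec c) (stdVec b) (stdVec d) := by
    intro d
    conv_lhs => rw [← sum_smul_stdVec u]
    exact lowerChristoffel_sum₁ _ _ _ _ _ _ _ _
  simp only [connectionForm, christoffel_eq hg, h, Finset.mul_sum]
  rw [Finset.sum_comm]
  refine Finset.sum_congr rfl fun i _ => Finset.sum_congr rfl fun j _ => ?_
  simp only [comp]
  ring

/-- Pairing with the metric cancels the inverse metric in the Christoffel symbols. This is where
nondegeneracy enters the passage to lowered indices. -/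
theorem gramAt_mul_christoffel {g : TwoTensor I M} {p : M}
    (hg : DifferentiableWithinAt ℝ (metricCoeff g p) (range I) (extChartAt I p p))
    (hs : ∀ u v, metricAt g p u v = metricAt g p v u) (hdet : (gramAt g p).det ≠ 0)
    (u v w : EuclideanSpace ℝ (Fin n)) :
    metricAt g p (WithLp.toLp 2 (fun a => ∑ b, ∑ c, christoffel g p a b c * u b * v c)) w = lowerConnection g p u v w := by
  have hsum : ∀ a, ∑ b, ∑ c, christoffel g p a b c * u b * v c
      = ∑ d, (gramAt g p)⁻¹ a d * lowerConnection g p u v (stdVec d) := by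
    intro a
    have h : ∀ d, lowerConnection g p u v (stdVec d)
        = ∑ b, ∑ c, u b * (v c * lowerConnection g p (stdVec b) (stdVec c) (stdVec d)) := by
      intro d
      conv_lhs => rw [← sum_smul_stdVec u, ← sum_smul_stdVec v]
      simp only [lowerConnection, lowerChristoffel_sum₁, lowerChristoffel_sum₂, Finset.mul_sum]
      rw [Finset.sum_comm]
      refine Finset.sum_congr rfl fun _ _ => Finset.sum_congr rfl fun _ _ => ?_
      ring
    simp only [h, christoffel_eq hg, Finset.mul_sum, Finset.sum_mul]
    rw [Finset.sum_comm (s := Finset.univ) (t := Finset.univ)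
      (f := fun d b => ∑ c, (gramAt g p)⁻¹ a d *
        (u b * (v c * lowerConnection g p (stdVec b) (stdVec c) (stdVec d))))]
    refine Finset.sum_congr rfl fun b _ => ?_
    rw [Finset.sum_comm]
    refine Finset.sum_congr rfl fun _ _ => Finset.sum_congr rfl fun _ _ => ?_
    ring
  have hinv : ∀ j d, ∑ i, gramAt g p i j * (gramAt g p)⁻¹ i d = if j = d then 1 else 0 := by
    intro j d
    have h1 := Matrix.mul_nonsing_inv (gramAt g p) (isUnit_iff_ne_zero.mpr hdet)
    have h2 := congrFun (congrFun h1 j) d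
    rw [Matrix.mul_apply, Matrix.one_apply] at h2
    rw [← h2]
    refine Finset.sum_congr rfl fun i _ => ?_
    rw [gramAt_apply, gramAt_apply, hs]
  have hw : lowerConnection g p u v w = ∑ j, w j * lowerConnection g p u v (stdVec j) := by
    conv_lhs => rw [← sum_smul_stdVec w]
    exact lowerChristoffel_sum₃ _ _ _ _ _ _ _ _
  rw [apply_eq_sum_gramAt, hw, Finset.sum_comm]
  refine Finset.sum_congr rfl fun j _ => ?_
  simp only [hsum]
  calc _ = w j * ∑ d, (∑ i, gramAt g p i j * (gramAt g p)⁻¹ i d) *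
        lowerConnection g p u v (stdVec d) := by
        simp only [Finset.mul_sum, Finset.sum_mul]
        rw [Finset.sum_comm]
        refine Finset.sum_congr rfl fun _ _ => Finset.sum_congr rfl fun _ _ => ?_
        ring
    _ = _ := by simp [hinv]

variable {S : Type*} [TopologicalSpace S] [ChartedSpace (EuclideanSpace ℝ (Fin 2)) S]

/-- The first term depends only on the value of the metric at the point, the second on its first
derivatives. For two metrics that agree at the point, the first terms cancel. -/
theorem surfaceHessian_eq (g : TwoTensor I M) {f : S → M} {s : S}
    (hf : MDifferentiableAt (𝓡 2) I f s) (u v : EuclideanSpace ℝ (Fin 2))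
    (w : EuclideanSpace ℝ (Fin n)) :
    surfaceHessian g f s u v w =
      metricAt g (f s) (fderiv ℝ (fun y => fderiv ℝ (chartRep (𝓡 2) I f s) y v)
        (extChartAt (𝓡 2) s s) u) w
      + lowerConnection g (f s) (differential (𝓡 2) I f s u) (differential (𝓡 2) I f s v) w := by
  unfold surfaceHessian lowerHessian
  rw [chartRep_self, fderiv_chartRep hf, metricCoeff_self]
  rfl

end Coordinates

/-! ### Mean curvature through lowered covariant second derivatives. -/

section MeanCurvature

variable {S : Type*} [TopologicalSpace S] [ChartedSpace (EuclideanSpace ℝ (Fin 2)) S]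
  [IsManifold (𝓡 2) 1 S]
  {H : Type*} [TopologicalSpace H] {I : ModelWithCorners ℝ (EuclideanSpace ℝ (Fin 3)) H}
  {P : Type*} [TopologicalSpace P] [ChartedSpace H P] [IsManifold I 1 P]

/-- Replaces the raised Christoffel symbols of the definition by the lowered form, for which
naturality under pull-back is available. -/
theorem meanCurvature_eq {h : TwoTensor I P} {f : S → P} (ν : ∀ s : S, TangentSpace I (f s)) {s : S}
    (hf : MDifferentiableAt (𝓡 2) I f s)
    (hd : DifferentiableWithinAt ℝ (metricCoeff h (f s)) (range I) (extChartAt I (f s) (f s)))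
    (hs : ∀ u v, metricAt h (f s) u v = metricAt h (f s) v u) (hdet : (gramAt h (f s)).det ≠ 0) :
    meanCurvature h f ν s = -∑ i, ∑ j, (gramAt (pullback (𝓡 2) f h) s)⁻¹ i j *
      surfaceHessian h f s (stdVec i) (stdVec j) (ν s) := by
  unfold meanCurvature
  congr 1
  refine Finset.sum_congr rfl fun i _ => Finset.sum_congr rfl fun j _ => ?_
  congr 1
  have h1 : ∀ i, dCoordMap I f s i (extChartAt (𝓡 2) s s) = differential (𝓡 2) I f s (stdVec i) :=
    fun i => congrArg (fun L : EuclideanSpace ℝ (Fin 2) →L[ℝ] EuclideanSpace ℝ (Fin 3) =>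
      L (stdVec i)) (fderiv_chartRep hf)
  have h2 : covHessian h f s i j =
      (fderiv ℝ (fun y => fderiv ℝ (chartRep (𝓡 2) I f s) y (stdVec j)) (extChartAt (𝓡 2) s s)
        (stdVec i)) + (WithLp.toLp 2 (fun a => ∑ b, ∑ c, christoffel h (f s) a b c *
          dCoordMap I f s i (extChartAt (𝓡 2) s s) b *
          dCoordMap I f s j (extChartAt (𝓡 2) s s) c) : EuclideanSpace ℝ (Fin 3)) := rfl
  suffices key : ∀ w : EuclideanSpace ℝ (Fin 3), metricAt h (f s) (covHessian h f s i j) w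
      = surfaceHessian h f s (stdVec i) (stdVec j) w from key (ν s)
  intro w
  rw [surfaceHessian_eq h hf, ← h1, ← h1, ← gramAt_mul_christoffel hd hs hdet, h2,
    map_add, add_apply]

end MeanCurvature

/-! ### Orientation signs of bases. -/

section Orientation

variable {V : Type*} [AddCommGroup V] [Module ℝ V] {n : ℕ}

theorem isPositiveFrame_basis_iff (o : Orientation ℝ V (Fin n)) (b : Module.Basis (Fin n) ℝ V) :
    IsPositiveFrame o b ↔ b.orientation = o := by
  constructor
  · rintro ⟨c, hc, ho⟩
    rw [← ho, DFunLike.coe_injective hc]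
  · exact fun h => ⟨b, rfl, h⟩

/-- The signs of two bases differ by the sign of the transition determinant. This trades the sign of
the coordinate frame in the volume form for the sign of an adapted frame. -/
theorem frameSign_basis (o : Orientation ℝ V (Fin n)) (b c : Module.Basis (Fin n) ℝ V) :
    frameSign o b * |c.det b| = frameSign o c * c.det b := by
  classical
  unfold frameSign
  rw [isPositiveFrame_basis_iff, isPositiveFrame_basis_iff]
  have hd : c.det b ≠ 0 := (c.isUnit_det b).ne_zero
  rcases b.orientation_eq_or_eq_neg o with h | h <;>
    rcases c.orientation_eq_or_eq_neg o with h' | h'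
  · have h1 : 0 < c.det b := (c.orientation_eq_iff_det_pos b).mp (h'.symm.trans h)
    simp [← h, ← h', abs_of_pos h1]
  · have h0 : ¬ c.orientation = o := by
      rw [h']
      exact (Module.Ray.ne_neg_self _)
    have h1 : c.det b < 0 := by
      refine lt_of_le_of_ne (not_lt.mp fun h2 => h0 ?_) hd
      rw [h, (c.orientation_eq_iff_det_pos b).mpr h2]
    simp [← h, h0, abs_of_neg h1]
  · have h0 : ¬ b.orientation = o := by
      rw [h]
      exact (Module.Ray.ne_neg_self _)
    have h1 : c.det b < 0 := by
      refine lt_of_le_of_ne (not_lt.mp fun h2 => h0 ?_) hd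
      rw [h', (c.orientation_eq_iff_det_pos b).mpr h2]
    simp [← h', h0, abs_of_neg h1]
  · have h0 : ¬ b.orientation = o := by
      rw [h]
      exact (Module.Ray.ne_neg_self _)
    have h0' : ¬ c.orientation = o := by
      rw [h']
      exact (Module.Ray.ne_neg_self _)
    have h1 : 0 < c.det b := (c.orientation_eq_iff_det_pos b).mp (neg_injective (h'.symm.trans h))
    simp [h0, h0', abs_of_pos h1]

end Orientation

/-! ### The integrand of the energy in an adapted frame. -/

section Energy

variable {M : Type*} [TopologicalSpace M] [ChartedSpace (EuclideanSpace ℝ (Fin 4)) M]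
  [IsManifold (𝓡 4) 1 M]

/-- The standard basis of the model space. -/
def stdBasis : Module.Basis (Fin 4) ℝ (EuclideanSpace ℝ (Fin 4)) :=
  (EuclideanSpace.basisFun (Fin 4) ℝ).toBasis

theorem stdBasis_apply (i : Fin 4) : stdBasis i = stdVec i := by
  simp [stdBasis, stdVec]

theorem stdBasis_toMatrix (v : Fin 4 → EuclideanSpace ℝ (Fin 4)) :
    stdBasis.toMatrix v = Matrix.of fun i j => v j i := by
  ext i j
  simp [stdBasis, Module.Basis.toMatrix_apply]

/-- The volume form as an alternating map on the model space. -/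
def volumeAlternating (g : TwoTensor (𝓡 4) M) (o : OrientationField (𝓡 4) M 4) (p : M) :
    (EuclideanSpace ℝ (Fin 4)) [⋀^Fin 4]→ₗ[ℝ] ℝ :=
  (frameSign (o p) (fun i => (stdVec i : TangentSpace (𝓡 4) p)) * √(-(gramAt g p).det)) •
    stdBasis.det

theorem volumeForm_eq (g : TwoTensor (𝓡 4) M) (o : OrientationField (𝓡 4) M 4) (p : M)
    (v : Fin 4 → EuclideanSpace ℝ (Fin 4)) : volumeForm g o p v = volumeAlternating g o p v := by
  simp only [volumeAlternating, AlternatingMap.smul_apply, smul_eq_mul, Module.Basis.det_apply,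
    stdBasis_toMatrix]
  rfl

theorem volumeAlternating_congr {g k : TwoTensor (𝓡 4) M} (o : OrientationField (𝓡 4) M 4) {p : M}
    (h : gramAt k p = gramAt g p) : volumeAlternating k o p = volumeAlternating g o p := by
  unfold volumeAlternating
  rw [h]

theorem eta_eq (g : TwoTensor (𝓡 4) M) (o : OrientationField (𝓡 4) M 4) (p : M) (a b : Fin 4)
    (x y : EuclideanSpace ℝ (Fin 4)) :
    eta g o p a b x y = ∑ β, (gramAt g p)⁻¹ b β *
      volumeAlternating g o p ![stdVec a, stdVec β, x, y] :=
  Finset.sum_congr rfl fun β _ => congrArg ((gramAt g p)⁻¹ b β * ·)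
    (volumeForm_eq g o p ![stdVec a, stdVec β, x, y])

/-- The matrix with columns `e μ`. -/
def frameMatrix (e : Fin 4 → EuclideanSpace ℝ (Fin 4)) : Matrix (Fin 4) (Fin 4) ℝ :=
  Matrix.of fun d μ => e μ d

theorem frameMatrix_gram (g : TwoTensor (𝓡 4) M) (p : M) (e : Fin 4 → EuclideanSpace ℝ (Fin 4))
    (μ ν : Fin 4) :
    ((frameMatrix e).transpose * gramAt g p * frameMatrix e) μ ν = metricAt g p (e μ) (e ν) := by
  rw [apply_eq_sum_gramAt, Finset.sum_comm]
  simp only [Matrix.mul_apply, Finset.sum_mul, frameMatrix, Matrix.transpose_apply, Matrix.of_apply]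

/-- The determinant of a frame with Gram matrix `diag(-a², 1, h)`. -/
theorem det_frameMatrix_sq {g : TwoTensor (𝓡 4) M} {p : M} {e : Fin 4 → EuclideanSpace ℝ (Fin 4)}
    {a : ℝ} {h : Matrix (Fin 2) (Fin 2) ℝ}
    (hG : (frameMatrix e).transpose * gramAt g p * frameMatrix e = blockGram a h) :
    (frameMatrix e).det ^ 2 * (gramAt g p).det = a * h.det := by
  rw [← det_blockGram, ← hG, Matrix.det_mul, Matrix.det_mul, Matrix.det_transpose]
  ring

/-- The volume of a frame with Gram matrix `diag(-a², 1, h)`. -/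
theorem volumeAlternating_frame {g : TwoTensor (𝓡 4) M} (o : OrientationField (𝓡 4) M 4) {p : M}
    {e : Fin 4 → EuclideanSpace ℝ (Fin 4)} {a : ℝ} (ha : a ≠ 0) {h : Matrix (Fin 2) (Fin 2) ℝ}
    (hh : h.det ≠ 0)
    (hG : (frameMatrix e).transpose * gramAt g p * frameMatrix e = blockGram (-a ^ 2) h) :
    volumeAlternating g o p e
      = frameSign (o p) (fun i => (e i : TangentSpace (𝓡 4) p)) * (|a| * √h.det) := by
  have h1 := det_frameMatrix_sq hG
  have hd : (frameMatrix e).det ≠ 0 := by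
    intro h0
    rw [h0] at h1
    have : -a ^ 2 * h.det ≠ 0 := mul_ne_zero (neg_ne_zero.mpr (pow_ne_zero 2 ha)) hh
    exact this (by rw [← h1]; ring)
  have hdet : stdBasis.det e = (frameMatrix e).det := by
    rw [Module.Basis.det_apply, stdBasis_toMatrix]
    rfl
  have hu : IsUnit (stdBasis.det e) := by rw [hdet]; exact isUnit_iff_ne_zero.mpr hd
  obtain ⟨hli, hsp⟩ := (Module.Basis.is_basis_iff_det stdBasis).mpr hu
  let b := Module.Basis.mk hli hsp.ge
  have hb : ⇑b = e := Module.Basis.coe_mk _ _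
  obtain ⟨o', ho'⟩ : ∃ o' : Orientation ℝ (EuclideanSpace ℝ (Fin 4)) (Fin 4), o' = o p := ⟨o p, rfl⟩
  have h2 := frameSign_basis o' b stdBasis
  rw [hb, hdet] at h2
  -- Follows from det(e)² det g = -a² det h by taking square roots.
  have h3 : √(-(gramAt g p).det) * |(frameMatrix e).det| = |a| * √h.det := by
    rw [← Real.sqrt_sq_eq_abs, ← Real.sqrt_sq_eq_abs, mul_comm, ← Real.sqrt_mul (sq_nonneg _),
      ← Real.sqrt_mul (sq_nonneg _)]
    congr 1
    linarith
  have hstd : (⇑stdBasis : Fin 4 → EuclideanSpace ℝ (Fin 4)) = fun i => stdVec i :=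
    funext stdBasis_apply
  rw [hstd] at h2
  have h4 : volumeAlternating g o p e = (frameSign o'
      (fun i => stdVec i) * (frameMatrix e).det) * √(-(gramAt g p).det) := by
    rw [← hdet, ho']
    exact mul_right_comm _ _ _
  rw [h4, ← h2, ← h3]
  rw [ho', mul_assoc, mul_comm |_|]
  rfl

/-- Equality of the metrics at p equates the two η, which removes the term with the derivative of N.
The connection forms are lowered with the common metric, and `hA` supplies the skewness that the
algebraic contraction requires. -/
theorem cntForm_eq {g k : TwoTensor (𝓡 4) M} (o : OrientationField (𝓡 4) M 4)
    (N : ∀ p : M, TangentSpace (𝓡 4) p) {p : M} {N₀ : EuclideanSpace ℝ (Fin 4)} (hN : N p = N₀)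
    (hk : metricAt k p = metricAt g p)
    (hs : ∀ u v, metricAt g p u v = metricAt g p v u)
    (hg : DifferentiableWithinAt ℝ (metricCoeff g p) (range (𝓡 4)) (extChartAt (𝓡 4) p p))
    (hk' : DifferentiableWithinAt ℝ (metricCoeff k p) (range (𝓡 4)) (extChartAt (𝓡 4) p p))
    {z : Fin 2 → EuclideanSpace ℝ (Fin 4)} {n : EuclideanSpace ℝ (Fin 4)} {a : ℝ} (ha : a ≠ 0)
    {h : Matrix (Fin 2) (Fin 2) ℝ} (hh : h.det ≠ 0)
    (hG : (frameMatrix ![N₀, n, z 0, z 1]).transpose * gramAt g p *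
      frameMatrix ![N₀, n, z 0, z 1] = blockGram a h)
    (hA : ∀ i u v, lowerConnection g p (z i) u v - lowerConnection k p (z i) u v
      = -(lowerConnection g p (z i) v u - lowerConnection k p (z i) v u)) :
    cntForm g k o N p (z 0) (z 1) = 2 * volumeAlternating g o p ![N₀, n, z 0, z 1] *
      ∑ i, ∑ j, h⁻¹ i j *
        (lowerConnection g p (z i) (z j) n - lowerConnection k p (z i) (z j) n) := by
  have hgram : gramAt k p = gramAt g p := by
    ext i j
    rw [gramAt_apply, gramAt_apply, hk]
  have heta : ∀ a b x y, eta k o p a b x y = eta g o p a b x y := by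
    intro a b x y
    refine (eta_eq k o p a b x y).trans (Eq.trans ?_ (eta_eq g o p a b x y).symm)
    rw [hgram, volumeAlternating_congr o hgram]
  set e : Fin 4 → EuclideanSpace ℝ (Fin 4) := ![N₀, n, z 0, z 1] with he
  let A : Fin 2 → Matrix (Fin 4) (Fin 4) ℝ := fun i => Matrix.of fun d b =>
    lowerConnection g p (z i) (stdVec b) (stdVec d)
      - lowerConnection k p (z i) (stdVec b) (stdVec d)
  have hω : ∀ i a b, connectionForm g p a b (z i) - connectionForm k p a b (z i)
      = ∑ d, (gramAt g p)⁻¹ a d * A i d b := by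
    intro i a b
    rw [connectionForm_eq hg, connectionForm_eq hk', hgram, ← Finset.sum_sub_distrib]
    refine Finset.sum_congr rfl fun d _ => ?_
    simp only [A, Matrix.of_apply]
    ring
  -- The column index is the differentiated vector and the row index the one it is paired with, so
  -- the entries (1, 2) and (1, 3) are the differences of ⟨∇ z_j, n⟩ for j = 0, 1.
  have hEA : ∀ i μ ν, ((frameMatrix e).transpose * A i * frameMatrix e) μ ν
      = lowerConnection g p (z i) (e ν) (e μ) - lowerConnection k p (z i) (e ν) (e μ) := by
    intro i μ ν
    have hl : ∀ g : TwoTensor (𝓡 4) M, lowerConnection g p (z i) (e ν) (e μ) = ∑ b, ∑ d,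
        e μ d * lowerConnection g p (z i) (stdVec b) (stdVec d) * e ν b := by
      intro g
      conv_lhs => rw [← sum_smul_stdVec (e ν), ← sum_smul_stdVec (e μ)]
      simp only [lowerConnection, lowerChristoffel_sum₂, lowerChristoffel_sum₃, Finset.mul_sum]
      try rw [Finset.sum_comm]
      refine Finset.sum_congr rfl fun _ _ => Finset.sum_congr rfl fun _ _ => ?_
      ring
    rw [hl, hl]
    simp only [Matrix.mul_apply, Finset.sum_mul, frameMatrix, Matrix.transpose_apply,
      Matrix.of_apply, ← Finset.sum_sub_distrib, A]
    refine Finset.sum_congr rfl fun _ _ => Finset.sum_congr rfl fun _ _ => ?_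
    ring
  have hsymm : h.IsSymm := by
    have h1 : ∀ μ ν, blockGram a h μ ν = blockGram a h ν μ := by
      intro μ ν
      rw [← hG, frameMatrix_gram, frameMatrix_gram, hs]
    have h2 : h 0 1 = h 1 0 := by simpa [blockGram] using h1 2 3
    ext i j
    fin_cases i <;> fin_cases j <;> simp [h2]
  have hAs : ∀ i, (A i).transpose = -A i := by
    intro i
    ext d b
    simp only [A, Matrix.transpose_apply, Matrix.neg_apply, Matrix.of_apply]
    rw [hA]
  have main := sum_inv_contraction_eq_trace (volumeAlternating g o p)
    (fun i => stdVec i) e (gramAt g p) (frameMatrix e) A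
    (fun μ => (sum_smul_stdVec (e μ)).symm) ha hh hsymm hG hAs
  have hunfold : cntForm g k o N p (z 0) (z 1) = ∑ a, ∑ b,
      ((connectionForm g p a b (z 0) - connectionForm k p a b (z 0)) * eta g o p a b N₀ (z 1)
      - (connectionForm g p a b (z 1) - connectionForm k p a b (z 1)) * eta g o p a b N₀ (z 0)) := by
    unfold cntForm
    refine Finset.sum_congr rfl fun a _ => Finset.sum_congr rfl fun b _ => ?_
    -- The coefficient of the derivative of N is η minus the η of the reference, which is zero here.
    have e1 := heta a b (z 0) (z 1)
    rw [hN]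
    linear_combination (-covDeriv k N p a b) * e1
  have hsi : h⁻¹.transpose = h⁻¹ := by rw [Matrix.transpose_nonsing_inv, hsymm.eq]
  have hsi' : ∀ i j, h⁻¹ i j = h⁻¹ j i := fun i j => congrFun (congrFun hsi j) i
  rw [hunfold]
  have hη : ∀ a b (y : EuclideanSpace ℝ (Fin 4)), eta g o p a b N₀ y = _ := fun a b y =>
    eta_eq g o p a b N₀ y
  simp only [hω, hη, Finset.sum_sub_distrib]
  refine main.trans ?_
  have hvol : volumeAlternating g o p ![e 0, e 1, e 2, e 3] = volumeAlternating g o p e := by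
    congr 1
  rw [hvol]
  congr 1
  refine Finset.sum_congr rfl fun i _ => ?_
  rw [Fin.sum_univ_two, hEA, hEA]
  simp only [he, Matrix.cons_val]
  ring

end Energy

/-! ### Gram determinants and uniqueness of the unit normal. -/

section LinearAlgebra

variable {E : Type*} [NormedAddCommGroup E] [NormedSpace ℝ E]

/-- A null vector of the Gram matrix gives a combination of the u i of zero length, hence a linear
relation. -/
theorem det_gram_ne_zero {n : ℕ} (B : E →L[ℝ] E →L[ℝ] ℝ) (hB : ∀ v, v ≠ 0 → 0 < B v v)
    {u : Fin n → E} (hu : LinearIndependent ℝ u) :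
    (Matrix.of fun i j => B (u i) (u j)).det ≠ 0 := by
  intro h0
  obtain ⟨c, hc, h⟩ := Matrix.exists_mulVec_eq_zero_iff.mpr h0
  have h1 : B (∑ i, c i • u i) (∑ i, c i • u i) = 0 := by
    have h2 : B (∑ i, c i • u i) (∑ i, c i • u i) = ∑ i, c i * ∑ j, B (u i) (u j) * c j := by
      simp only [map_sum, map_smul, sum_apply, smul_apply, smul_eq_mul, Finset.mul_sum]
      rw [Finset.sum_comm]
      refine Finset.sum_congr rfl fun i _ => Finset.sum_congr rfl fun j _ => ?_
      ring
    rw [h2]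
    refine Finset.sum_eq_zero fun i _ => ?_
    have h3 : ∑ j, B (u i) (u j) * c j = 0 := congrFun h i
    rw [h3, mul_zero]
  have h2 : ∑ i, c i • u i = 0 := by
    by_contra h3
    exact (hB _ h3).ne' h1
  exact hc (funext (Fintype.linearIndependent_iff.mp hu c h2))

/-- In dimension three, a unit normal of a plane is unique up to sign. -/
theorem eq_or_eq_neg_of_unit_normal [FiniteDimensional ℝ E] (hE : Module.finrank ℝ E = 3)
    (B : E →L[ℝ] E →L[ℝ] ℝ) (hB : ∀ v, v ≠ 0 → 0 < B v v) {w : Fin 2 → E}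
    (hw : LinearIndependent ℝ w) {m n : E} (hm : B m m = 1) (hn : B n n = 1)
    (hmw : ∀ i, B m (w i) = 0) (hnw : ∀ i, B n (w i) = 0) : m = n ∨ m = -n := by
  -- Four vectors in dimension three are dependent. The tangential part of the relation is
  -- orthogonal to itself, so it vanishes; comparing the lengths of the rest gives equal squared
  -- coefficients of m and n.
  have hdep : ¬ LinearIndependent ℝ ![m, n, w 0, w 1] := by
    intro h
    have := h.fintype_card_le_finrank
    rw [hE] at this
    simp at this
  obtain ⟨c, hc, i, hi⟩ := Fintype.not_linearIndependent_iff.mp hdep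
  have hc' : c 0 • m + c 1 • n + (c 2 • w 0 + c 3 • w 1) = 0 := by
    simpa [Fin.sum_univ_four, add_assoc] using hc
  have h0 : c 2 • w 0 + c 3 • w 1 = 0 := by
    by_contra h
    have h1 := hB _ h
    have h2 : c 2 • w 0 + c 3 • w 1 = -(c 0 • m + c 1 • n) := by
      rw [eq_neg_iff_add_eq_zero, add_comm]
      exact hc'
    have h3 : B (-(c 0 • m + c 1 • n)) (c 2 • w 0 + c 3 • w 1) = 0 := by
      simp [hmw, hnw]
    rw [← h2] at h3
    exact h1.ne' h3
  have h4 : ∀ i, ![c 2, c 3] i = 0 :=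
    Fintype.linearIndependent_iff.mp hw ![c 2, c 3] (by simpa [Fin.sum_univ_two] using h0)
  have h5 : c 2 = 0 := h4 0
  have h6 : c 3 = 0 := h4 1
  have h7 : c 0 • m = -(c 1 • n) := by
    rw [eq_neg_iff_add_eq_zero]
    rwa [h0, add_zero] at hc'
  have h8 : c 0 * c 0 = c 1 * c 1 := by
    have h9 : B (c 0 • m) (c 0 • m) = B (-(c 1 • n)) (-(c 1 • n)) := by rw [h7]
    simpa [hm, hn] using h9
  have h10 : c 1 ≠ 0 := by
    intro h1
    have h2 : c 0 = 0 := by simpa [h1] using h8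
    fin_cases i <;> simp_all
  rcases mul_self_eq_mul_self_iff.mp h8 with h | h
  · right
    rw [h, ← smul_neg] at h7
    exact smul_right_injective E h10 h7
  · left
    rw [h, neg_smul, neg_inj] at h7
    exact smul_right_injective E h10 h7

end LinearAlgebra

/-! ### Positive frames under a sign change or a transposition. -/

section Orientation

variable {V : Type*} [AddCommGroup V] [Module ℝ V] {n : ℕ}

theorem IsPositiveFrame.not_of_det_neg {o : Orientation ℝ V (Fin n)} {v w : Fin n → V}
    (hv : IsPositiveFrame o v) (h : ∀ b : Module.Basis (Fin n) ℝ V, ⇑b = v → b.det w < 0) :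
    ¬ IsPositiveFrame o w := by
  rintro ⟨c, hc, hco⟩
  obtain ⟨b, hb, hbo⟩ := hv
  have h1 := (b.orientation_eq_iff_det_pos c).mp (hbo.trans hco.symm)
  rw [hc] at h1
  exact absurd (h b hb) h1.le.not_gt

theorem IsPositiveFrame.not_swap {o : Orientation ℝ V (Fin n)} {v : Fin n → V}
    (hv : IsPositiveFrame o v) {i j : Fin n} (hij : i ≠ j) :
    ¬ IsPositiveFrame o (v ∘ Equiv.swap i j) := by
  refine hv.not_of_det_neg fun b hb => ?_
  rw [← hb, b.det.map_swap _ hij, b.det_self]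
  norm_num

theorem IsPositiveFrame.not_update_neg {o : Orientation ℝ V (Fin n)} {v : Fin n → V}
    (hv : IsPositiveFrame o v) (i : Fin n) :
    ¬ IsPositiveFrame o (Function.update v i (-v i)) := by
  refine hv.not_of_det_neg fun b hb => ?_
  rw [← hb, b.det.map_update_neg, Function.update_eq_self, b.det_self]
  norm_num

theorem isPositiveFrame_swap_of_not {o : Orientation ℝ V (Fin n)} (b : Module.Basis (Fin n) ℝ V)
    (hb : ¬ IsPositiveFrame o b) {i j : Fin n} (hij : i ≠ j) :
    IsPositiveFrame o (b ∘ Equiv.swap i j) := by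
  refine ⟨b.reindex (Equiv.swap i j), by simp, ?_⟩
  have h1 : (b.reindex (Equiv.swap i j)).orientation ≠ b.orientation := by
    intro h
    have h2 := (b.orientation_eq_iff_det_pos _).mp h.symm
    rw [Module.Basis.coe_reindex, Equiv.symm_swap, b.det.map_swap _ hij, b.det_self] at h2
    norm_num at h2
  rw [isPositiveFrame_basis_iff] at hb
  have h3 := ((b.reindex (Equiv.swap i j)).orientation_eq_or_eq_neg b.orientation).resolve_left
    h1.symm
  have h4 := (b.orientation_eq_or_eq_neg o).resolve_left (fun h => hb h.symm)
  rw [h4, h3]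
  exact (neg_neg (b.reindex (Equiv.swap i j)).orientation).symm

end Orientation

/-! ### Pull-back of a static metric, split into time and space parts. -/

section StaticPullback

theorem tangentCoordChange_model_space {E : Type*} [NormedAddCommGroup E] [NormedSpace ℝ E]
    (x y z : E) : tangentCoordChange 𝓘(ℝ, E) x y z = ContinuousLinearMap.id ℝ E := by
  rw [tangentCoordChange_def]
  simp only [extChartAt_model_space_eq_id]
  simp

variable {M : Type*} [TopologicalSpace M] [ChartedSpace (EuclideanSpace ℝ (Fin 4)) M]
  {P : Type*} [TopologicalSpace P] [ChartedSpace (EuclideanSpace ℝ (Fin 3)) P]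

theorem differential_fst {φ : M → ℝ × P} {q : M} (hφ : MDifferentiableAt (𝓡 4) staticModel φ q)
    (u : EuclideanSpace ℝ (Fin 4)) :
    differential (𝓡 4) 𝓘(ℝ, ℝ) (fun q => (φ q).1) q u
      = (differential (𝓡 4) staticModel φ q u).1 := by
  have h := (hasMFDerivAt_fst (I := 𝓘(ℝ, ℝ)) (I' := 𝓡 3) (φ q)).comp q hφ.hasMFDerivAt
  exact congrArg (fun L : EuclideanSpace ℝ (Fin 4) →L[ℝ] ℝ => L u) h.mfderiv

theorem differential_snd {φ : M → ℝ × P} {q : M} (hφ : MDifferentiableAt (𝓡 4) staticModel φ q)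
    (u : EuclideanSpace ℝ (Fin 4)) :
    differential (𝓡 4) (𝓡 3) (fun q => (φ q).2) q u
      = (differential (𝓡 4) staticModel φ q u).2 := by
  have h := (hasMFDerivAt_snd (I := 𝓘(ℝ, ℝ)) (I' := 𝓡 3) (φ q)).comp q hφ.hasMFDerivAt
  exact congrArg (fun L : EuclideanSpace ℝ (Fin 4) →L[ℝ] EuclideanSpace ℝ (Fin 3) => L u) h.mfderiv

theorem metricAt_pullback_static (h : TwoTensor (𝓡 3) P) (V : P → ℝ) (φ : M → ℝ × P) (q : M)
    (u v : EuclideanSpace ℝ (Fin 4)) :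
    metricAt (pullback (𝓡 4) φ (staticMetric h V)) q u v =
      -(V (φ q).2) ^ 2 * ((differential (𝓡 4) staticModel φ q u).1 *
        (differential (𝓡 4) staticModel φ q v).1)
      + metricAt h (φ q).2 (differential (𝓡 4) staticModel φ q u).2
        (differential (𝓡 4) staticModel φ q v).2 := rfl

variable [IsManifold (𝓡 4) 1 M]

/-- With θ the differential of the time component of φ, this is the decomposition into the pull-back
of the spatial metric and -V² θ ⊗ θ demanded by `lowerHessian_add_sq_of_ker`. -/
theorem eventually_metricCoeff_pullback_static (h : TwoTensor (𝓡 3) P) (V : P → ℝ)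
    {φ : M → ℝ × P} {p : M} (hφ : ∀ᶠ q in 𝓝 p, MDifferentiableAt (𝓡 4) staticModel φ q) :
    ∀ᶠ y in 𝓝[range (𝓡 4)] (extChartAt (𝓡 4) p p), ∀ u v,
      metricCoeff (pullback (𝓡 4) φ (staticMetric h V)) p y u v =
        metricCoeff (pullback (𝓡 4) (fun q => (φ q).2) h) p y u v
        + -(V (φ ((extChartAt (𝓡 4) p).symm y)).2) ^ 2 *
          (fderivWithin ℝ (chartRep (𝓡 4) 𝓘(ℝ, ℝ) (fun q => (φ q).1) p) (range (𝓡 4)) y u *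
            fderivWithin ℝ (chartRep (𝓡 4) 𝓘(ℝ, ℝ) (fun q => (φ q).1) p) (range (𝓡 4)) y v) := by
  have hsymm : Filter.Tendsto (extChartAt (𝓡 4) p).symm (𝓝[range (𝓡 4)] (extChartAt (𝓡 4) p p))
      (𝓝 p) := by
    have := (continuousAt_extChartAt_symm (I := 𝓡 4) p).tendsto
    rw [extChartAt_to_inv] at this
    exact this.mono_left nhdsWithin_le_nhds
  filter_upwards [hsymm.eventually hφ, extChartAt_target_mem_nhdsWithin (I := 𝓡 4) p]
    with y h1 h2 u v
  set q := (extChartAt (𝓡 4) p).symm y with hq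
  set T := tangentCoordChange (𝓡 4) p q q with hT
  have e1 : ∀ u, fderivWithin ℝ (chartRep (𝓡 4) 𝓘(ℝ, ℝ) (fun q => (φ q).1) p) (range (𝓡 4)) y u
      = (differential (𝓡 4) staticModel φ q (T u)).1 := by
    intro u
    have h3 : MDifferentiableAt (𝓡 4) 𝓘(ℝ, ℝ) (fun q => (φ q).1) q :=
      mdifferentiableAt_fst.comp q h1
    have h4 := (hasFDerivWithinAt_in_charts (p := (φ p).1) h2 rfl
      (by rw [extChartAt_model_space_eq_id]; exact mem_univ _) h3).fderivWithin
      ((𝓡 4).uniqueDiffOn y (extChartAt_target_subset_range p h2))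
    rw [tangentCoordChange_model_space, ContinuousLinearMap.id_comp] at h4
    rw [← differential_fst h1]
    exact congrArg (fun L : EuclideanSpace ℝ (Fin 4) →L[ℝ] ℝ => L u) h4
  have e2 : ∀ g : TwoTensor (𝓡 4) M, metricCoeff g p y u v = metricAt g q (T u) (T v) :=
    fun g => rfl
  rw [e1, e1, e2, e2, metricAt_pullback_static, add_comm, ← differential_snd h1,
    ← differential_snd h1]
  rfl

end StaticPullback

/-! ### Signs of matching frames of the surface and of spacetime. -/

section Orientation

variable {V W : Type*} [AddCommGroup V] [Module ℝ V] [AddCommGroup W] [Module ℝ W]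

theorem vec_comp_swap_zero_one {α : Type*} (a b : α) :
    ![a, b] ∘ Equiv.swap 0 1 = ![b, a] := by
  ext i; fin_cases i <;> rfl

theorem vec_comp_swap_two_three {α : Type*} (a b c d : α) :
    ![a, b, c, d] ∘ Equiv.swap 2 3 = ![a, b, d, c] := by
  ext i; fin_cases i <;> rfl

theorem exists_isPositiveFrame_pair (o : Orientation ℝ V (Fin 2))
    (b : Module.Basis (Fin 2) ℝ V) : ∃ u v, IsPositiveFrame o ![u, v] := by
  have hb : ⇑b = ![b 0, b 1] := by ext i; fin_cases i <;> rfl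
  by_cases h : IsPositiveFrame o b
  · exact ⟨b 0, b 1, hb ▸ h⟩
  · have h1 := isPositiveFrame_swap_of_not b h (i := 0) (j := 1) (by decide)
    rw [hb, vec_comp_swap_zero_one] at h1
    exact ⟨b 1, b 0, h1⟩

/-- The hypothesis speaks of positive pairs only. A negative pair becomes positive when its two
vectors are exchanged, and the exchange flips the sign of the 4-frame as well. -/
theorem frameSign_mul_frameSign_eq_one {o : Orientation ℝ V (Fin 2)} {o' : Orientation ℝ W (Fin 4)}
    {A : V → W} {m n : W}
    (h : ∀ u v, IsPositiveFrame o ![u, v] → IsPositiveFrame o' ![m, n, A u, A v])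
    (b : Module.Basis (Fin 2) ℝ V) :
    frameSign o b * frameSign o' ![m, n, A (b 0), A (b 1)] = 1 := by
  have hb : ⇑b = ![b 0, b 1] := by ext i; fin_cases i <;> rfl
  unfold frameSign
  by_cases hp : IsPositiveFrame o b
  · rw [if_pos hp, if_pos (h _ _ (hb ▸ hp)), one_mul]
  · have h1 := isPositiveFrame_swap_of_not b hp (i := 0) (j := 1) (by decide)
    rw [hb, vec_comp_swap_zero_one] at h1
    have h2 := (h _ _ h1).not_swap (i := 2) (j := 3) (by decide)
    rw [vec_comp_swap_two_three] at h2
    rw [if_neg hp, if_neg h2]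
    norm_num

end Orientation

section Algebra

theorem of_bilin_eq_transpose_mul {β : EuclideanSpace ℝ (Fin 2) → EuclideanSpace ℝ (Fin 2) → ℝ}
    (hβ : ∀ x y, β x y = ∑ k, ∑ l, x k * y l * β (stdVec k) (stdVec l))
    (u : Fin 2 → EuclideanSpace ℝ (Fin 2)) :
    (Matrix.of fun i j => β (u i) (u j)) = (Matrix.of fun k i => u i k).transpose *
      (Matrix.of fun i j => β (stdVec i) (stdVec j)) * (Matrix.of fun k i => u i k) := by
  ext i j
  simp only [Matrix.mul_apply, Matrix.of_apply, Matrix.transpose_apply, Finset.sum_mul]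
  rw [hβ, Finset.sum_comm]
  refine Finset.sum_congr rfl fun _ _ => Finset.sum_congr rfl fun _ _ => ?_
  ring

end Algebra

section Lorentz

variable {M : Type*} [TopologicalSpace M] [ChartedSpace (EuclideanSpace ℝ (Fin 4)) M]
  [IsManifold (𝓡 4) 1 M]

theorem IsLorentzMetric.symm {g : TwoTensor (𝓡 4) M} (hg : IsLorentzMetric g) (p : M)
    (u v : EuclideanSpace ℝ (Fin 4)) : metricAt g p u v = metricAt g p v u := by
  obtain ⟨e, he⟩ := hg.signature p
  have h : g p = LinearMap.flip (g p) := by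
    refine LinearMap.ext_basis e e fun i j => ?_
    rw [LinearMap.flip_apply, he, he]
    by_cases hij : i = j
    · subst hij; rfl
    · rw [if_neg hij, if_neg (Ne.symm hij)]
  exact congrArg (fun L : LinearMap.BilinForm ℝ (TangentSpace (𝓡 4) p) => L u v) h

end Lorentz

/-! ### Slices of a static metric are totally geodesic. -/

section StaticPullback

variable {M : Type*} [TopologicalSpace M] [ChartedSpace (EuclideanSpace ℝ (Fin 4)) M]
  [IsManifold (𝓡 4) 1 M]
  {P : Type*} [TopologicalSpace P] [ChartedSpace (EuclideanSpace ℝ (Fin 3)) P]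
  [IsManifold (𝓡 3) 1 P]
  {S : Type*} [TopologicalSpace S] [ChartedSpace (EuclideanSpace ℝ (Fin 2)) S]

theorem differential_comp {E E' E'' H H' H'' M M' M'' : Type*}
    [NormedAddCommGroup E] [NormedSpace ℝ E] [TopologicalSpace H] {I : ModelWithCorners ℝ E H}
    [TopologicalSpace M] [ChartedSpace H M]
    [NormedAddCommGroup E'] [NormedSpace ℝ E'] [TopologicalSpace H'] {I' : ModelWithCorners ℝ E' H'}
    [TopologicalSpace M'] [ChartedSpace H' M']
    [NormedAddCommGroup E''] [NormedSpace ℝ E''] [TopologicalSpace H'']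
    {I'' : ModelWithCorners ℝ E'' H''} [TopologicalSpace M''] [ChartedSpace H'' M'']
    {f : M → M'} {J : M' → M''} {x : M} (hf : MDifferentiableAt I I' f x)
    (hJ : MDifferentiableAt I' I'' J (f x)) (u : E) :
    differential I I'' (J ∘ f) x u = differential I' I'' J (f x) (differential I I' f x u) :=
  congrArg (fun L : E →L[ℝ] E'' => L u) (mfderiv_comp x hJ hf)

/-- The term -V² dT² drops out on vectors without time component; naturality then moves the spatial
term to P. Only the tangent vectors of the surface have to be killed by dT; nothing is asked of φ
off the surface beyond smoothness. -/
theorem surfaceHessian_pullback_static {h : TwoTensor (𝓡 3) P} {V : P → ℝ}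
    {φ : M → ℝ × P} {F : S → M} {s : S} (hF : ContMDiffAt (𝓡 2) (𝓡 4) ∞ F s)
    (hφ : ∀ᶠ q in 𝓝 (F s), ContMDiffAt (𝓡 4) staticModel ∞ φ q)
    (hh : DifferentiableWithinAt ℝ (metricCoeff h (φ (F s)).2) (range (𝓡 3))
      (extChartAt (𝓡 3) (φ (F s)).2 (φ (F s)).2))
    (hhs : ∀ u v, metricAt h (φ (F s)).2 u v = metricAt h (φ (F s)).2 v u)
    (hV : MDifferentiableAt (𝓡 3) 𝓘(ℝ, ℝ) V (φ (F s)).2)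
    (hT : ∀ u, (differential (𝓡 4) staticModel φ (F s) (differential (𝓡 2) (𝓡 4) F s u)).1 = 0) :
    DifferentiableWithinAt ℝ (metricCoeff (pullback (𝓡 4) φ (staticMetric h V)) (F s))
      (range (𝓡 4)) (extChartAt (𝓡 4) (F s) (F s)) ∧
    ∀ u v w, (differential (𝓡 4) staticModel φ (F s) w).1 = 0 →
      surfaceHessian (pullback (𝓡 4) φ (staticMetric h V)) F s u v w =
        surfaceHessian h (fun s => (φ (F s)).2) s u v
          (differential (𝓡 4) staticModel φ (F s) w).2 := by
  have hφd : ∀ᶠ q in 𝓝 (F s), MDifferentiableAt (𝓡 4) staticModel φ q :=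
    hφ.mono fun q hq => hq.mdifferentiableAt (by simp)
  have hφ₁ : ContMDiffAt (𝓡 4) 𝓘(ℝ, ℝ) ∞ (fun q => (φ q).1) (F s) :=
    contMDiffAt_fst.comp _ hφ.self_of_nhds
  have hφ₂ : ∀ᶠ q in 𝓝 (F s), ContMDiffAt (𝓡 4) (𝓡 3) ∞ (fun q => (φ q).2) q :=
    hφ.mono fun q hq => contMDiffAt_snd.comp _ hq
  have hφ₂d : ∀ᶠ q in 𝓝 (F s), MDifferentiableAt (𝓡 4) (𝓡 3) (fun q => (φ q).2) q :=
    hφ₂.mono fun q hq => hq.mdifferentiableAt (by simp)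
  have hself : chartRep (𝓡 2) (𝓡 4) F s (extChartAt (𝓡 2) s s) = extChartAt (𝓡 4) (F s) (F s) :=
    chartRep_self _ _
  have hmem : extChartAt (𝓡 4) (F s) (F s) ∈ range (𝓡 4) :=
    extChartAt_target_subset_range _ (mem_extChartAt_target _)
  have hK₁ : DifferentiableWithinAt ℝ (metricCoeff (pullback (𝓡 4) (fun q => (φ q).2) h) (F s))
      (range (𝓡 4)) (extChartAt (𝓡 4) (F s) (F s)) := by
    refine differentiableWithinAt_pullback (𝓡 4).uniqueDiffOn hmem
      ((contDiffWithinAt_chartRep hφ₂.self_of_nhds).of_le ENat.LEInfty.out)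
      (fun y _ => chartRep_mem_range _ _ _) ?_
      (eventually_metricCoeff_pullback h hφ₂d)
    rw [chartRep_self]
    exact hh
  have hθ : DifferentiableWithinAt ℝ
      (fderivWithin ℝ (chartRep (𝓡 4) 𝓘(ℝ, ℝ) (fun q => (φ q).1) (F s)) (range (𝓡 4)))
      (range (𝓡 4)) (extChartAt (𝓡 4) (F s) (F s)) :=
    (((contDiffWithinAt_chartRep hφ₁).of_le (m := 2) ENat.LEInfty.out).fderivWithin_right
      (𝓡 4).uniqueDiffOn (m := 1) (by norm_num) hmem).differentiableWithinAt one_ne_zero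
  have ha : DifferentiableWithinAt ℝ
      (fun y => -(V (φ ((extChartAt (𝓡 4) (F s)).symm y)).2) ^ 2)
      (range (𝓡 4)) (extChartAt (𝓡 4) (F s) (F s)) := by
    have h1 : MDifferentiableAt (𝓡 4) 𝓘(ℝ, ℝ) (fun q => V (φ q).2) (F s) :=
      hV.comp (F s) hφ₂d.self_of_nhds
    have h2 := h1.mdifferentiableWithinAt (s := univ) |>.differentiableWithinAt_comp_extChartAt_symm
    rw [preimage_univ, univ_inter] at h2
    exact (h2.pow 2).neg
  have hθ₁ : ∀ w, fderivWithin ℝ (chartRep (𝓡 4) 𝓘(ℝ, ℝ) (fun q => (φ q).1) (F s)) (range (𝓡 4))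
      (extChartAt (𝓡 4) (F s) (F s)) w = (differential (𝓡 4) staticModel φ (F s) w).1 := by
    intro w
    rw [fderivWithin_chartRep (hφ₁.mdifferentiableAt (by simp)), differential_fst hφd.self_of_nhds]
  have key := fun (u v : EuclideanSpace ℝ (Fin 2)) (w : EuclideanSpace ℝ (Fin 4))
      (hw : (differential (𝓡 4) staticModel φ (F s) w).1 = 0) =>
    lowerHessian_add_sq_of_ker (s := range (𝓡 4)) (f := chartRep (𝓡 2) (𝓡 4) F s)
      (z := extChartAt (𝓡 2) s s) (u := u) (v := v) (w := w)
      (K := metricCoeff (pullback (𝓡 4) φ (staticMetric h V)) (F s))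
      (by rw [hself]; exact (𝓡 4).uniqueDiffOn _ hmem) (by rw [hself]; exact hmem)
      (by rw [hself]; exact hK₁) (by rw [hself]; exact ha) (by rw [hself]; exact hθ)
      (by rw [hself]; exact eventually_metricCoeff_pullback_static h V hφd)
      (by rw [hself, hθ₁]; exact hw)
      (by rw [hself, hθ₁, fderiv_chartRep (hF.mdifferentiableAt (by simp))]; exact hT u)
      (by rw [hself, hθ₁, fderiv_chartRep (hF.mdifferentiableAt (by simp))]; exact hT v)
  refine ⟨?_, fun u v w hw => ?_⟩
  -- The differentiability statement does not involve u, v, w, so the zero vectors, which satisfy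
  -- every condition, suffice.
  · have h1 := (key 0 0 0 (by simp)).1
    rwa [hself] at h1
  · refine (key u v w hw).2.trans ?_
    rw [← differential_snd hφd.self_of_nhds]
    exact surfaceHessian_pullback h hF hφ₂.self_of_nhds hφ₂d hh hhs u v w

end StaticPullback

/-! ### The reference along the surface: normals and skewness of the connection difference. -/

section Pointwise

variable {M : Type*} [TopologicalSpace M]
  [ChartedSpace (EuclideanSpace ℝ (Fin 4)) M] [IsManifold (𝓡 4) ∞ M]
  {S : Type*} [TopologicalSpace S]
  [ChartedSpace (EuclideanSpace ℝ (Fin 2)) S]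
  {Ω : Type*} [TopologicalSpace Ω]
  [ChartedSpace (EuclideanHalfSpace 3) Ω]
  {P : Type*} [TopologicalSpace P] [ChartedSpace (EuclideanSpace ℝ (Fin 3)) P]
  [IsManifold (𝓡 3) 1 P]

/-- The bundled data of a spacelike domain `j : Ω → M` with boundary `b : S → Ω`, a normal field
`N`, and a reference `φ` into the static spacetime `-V² dT² + h`, as in the definition of the
energy of `S`. -/
structure IsStaticReference (g : TwoTensor (𝓡 4) M) (o : OrientationField (𝓡 4) M 4)
    (j : Ω → M) (b : S → Ω) (ν : ∀ s : S, TangentSpace (𝓡∂ 3) (b s))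
    (N : ∀ p : M, TangentSpace (𝓡 4) p) (oS : OrientationField (𝓡 2) S 2)
    (h : TwoTensor (𝓡 3) P) (V : P → ℝ) (o' : OrientationField staticModel (ℝ × P) 4) (U : Set M)
    (φ : M → ℝ × P) (ν₀ : ∀ s : S, TangentSpace (𝓡 3) (φ (j (b s))).2) : Prop where
  lorentz : IsLorentzMetric g
  domain : IsSpacelikeDomain g j b
  unit_normal : IsUnitNormal (pullback (𝓡∂ 3) j g) b ν
  orthogonal : ∀ (s : S) (w : TangentSpace (𝓡∂ 3) (b s)),
    g (j (b s)) (N (j (b s))) (mfderiv (𝓡∂ 3) (𝓡 4) j (b s) w) = 0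
  orientation : ∀ (s : S) (u v : TangentSpace (𝓡 2) s), IsPositiveFrame (oS s) ![u, v] →
      IsPositiveFrame (o (j (b s)))
        ![N (j (b s)), mfderiv (𝓡∂ 3) (𝓡 4) j (b s) (ν s),
          mfderiv (𝓡 2) (𝓡 4) (j ∘ b) s u, mfderiv (𝓡 2) (𝓡 4) (j ∘ b) s v]
  metric_differentiable : ∀ x, DifferentiableWithinAt ℝ (metricCoeff h x) (range (𝓡 3))
    (extChartAt (𝓡 3) x x)
  metric_symm : ∀ x u v, metricAt h x u v = metricAt h x v u
  metric_pos : ∀ x v, v ≠ 0 → 0 < metricAt h x v v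
  potential_differentiable : ∀ x, MDifferentiableAt (𝓡 3) 𝓘(ℝ, ℝ) V x
  isOpen : IsOpen U
  subset : ∀ s, j (b s) ∈ U
  ne_zero : ∀ s, V (φ (j (b s))).2 ≠ 0
  smooth : ContMDiffOn (𝓡 4) staticModel ∞ φ U
  immersion : ∀ s, Function.Injective (mfderiv (𝓡 4) staticModel φ (j (b s)))
  orientation_preserving : ∀ s, ∀ v : Fin 4 → TangentSpace (𝓡 4) (j (b s)),
    IsPositiveFrame (o (j (b s))) v →
    IsPositiveFrame (o' (φ (j (b s)))) (fun i => mfderiv (𝓡 4) staticModel φ (j (b s)) (v i))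
  matching : IsIsometricMatching g (staticMetric h V) (range (j ∘ b)) φ
  map_normal : ∀ s : S, mfderiv (𝓡 4) staticModel φ (j (b s)) (N (j (b s)))
    = timeField (φ (j (b s)))
  slice : ∃ T₀ : ℝ, ∀ s : S, (φ (j (b s))).1 = T₀
  unit_normal₀ : IsUnitNormal h (fun s : S => (φ (j (b s))).2) ν₀
  orientation₀ : ∀ (s : S) (u v : TangentSpace (𝓡 2) s), IsPositiveFrame (oS s) ![u, v] →
    IsPositiveFrame (o' (φ (j (b s))))
      ![timeField (φ (j (b s))), staticVec (φ (j (b s))) 0 (ν₀ s),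
        mfderiv (𝓡 4) staticModel φ (j (b s)) (mfderiv (𝓡 2) (𝓡 4) (j ∘ b) s u),
        mfderiv (𝓡 4) staticModel φ (j (b s)) (mfderiv (𝓡 2) (𝓡 4) (j ∘ b) s v)]

namespace IsStaticReference

variable {g : TwoTensor (𝓡 4) M} {o : OrientationField (𝓡 4) M 4}
    {j : Ω → M} {b : S → Ω} {ν : ∀ s : S, TangentSpace (𝓡∂ 3) (b s)}
    {N : ∀ p : M, TangentSpace (𝓡 4) p} {oS : OrientationField (𝓡 2) S 2}
    {h : TwoTensor (𝓡 3) P} {V : P → ℝ} {o' : OrientationField staticModel (ℝ × P) 4} {U : Set M}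
    {φ : M → ℝ × P} {ν₀ : ∀ s : S, TangentSpace (𝓡 3) (φ (j (b s))).2}

theorem contMDiff_boundary (H : IsStaticReference g o j b ν N oS h V o' U φ ν₀) :
    ContMDiff (𝓡 2) (𝓡 4) ∞ (j ∘ b) :=
  H.domain.embedded.smooth.comp H.domain.boundary_embedded.smooth

theorem differential_boundary (H : IsStaticReference g o j b ν N oS h V o' U φ ν₀) (s : S)
    (u : EuclideanSpace ℝ (Fin 2)) :
    differential (𝓡 2) (𝓡 4) (j ∘ b) s u
      = differential (𝓡∂ 3) (𝓡 4) j (b s) (differential (𝓡 2) (𝓡∂ 3) b s u) :=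
  differential_comp (H.domain.boundary_embedded.smooth.mdifferentiable (by simp) s)
    (H.domain.embedded.smooth.mdifferentiable (by simp) (b s)) u

theorem eventually_contMDiffAt (H : IsStaticReference g o j b ν N oS h V o' U φ ν₀) (s : S) :
    ∀ᶠ q in 𝓝 (j (b s)), ContMDiffAt (𝓡 4) staticModel ∞ φ q :=
  (H.isOpen.eventually_mem (H.subset s)).mono fun _ hq =>
    H.smooth.contMDiffAt (H.isOpen.mem_nhds hq)

theorem mdifferentiableAt (H : IsStaticReference g o j b ν N oS h V o' U φ ν₀) (s : S) :
    MDifferentiableAt (𝓡 4) staticModel φ (j (b s)) :=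
  (H.eventually_contMDiffAt s).self_of_nhds.mdifferentiableAt (by simp)

theorem metricAt_eq (H : IsStaticReference g o j b ν N oS h V o' U φ ν₀) (s : S) :
    metricAt (pullback (𝓡 4) φ (staticMetric h V)) (j (b s)) = metricAt g (j (b s)) :=
  congrArg (fun B : LinearMap.BilinForm ℝ (EuclideanSpace ℝ (Fin 4)) =>
    LinearMap.toContinuousBilinearMap B) (H.matching _ ⟨s, rfl⟩)

theorem differential_fst_eq_zero (H : IsStaticReference g o j b ν N oS h V o' U φ ν₀) (s : S)
    (u : EuclideanSpace ℝ (Fin 2)) :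
    (differential (𝓡 4) staticModel φ (j (b s)) (differential (𝓡 2) (𝓡 4) (j ∘ b) s u)).1 = 0 := by
  obtain ⟨T₀, hT⟩ := H.slice
  rw [← differential_fst (H.mdifferentiableAt s)]
  refine (differential_comp (f := j ∘ b) (J := fun q => (φ q).1)
    (H.contMDiff_boundary.mdifferentiable (by simp) s)
    (mdifferentiableAt_fst.comp _ (H.mdifferentiableAt s)) u).symm.trans ?_
  have h1 : (fun q => (φ q).1) ∘ (j ∘ b) = fun _ => T₀ := funext hT
  rw [h1]
  exact congrArg (fun L : EuclideanSpace ℝ (Fin 2) →L[ℝ] ℝ => L u) (mfderiv_const (x := s) (c := T₀))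

theorem differential_snd_boundary (H : IsStaticReference g o j b ν N oS h V o' U φ ν₀) (s : S)
    (u : EuclideanSpace ℝ (Fin 2)) :
    differential (𝓡 2) (𝓡 3) (fun s => (φ (j (b s))).2) s u
      = (differential (𝓡 4) staticModel φ (j (b s))
          (differential (𝓡 2) (𝓡 4) (j ∘ b) s u)).2 := by
  rw [← differential_snd (H.mdifferentiableAt s)]
  exact differential_comp (f := j ∘ b) (J := fun q => (φ q).2)
    (H.contMDiff_boundary.mdifferentiable (by simp) s)
    (mdifferentiableAt_snd.comp _ (H.mdifferentiableAt s)) u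

/-- Vectors tangent to the image have no time component, so matching makes the surface in P
isometric to the surface in M. Both mean curvatures are therefore traces with the same inverse
metric. -/
theorem metricAt_boundary (H : IsStaticReference g o j b ν N oS h V o' U φ ν₀) (s : S)
    (u v : EuclideanSpace ℝ (Fin 2)) :
    metricAt (pullback (𝓡 2) (fun s => (φ (j (b s))).2) h) s u v
      = metricAt g (j (b s)) (differential (𝓡 2) (𝓡 4) (j ∘ b) s u)
        (differential (𝓡 2) (𝓡 4) (j ∘ b) s v) := by
  have h1 : metricAt (pullback (𝓡 2) (fun s => (φ (j (b s))).2) h) s u v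
    = metricAt h (φ (j (b s))).2 (differential (𝓡 2) (𝓡 3) (fun s => (φ (j (b s))).2) s u)
      (differential (𝓡 2) (𝓡 3) (fun s => (φ (j (b s))).2) s v) := rfl
  rw [h1, ← H.metricAt_eq, metricAt_pullback_static, H.differential_fst_eq_zero,
    H.differential_snd_boundary, H.differential_snd_boundary]
  ring

theorem linearIndependent_boundary (H : IsStaticReference g o j b ν N oS h V o' U φ ν₀) (s : S)
    {u : Fin 2 → EuclideanSpace ℝ (Fin 2)} (hu : LinearIndependent ℝ u) :
    LinearIndependent ℝ (fun i => differential (𝓡 2) (𝓡∂ 3) b s (u i)) :=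
  hu.map' (differential (𝓡 2) (𝓡∂ 3) b s).toLinearMap
    (LinearMap.ker_eq_bot.mpr (H.domain.boundary_embedded.immersion s))

theorem det_gram_boundary_ne_zero (H : IsStaticReference g o j b ν N oS h V o' U φ ν₀) (s : S)
    {u : Fin 2 → EuclideanSpace ℝ (Fin 2)} (hu : LinearIndependent ℝ u) :
    (Matrix.of fun i k => metricAt g (j (b s)) (differential (𝓡 2) (𝓡 4) (j ∘ b) s (u i))
      (differential (𝓡 2) (𝓡 4) (j ∘ b) s (u k))).det ≠ 0 := by
  have h1 := det_gram_ne_zero (metricAt (pullback (𝓡∂ 3) j g) (b s))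
    (fun v hv => H.domain.spacelike (b s) v hv) (H.linearIndependent_boundary s hu)
  simp only [H.differential_boundary]
  exact h1

/-- The reference maps the unit normal to the unit normal. -/
theorem differential_normal (H : IsStaticReference g o j b ν N oS h V o' U φ ν₀) (s : S)
    {n : EuclideanSpace ℝ (Fin 4)} {m₀ : EuclideanSpace ℝ (Fin 3)}
    (hn : n = mfderiv (𝓡∂ 3) (𝓡 4) j (b s) (ν s)) (hm₀ : m₀ = ν₀ s) :
    (differential (𝓡 4) staticModel φ (j (b s)) n).1 = 0 ∧
      (differential (𝓡 4) staticModel φ (j (b s)) n).2 = m₀ := by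
  set dφ := differential (𝓡 4) staticModel φ (j (b s)) with hdφ
  set dF := differential (𝓡 2) (𝓡 4) (j ∘ b) s with hdF
  obtain ⟨N₀, hN₀⟩ : ∃ N₀ : EuclideanSpace ℝ (Fin 4), N₀ = N (j (b s)) := ⟨_, rfl⟩
  have hφN : dφ N₀ = (1, 0) := by rw [hN₀]; exact H.map_normal s
  have hNn : metricAt g (j (b s)) N₀ n = 0 := by rw [hN₀, hn]; exact H.orthogonal s (ν s)
  have hnn : metricAt g (j (b s)) n n = 1 := by rw [hn]; exact (H.unit_normal s).1
  have hnF : ∀ u, metricAt g (j (b s)) n (dF u) = 0 := by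
    intro u
    rw [hn, hdF, H.differential_boundary]
    exact (H.unit_normal s).2 u
  have hsplit : ∀ u v, metricAt g (j (b s)) u v = -(V (φ (j (b s))).2) ^ 2 * ((dφ u).1 * (dφ v).1)
      + metricAt h (φ (j (b s))).2 (dφ u).2 (dφ v).2 := by
    intro u v
    rw [← H.metricAt_eq]
    rfl
  -- The product of ∂/∂T and dφ n is -V² times the time component of dφ n, and it equals g(N, n) =
  -- 0.
  have h1 : (dφ n).1 = 0 := by
    rw [hsplit, hφN] at hNn
    simpa [H.ne_zero s] using hNn
  refine ⟨h1, ?_⟩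
  have hdF1 : ∀ u, (dφ (dF u)).1 = 0 := H.differential_fst_eq_zero s
  set w : Fin 2 → EuclideanSpace ℝ (Fin 3) := fun i => (dφ (dF (stdVec i))).2 with hw
  have hwi : LinearIndependent ℝ w := by
    rw [Fintype.linearIndependent_iff]
    intro c hc
    have h2 : dφ (dF (∑ i, c i • stdVec i)) = 0 := by
      refine Prod.ext (hdF1 _) ?_
      simp only [map_sum, map_smul, Prod.snd_sum, Prod.smul_snd, Prod.snd_zero]
      exact hc
    have h3 : dF (∑ i, c i • stdVec i) = 0 := H.immersion s (h2.trans (map_zero dφ).symm)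
    have h4 : (∑ i, c i • stdVec i : EuclideanSpace ℝ (Fin 2)) = 0 := by
      rw [hdF, H.differential_boundary] at h3
      exact H.domain.boundary_embedded.immersion s (H.domain.embedded.immersion (b s)
        (h3.trans (map_zero (differential (𝓡∂ 3) (𝓡 4) j (b s))).symm)
        |>.trans (map_zero (differential (𝓡 2) (𝓡∂ 3) b s)).symm)
    intro i
    have h5 := congrArg (fun x : EuclideanSpace ℝ (Fin 2) => x i)
      ((sum_smul_stdVec (WithLp.toLp 2 c)).symm.trans h4)
    simpa using h5
  have hν₀ : metricAt h (φ (j (b s))).2 m₀ m₀ = 1 := by rw [hm₀]; exact (H.unit_normal₀ s).1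
  have hν₀w : ∀ i, metricAt h (φ (j (b s))).2 m₀ (w i) = 0 := by
    intro i
    rw [hw, hm₀]
    simp only [hdφ, hdF]
    rw [← H.differential_snd_boundary]
    exact (H.unit_normal₀ s).2 (stdVec i)
  have hm : metricAt h (φ (j (b s))).2 (dφ n).2 (dφ n).2 = 1 := by
    rw [hsplit, h1] at hnn
    simpa using hnn
  have hmw : ∀ i, metricAt h (φ (j (b s))).2 (dφ n).2 (w i) = 0 := by
    intro i
    have h2 := hnF (stdVec i)
    rw [hsplit, h1] at h2
    simpa using h2
  rcases eq_or_eq_neg_of_unit_normal (by simp) (metricAt h (φ (j (b s))).2) (H.metric_pos _) hwi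
    hm hν₀ hmw hν₀w with h2 | h2
  · exact h2
  · exfalso
    -- If n went to -ν₀, a positive pair of S would make both (∂/∂T, ν₀, …) and (∂/∂T, -ν₀, …)
    -- positive. Slot 1 is the normal.
    obtain ⟨u, v, huv⟩ := exists_isPositiveFrame_pair
      (show Orientation ℝ (EuclideanSpace ℝ (Fin 2)) (Fin 2) from oS s)
      (EuclideanSpace.basisFun (Fin 2) ℝ).toBasis
    have h3 := H.orientation_preserving s _ (H.orientation s u v huv)
    have h4 := H.orientation₀ s u v huv
    refine h4.not_update_neg 1 ?_
    convert h3 using 1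
    ext i : 1
    fin_cases i
    · exact (H.map_normal s).symm
    · refine Prod.ext (Eq.trans (neg_zero (G := ℝ)) (Eq.trans h1.symm ?_))
        (Eq.trans ?_ (Eq.trans h2.symm ?_))
      · rw [hn]; rfl
      · rw [hm₀]; rfl
      · rw [hn]; rfl
    · rfl
    · rfl

theorem differentiableWithinAt_metricCoeff (H : IsStaticReference g o j b ν N oS h V o' U φ ν₀)
    (s : S) : DifferentiableWithinAt ℝ
      (metricCoeff (pullback (𝓡 4) φ (staticMetric h V)) (j (b s))) (range (𝓡 4))
      (extChartAt (𝓡 4) (j (b s)) (j (b s))) :=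
  (surfaceHessian_pullback_static (F := j ∘ b) (H.contMDiff_boundary s)
    (H.eventually_contMDiffAt s) (H.metric_differentiable _) (H.metric_symm _)
    (H.potential_differentiable _) (H.differential_fst_eq_zero s)).1

theorem metricCoeff_pullback_symm (H : IsStaticReference g o j b ν N oS h V o' U φ ν₀) (p : M)
    (y u v : EuclideanSpace ℝ (Fin 4)) :
    metricCoeff (pullback (𝓡 4) φ (staticMetric h V)) p y u v
      = metricCoeff (pullback (𝓡 4) φ (staticMetric h V)) p y v u := by
  set q := (extChartAt (𝓡 4) p).symm y
  set T := tangentCoordChange (𝓡 4) p q q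
  change metricAt (pullback (𝓡 4) φ (staticMetric h V)) q (T u) (T v)
    = metricAt (pullback (𝓡 4) φ (staticMetric h V)) q (T v) (T u)
  rw [metricAt_pullback_static, metricAt_pullback_static, H.metric_symm]
  ring

theorem metricCoeff_symm (H : IsStaticReference g o j b ν N oS h V o' U φ ν₀) (p : M)
    (y u v : EuclideanSpace ℝ (Fin 4)) : metricCoeff g p y u v = metricCoeff g p y v u := by
  set q := (extChartAt (𝓡 4) p).symm y
  set T := tangentCoordChange (𝓡 4) p q q
  change g q (T u) (T v) = g q (T v) (T u)
  exact H.lorentz.symm q _ _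

/-- Matching holds at all points of the surface near s, not just at s; this permits differentiating
the equality along the surface. -/
theorem eventually_metricCoeff_eq (H : IsStaticReference g o j b ν N oS h V o' U φ ν₀) (s : S) :
    ∀ᶠ y in 𝓝 (extChartAt (𝓡 2) s s),
      metricCoeff g (j (b s)) (chartRep (𝓡 2) (𝓡 4) (j ∘ b) s y)
        = metricCoeff (pullback (𝓡 4) φ (staticMetric h V)) (j (b s))
          (chartRep (𝓡 2) (𝓡 4) (j ∘ b) s y) := by
  have hc : Filter.Tendsto (fun y => (j ∘ b) ((extChartAt (𝓡 2) s).symm y))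
      (𝓝 (extChartAt (𝓡 2) s s)) (𝓝 (j (b s))) := by
    have h3 := (continuousAt_extChartAt_symm (I := 𝓡 2) s).tendsto
    rw [extChartAt_to_inv] at h3
    exact (H.contMDiff_boundary.continuous.tendsto s).comp h3
  filter_upwards [hc.eventually (extChartAt_source_mem_nhds (I := 𝓡 4) (j (b s)))] with y hy
  have h4 : (extChartAt (𝓡 4) (j (b s))).symm (chartRep (𝓡 2) (𝓡 4) (j ∘ b) s y)
      = j (b ((extChartAt (𝓡 2) s).symm y)) := (extChartAt (𝓡 4) (j (b s))).left_inv hy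
  ext u v
  refine (inChart_eq g h4 u v).trans (Eq.trans ?_
    (inChart_eq (pullback (𝓡 4) φ (staticMetric h V)) h4 u v).symm)
  exact congrArg (fun B : LinearMap.BilinForm ℝ (EuclideanSpace ℝ (Fin 4)) => B _ _)
    (H.matching (j (b ((extChartAt (𝓡 2) s).symm y))) ⟨_, rfl⟩).symm

/-- The metrics have the same derivatives in directions tangent to the surface. -/
theorem fderivWithin_metricCoeff_eq (H : IsStaticReference g o j b ν N oS h V o' U φ ν₀) (s : S)
    (x : EuclideanSpace ℝ (Fin 2)) :
    fderivWithin ℝ (metricCoeff g (j (b s))) (range (𝓡 4)) (extChartAt (𝓡 4) (j (b s)) (j (b s)))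
      (differential (𝓡 2) (𝓡 4) (j ∘ b) s x)
    = fderivWithin ℝ (metricCoeff (pullback (𝓡 4) φ (staticMetric h V)) (j (b s))) (range (𝓡 4))
      (extChartAt (𝓡 4) (j (b s)) (j (b s))) (differential (𝓡 2) (𝓡 4) (j ∘ b) s x) := by
  have hself : extChartAt (𝓡 4) (j (b s)) (j (b s))
      = chartRep (𝓡 2) (𝓡 4) (j ∘ b) s (extChartAt (𝓡 2) s s) :=
    (chartRep_self (I := 𝓡 2) (I' := 𝓡 4) (j ∘ b) s).symm
  have hg := H.lorentz.smooth.differentiableWithinAt_metricCoeff (j (b s))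
  have hk := H.differentiableWithinAt_metricCoeff s
  rw [← fderiv_chartRep (H.contMDiff_boundary.mdifferentiable (by simp) s)]
  rw [hself] at hg hk ⊢
  exact fderivWithin_eq_of_eq_along hg hk
    ((contDiffAt_chartRep (H.contMDiff_boundary s)).differentiableAt (by simp))
    (chartRep_mem_range _ _) (H.eventually_metricCoeff_eq s) x

/-- The connections of `g` and of the reference metric differ on tangent vectors of the surface by
a skew-symmetric form. -/
theorem lowerConnection_sub_skew (H : IsStaticReference g o j b ν N oS h V o' U φ ν₀) (s : S)
    (x : EuclideanSpace ℝ (Fin 2)) (u v : EuclideanSpace ℝ (Fin 4)) :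
    lowerConnection g (j (b s)) (differential (𝓡 2) (𝓡 4) (j ∘ b) s x) u v
      - lowerConnection (pullback (𝓡 4) φ (staticMetric h V)) (j (b s))
        (differential (𝓡 2) (𝓡 4) (j ∘ b) s x) u v
    = -(lowerConnection g (j (b s)) (differential (𝓡 2) (𝓡 4) (j ∘ b) s x) v u
      - lowerConnection (pullback (𝓡 4) φ (staticMetric h V)) (j (b s))
        (differential (𝓡 2) (𝓡 4) (j ∘ b) s x) v u) := by
  have hmem : UniqueDiffWithinAt ℝ (range (𝓡 4)) (extChartAt (𝓡 4) (j (b s)) (j (b s))) :=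
    (𝓡 4).uniqueDiffOn _ (extChartAt_target_subset_range _ (mem_extChartAt_target _))
  -- Each symmetrized connection is the derivative of its metric along x, and these two derivatives
  -- agree since x is tangent to the surface.
  have h1 := lowerChristoffel_add_swap hmem
    (H.lorentz.smooth.differentiableWithinAt_metricCoeff (j (b s)))
    (H.metricCoeff_symm (j (b s))) (differential (𝓡 2) (𝓡 4) (j ∘ b) s x) u v
  have h2 := lowerChristoffel_add_swap hmem (H.differentiableWithinAt_metricCoeff s)
    (H.metricCoeff_pullback_symm (j (b s))) (differential (𝓡 2) (𝓡 4) (j ∘ b) s x) u v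
  rw [H.fderivWithin_metricCoeff_eq, ← h2] at h1
  unfold lowerConnection
  linear_combination h1

variable [IsManifold (𝓡 2) ∞ S]

theorem gramAt_boundary (H : IsStaticReference g o j b ν N oS h V o' U φ ν₀) (s : S) :
    gramAt (pullback (𝓡 2) b (pullback (𝓡∂ 3) j g)) s = Matrix.of fun i k =>
      metricAt g (j (b s)) (differential (𝓡 2) (𝓡 4) (j ∘ b) s (stdVec i))
        (differential (𝓡 2) (𝓡 4) (j ∘ b) s (stdVec k)) := by
  ext i k
  rw [gramAt_apply, Matrix.of_apply, H.differential_boundary, H.differential_boundary]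
  rfl

theorem gramAt_image (H : IsStaticReference g o j b ν N oS h V o' U φ ν₀) (s : S) :
    gramAt (pullback (𝓡 2) (fun s => (φ (j (b s))).2) h) s = Matrix.of fun i k =>
      metricAt g (j (b s)) (differential (𝓡 2) (𝓡 4) (j ∘ b) s (stdVec i))
        (differential (𝓡 2) (𝓡 4) (j ∘ b) s (stdVec k)) := by
  ext i k
  rw [gramAt_apply, H.metricAt_boundary]
  rfl

end IsStaticReference

end Pointwise

/-! ### Nondegeneracy of positive definite Gram matrices. -/

section Gram

variable {n : ℕ} {H : Type*} [TopologicalSpace H]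
  {I : ModelWithCorners ℝ (EuclideanSpace ℝ (Fin n)) H}
  {Q : Type*} [TopologicalSpace Q] [ChartedSpace H Q] [IsManifold I 1 Q]

theorem det_gramAt_ne_zero (g : TwoTensor I Q) (x : Q)
    (hg : ∀ v, v ≠ 0 → 0 < metricAt g x v v) : (gramAt g x).det ≠ 0 := by
  have h1 : gramAt g x = Matrix.of fun i k => metricAt g x (stdVec i) (stdVec k) := by
    ext i k
    exact gramAt_apply g x i k
  rw [h1]
  exact det_gram_ne_zero _ hg linearIndependent_stdVec

end Gram

/-! ### The two mean curvatures and their difference. -/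

section Pointwise

variable {M : Type*} [TopologicalSpace M]
  [ChartedSpace (EuclideanSpace ℝ (Fin 4)) M] [IsManifold (𝓡 4) ∞ M]
  {S : Type*} [TopologicalSpace S]
  [ChartedSpace (EuclideanSpace ℝ (Fin 2)) S]
  {Ω : Type*} [TopologicalSpace Ω]
  [ChartedSpace (EuclideanHalfSpace 3) Ω]
  {P : Type*} [TopologicalSpace P] [ChartedSpace (EuclideanSpace ℝ (Fin 3)) P]
  [IsManifold (𝓡 3) 1 P]

namespace IsStaticReference

variable {g : TwoTensor (𝓡 4) M} {o : OrientationField (𝓡 4) M 4}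
    {j : Ω → M} {b : S → Ω} {ν : ∀ s : S, TangentSpace (𝓡∂ 3) (b s)}
    {N : ∀ p : M, TangentSpace (𝓡 4) p} {oS : OrientationField (𝓡 2) S 2}
    {h : TwoTensor (𝓡 3) P} {V : P → ℝ} {o' : OrientationField staticModel (ℝ × P) 4} {U : Set M}
    {φ : M → ℝ × P} {ν₀ : ∀ s : S, TangentSpace (𝓡 3) (φ (j (b s))).2}

theorem metricAt_pullback_symm (H : IsStaticReference g o j b ν N oS h V o' U φ ν₀) (x : Ω)
    (u v : EuclideanSpace ℝ (Fin 3)) :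
    metricAt (pullback (𝓡∂ 3) j g) x u v = metricAt (pullback (𝓡∂ 3) j g) x v u := by
  set T := differential (𝓡∂ 3) (𝓡 4) j x
  change g (j x) (T u) (T v) = g (j x) (T v) (T u)
  exact H.lorentz.symm (j x) _ _

/-- The normal n has image (0, ν₀), so it satisfies the condition dT = 0 and its spatial part is ν₀.
-/
theorem surfaceHessian_image (H : IsStaticReference g o j b ν N oS h V o' U φ ν₀) (s : S)
    {n : EuclideanSpace ℝ (Fin 4)} (hn : n = mfderiv (𝓡∂ 3) (𝓡 4) j (b s) (ν s))
    (u v : EuclideanSpace ℝ (Fin 2)) :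
    surfaceHessian h (fun s => (φ (j (b s))).2) s u v (ν₀ s)
      = surfaceHessian (pullback (𝓡 4) φ (staticMetric h V)) (j ∘ b) s u v n := by
  obtain ⟨m₀, hm₀⟩ : ∃ m₀ : EuclideanSpace ℝ (Fin 3), m₀ = ν₀ s := ⟨_, rfl⟩
  obtain ⟨hn1, hn2⟩ := H.differential_normal s hn hm₀
  refine Eq.trans ?_ ((surfaceHessian_pullback_static (F := j ∘ b) (H.contMDiff_boundary s)
    (H.eventually_contMDiffAt s) (H.metric_differentiable _) (H.metric_symm _)
    (H.potential_differentiable _) (H.differential_fst_eq_zero s)).2 u v n hn1).symm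
  change surfaceHessian h _ s _ _ (ν₀ s) = surfaceHessian h _ s _ _
    (differential (𝓡 4) staticModel φ (j (b s)) n).2
  rw [hn2, hm₀]
  rfl

/-- The second coordinate derivatives of the surface are paired with the same metric value on both
sides and cancel. -/
theorem surfaceHessian_sub (H : IsStaticReference g o j b ν N oS h V o' U φ ν₀) (s : S)
    (u v : EuclideanSpace ℝ (Fin 2)) (n : EuclideanSpace ℝ (Fin 4)) :
    surfaceHessian g (j ∘ b) s u v n
        - surfaceHessian (pullback (𝓡 4) φ (staticMetric h V)) (j ∘ b) s u v n
      = lowerConnection g (j (b s)) (differential (𝓡 2) (𝓡 4) (j ∘ b) s u)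
          (differential (𝓡 2) (𝓡 4) (j ∘ b) s v) n
        - lowerConnection (pullback (𝓡 4) φ (staticMetric h V)) (j (b s))
          (differential (𝓡 2) (𝓡 4) (j ∘ b) s u) (differential (𝓡 2) (𝓡 4) (j ∘ b) s v) n := by
  have hF : MDifferentiableAt (𝓡 2) (𝓡 4) (j ∘ b) s :=
    H.contMDiff_boundary.mdifferentiable (by simp) s
  rw [surfaceHessian_eq g hF, surfaceHessian_eq _ hF]
  exact (congrArg (fun B : EuclideanSpace ℝ (Fin 4) →L[ℝ] EuclideanSpace ℝ (Fin 4) →L[ℝ] ℝ =>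
    _ - (B _ _ + _)) (H.metricAt_eq s)).trans (add_sub_add_left_eq_sub _ _ _)

theorem differentiableWithinAt_metricCoeff_pullback [IsManifold (𝓡∂ 3) ∞ Ω]
    (H : IsStaticReference g o j b ν N oS h V o' U φ ν₀) (s : S) :
    DifferentiableWithinAt ℝ (metricCoeff (pullback (𝓡∂ 3) j g) (b s)) (range (𝓡∂ 3))
      (extChartAt (𝓡∂ 3) (b s) (b s)) := by
  have hj : ContMDiff (𝓡∂ 3) (𝓡 4) ∞ j := H.domain.embedded.smooth
  have hjd : ∀ᶠ q in 𝓝 (b s), MDifferentiableAt (𝓡∂ 3) (𝓡 4) j q :=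
    Filter.Eventually.of_forall (hj.mdifferentiable (by simp))
  refine differentiableWithinAt_pullback (𝓡∂ 3).uniqueDiffOn
    (extChartAt_target_subset_range _ (mem_extChartAt_target _))
    ((contDiffWithinAt_chartRep (hj (b s))).of_le ENat.LEInfty.out)
    (fun y _ => chartRep_mem_range _ _ _) ?_ (eventually_metricCoeff_pullback g hjd)
  rw [chartRep_self]
  exact H.lorentz.smooth.differentiableWithinAt_metricCoeff (j (b s))

/-- Naturality for the inclusion of Ω with its induced metric. The base point is a boundary point,
so derivatives on Ω are taken within the half-space. -/
theorem surfaceHessian_boundary [IsManifold (𝓡∂ 3) ∞ Ω]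
    (H : IsStaticReference g o j b ν N oS h V o' U φ ν₀) (s : S)
    {n : EuclideanSpace ℝ (Fin 4)} (hn : n = mfderiv (𝓡∂ 3) (𝓡 4) j (b s) (ν s))
    (u v : EuclideanSpace ℝ (Fin 2)) :
    surfaceHessian (pullback (𝓡∂ 3) j g) b s u v (ν s)
      = surfaceHessian g (j ∘ b) s u v n := by
  have hj : ContMDiff (𝓡∂ 3) (𝓡 4) ∞ j := H.domain.embedded.smooth
  rw [hn]
  exact surfaceHessian_pullback g (H.domain.boundary_embedded.smooth s) (hj (b s))
    (Filter.Eventually.of_forall (hj.mdifferentiable (by simp)))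
    (H.lorentz.smooth.differentiableWithinAt_metricCoeff (j (b s))) (H.lorentz.symm _) u v (ν s)

variable [IsManifold (𝓡 2) ∞ S]

/-- The mean curvature of the surface in the domain. -/
theorem meanCurvature_boundary [IsManifold (𝓡∂ 3) ∞ Ω]
    (H : IsStaticReference g o j b ν N oS h V o' U φ ν₀) (s : S)
    {n : EuclideanSpace ℝ (Fin 4)} (hn : n = mfderiv (𝓡∂ 3) (𝓡 4) j (b s) (ν s)) :
    meanCurvature (pullback (𝓡∂ 3) j g) b ν s
      = -∑ i, ∑ k, (Matrix.of fun i k =>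
          metricAt g (j (b s)) (differential (𝓡 2) (𝓡 4) (j ∘ b) s (stdVec i))
            (differential (𝓡 2) (𝓡 4) (j ∘ b) s (stdVec k)))⁻¹ i k *
        surfaceHessian g (j ∘ b) s (stdVec i) (stdVec k) n := by
  rw [meanCurvature_eq ν (H.domain.boundary_embedded.smooth.mdifferentiable (by simp) s)
    (H.differentiableWithinAt_metricCoeff_pullback s) (H.metricAt_pullback_symm (b s))
    (det_gramAt_ne_zero _ _ (fun v hv => H.domain.spacelike (b s) v hv)), H.gramAt_boundary]
  simp only [H.surfaceHessian_boundary s hn]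

/-- The mean curvature of the image of the surface in the slice. -/
theorem meanCurvature_image (H : IsStaticReference g o j b ν N oS h V o' U φ ν₀) (s : S)
    {n : EuclideanSpace ℝ (Fin 4)} (hn : n = mfderiv (𝓡∂ 3) (𝓡 4) j (b s) (ν s)) :
    meanCurvature h (fun s : S => (φ (j (b s))).2) ν₀ s
      = -∑ i, ∑ k, (Matrix.of fun i k =>
          metricAt g (j (b s)) (differential (𝓡 2) (𝓡 4) (j ∘ b) s (stdVec i))
            (differential (𝓡 2) (𝓡 4) (j ∘ b) s (stdVec k)))⁻¹ i k *
        surfaceHessian (pullback (𝓡 4) φ (staticMetric h V)) (j ∘ b) s (stdVec i) (stdVec k) n := by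
  have hf : MDifferentiableAt (𝓡 2) (𝓡 3) (fun s => (φ (j (b s))).2) s :=
    mdifferentiableAt_snd.comp s ((H.mdifferentiableAt s).comp s
      (H.contMDiff_boundary.mdifferentiable (by simp) s))
  rw [meanCurvature_eq ν₀ hf (H.metric_differentiable _) (H.metric_symm _)
      (det_gramAt_ne_zero _ _ (H.metric_pos _)), H.gramAt_image]
  simp only [H.surfaceHessian_image s hn]

/-- The difference of the mean curvatures in the reference and in `Ω`. -/
theorem meanCurvature_sub [IsManifold (𝓡∂ 3) ∞ Ω]
    (H : IsStaticReference g o j b ν N oS h V o' U φ ν₀) (s : S)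
    {n : EuclideanSpace ℝ (Fin 4)} (hn : n = mfderiv (𝓡∂ 3) (𝓡 4) j (b s) (ν s)) :
    meanCurvature h (fun s : S => (φ (j (b s))).2) ν₀ s
        - meanCurvature (pullback (𝓡∂ 3) j g) b ν s
      = ∑ i, ∑ k, (Matrix.of fun i k =>
          metricAt g (j (b s)) (differential (𝓡 2) (𝓡 4) (j ∘ b) s (stdVec i))
            (differential (𝓡 2) (𝓡 4) (j ∘ b) s (stdVec k)))⁻¹ i k *
        (lowerConnection g (j (b s)) (differential (𝓡 2) (𝓡 4) (j ∘ b) s (stdVec i))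
            (differential (𝓡 2) (𝓡 4) (j ∘ b) s (stdVec k)) n
          - lowerConnection (pullback (𝓡 4) φ (staticMetric h V)) (j (b s))
            (differential (𝓡 2) (𝓡 4) (j ∘ b) s (stdVec i))
            (differential (𝓡 2) (𝓡 4) (j ∘ b) s (stdVec k)) n) := by
  -- Both mean curvatures carry a minus sign, so k₀ - k is the trace for g minus the trace for the
  -- reference.
  rw [H.meanCurvature_boundary s hn, H.meanCurvature_image s hn, neg_sub_neg,
    ← Finset.sum_sub_distrib]
  refine Finset.sum_congr rfl fun i _ => ?_
  rw [← Finset.sum_sub_distrib]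
  refine Finset.sum_congr rfl fun k _ => ?_
  rw [← mul_sub, H.surfaceHessian_sub]

end IsStaticReference

end Pointwise

/-! ### Basis independence of traces of bilinear forms. -/

theorem bilin_eq_sum {n : ℕ} {β : EuclideanSpace ℝ (Fin n) → EuclideanSpace ℝ (Fin n) → ℝ}
    (h₁ : ∀ (c : Fin n → ℝ) (x : Fin n → EuclideanSpace ℝ (Fin n)) y,
      β (∑ i, c i • x i) y = ∑ i, c i * β (x i) y)
    (h₂ : ∀ (c : Fin n → ℝ) (y : Fin n → EuclideanSpace ℝ (Fin n)) x,
      β x (∑ i, c i • y i) = ∑ i, c i * β x (y i)) (x y : EuclideanSpace ℝ (Fin n)) :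
    β x y = ∑ k, ∑ l, x k * y l * β (stdVec k) (stdVec l) := by
  conv_lhs => rw [← sum_smul_stdVec x, ← sum_smul_stdVec y]
  rw [h₁]
  refine Finset.sum_congr rfl fun k _ => ?_
  rw [h₂, Finset.mul_sum]
  exact Finset.sum_congr rfl fun l _ => by ring

/-- Contractions of bilinear forms do not depend on the basis. -/
theorem sum_gram_inv_mul_eq {β L : EuclideanSpace ℝ (Fin 2) → EuclideanSpace ℝ (Fin 2) → ℝ}
    (hβ : ∀ x y, β x y = ∑ k, ∑ l, x k * y l * β (stdVec k) (stdVec l))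
    (hL : ∀ x y, L x y = ∑ k, ∑ l, x k * y l * L (stdVec k) (stdVec l))
    {u : Fin 2 → EuclideanSpace ℝ (Fin 2)} (hu : LinearIndependent ℝ u) :
    ∑ i, ∑ j, (Matrix.of fun i j => β (u i) (u j))⁻¹ i j * L (u i) (u j)
      = ∑ i, ∑ j, (Matrix.of fun i j => β (stdVec i) (stdVec j))⁻¹ i j
        * L (stdVec i) (stdVec j) := by
  have hP : (Matrix.of fun k i => u i k).det ≠ 0 := by
    have h1 : LinearIndependent ℝ (fun i => (EuclideanSpace.equiv (Fin 2) ℝ) (u i)) :=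
      hu.map' (EuclideanSpace.equiv (Fin 2) ℝ).toLinearEquiv.toLinearMap
        (LinearEquiv.ker _)
    have h2 : IsUnit (Matrix.of fun i k => u i k) :=
      Matrix.linearIndependent_rows_iff_isUnit.mp h1
    have h3 := (Matrix.isUnit_iff_isUnit_det _).mp h2
    rw [← Matrix.det_transpose]
    exact h3.ne_zero
  have h := sum_inv_mul_congr (Matrix.of fun i j => β (stdVec i) (stdVec j))
    (Matrix.of fun i j => L (stdVec i) (stdVec j)) (Matrix.of fun k i => u i k) hP
  rw [← of_bilin_eq_transpose_mul hβ, ← of_bilin_eq_transpose_mul hL] at h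
  exact h

/-! ### Equality of the two integrands. -/

section Pointwise

variable {M : Type*} [TopologicalSpace M]
  [ChartedSpace (EuclideanSpace ℝ (Fin 4)) M] [IsManifold (𝓡 4) ∞ M]
  {S : Type*} [TopologicalSpace S]
  [ChartedSpace (EuclideanSpace ℝ (Fin 2)) S]
  {Ω : Type*} [TopologicalSpace Ω]
  [ChartedSpace (EuclideanHalfSpace 3) Ω]
  {P : Type*} [TopologicalSpace P] [ChartedSpace (EuclideanSpace ℝ (Fin 3)) P]
  [IsManifold (𝓡 3) 1 P]

theorem lowerConnection_sum₁ {n : ℕ} (g : TwoTensor (𝓡 4) M) (p : M)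
    (v w : EuclideanSpace ℝ (Fin 4)) (c : Fin n → ℝ) (u : Fin n → EuclideanSpace ℝ (Fin 4)) :
    lowerConnection g p (∑ i, c i • u i) v w = ∑ i, c i * lowerConnection g p (u i) v w :=
  lowerChristoffel_sum₁ _ _ _ _ _ _ _ _

theorem lowerConnection_sum₂ {n : ℕ} (g : TwoTensor (𝓡 4) M) (p : M)
    (u w : EuclideanSpace ℝ (Fin 4)) (c : Fin n → ℝ) (v : Fin n → EuclideanSpace ℝ (Fin 4)) :
    lowerConnection g p u (∑ i, c i • v i) w = ∑ i, c i * lowerConnection g p u (v i) w :=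
  lowerChristoffel_sum₂ _ _ _ _ _ _ _ _

namespace IsStaticReference

variable {g : TwoTensor (𝓡 4) M} {o : OrientationField (𝓡 4) M 4}
    {j : Ω → M} {b : S → Ω} {ν : ∀ s : S, TangentSpace (𝓡∂ 3) (b s)}
    {N : ∀ p : M, TangentSpace (𝓡 4) p} {oS : OrientationField (𝓡 2) S 2}
    {h : TwoTensor (𝓡 3) P} {V : P → ℝ} {o' : OrientationField staticModel (ℝ × P) 4} {U : Set M}
    {φ : M → ℝ × P} {ν₀ : ∀ s : S, TangentSpace (𝓡 3) (φ (j (b s))).2}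

/-- The Gram matrix of the adapted frame of `M` along the surface. -/
theorem frame_gram (H : IsStaticReference g o j b ν N oS h V o' U φ ν₀) (s : S)
    {N₀ n : EuclideanSpace ℝ (Fin 4)} (hN₀ : N₀ = N (j (b s)))
    (hn : n = mfderiv (𝓡∂ 3) (𝓡 4) j (b s) (ν s)) {z : Fin 2 → EuclideanSpace ℝ (Fin 4)}
    {u : Fin 2 → EuclideanSpace ℝ (Fin 2)}
    (hz : ∀ i, z i = differential (𝓡 2) (𝓡 4) (j ∘ b) s (u i)) :
    (frameMatrix ![N₀, n, z 0, z 1]).transpose * gramAt g (j (b s)) *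
      frameMatrix ![N₀, n, z 0, z 1]
      = blockGram (-(V (φ (j (b s))).2) ^ 2)
        (Matrix.of fun i k => metricAt g (j (b s)) (z i) (z k)) := by
  -- Matching turns g(N, N) into the square of ∂/∂T. The remaining entries are orthogonality of N to
  -- Ω and of the unit normal to S.
  have hNN : metricAt g (j (b s)) N₀ N₀ = -(V (φ (j (b s))).2) ^ 2 := by
    have hφN : differential (𝓡 4) staticModel φ (j (b s)) N₀ = (1, 0) := by
      rw [hN₀]; exact H.map_normal s
    rw [← H.metricAt_eq, metricAt_pullback_static, hφN]
    simp
  have hNn : metricAt g (j (b s)) N₀ n = 0 := by rw [hN₀, hn]; exact H.orthogonal s (ν s)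
  have hNz : ∀ i, metricAt g (j (b s)) N₀ (z i) = 0 := by
    intro i
    rw [hN₀, hz, H.differential_boundary]
    exact H.orthogonal s _
  have hnn : metricAt g (j (b s)) n n = 1 := by rw [hn]; exact (H.unit_normal s).1
  have hnz : ∀ i, metricAt g (j (b s)) n (z i) = 0 := by
    intro i
    rw [hn, hz, H.differential_boundary]
    exact (H.unit_normal s).2 (u i)
  have hs := H.lorentz.symm (j (b s))
  ext μ κ
  rw [frameMatrix_gram]
  fin_cases μ <;> fin_cases κ <;>
    simp [blockGram, hNN, hNn, hNz, hnn, hnz, hs n N₀, hs (z _) N₀, hs (z _) n]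

/-- The integrands of the energy and of the mean curvature integral agree. -/
theorem frameSign_mul_cntForm [IsManifold (𝓡 2) ∞ S] [IsManifold (𝓡∂ 3) ∞ Ω]
    (H : IsStaticReference g o j b ν N oS h V o' U φ ν₀) (s : S)
    (e : Module.Basis (Fin 2) ℝ (TangentSpace (𝓡 2) s)) :
    frameSign (oS s) e * cntForm g (pullback (𝓡 4) φ (staticMetric h V)) o N (j (b s))
        (mfderiv (𝓡 2) (𝓡 4) (j ∘ b) s (e 0)) (mfderiv (𝓡 2) (𝓡 4) (j ∘ b) s (e 1))
      = 2 * (√(Matrix.of fun i k => g (j (b s)) (mfderiv (𝓡 2) (𝓡 4) (j ∘ b) s (e i))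
            (mfderiv (𝓡 2) (𝓡 4) (j ∘ b) s (e k))).det *
          (|V (φ (j (b s))).2| * (meanCurvature h (fun s : S => (φ (j (b s))).2) ν₀ s
            - meanCurvature (pullback (𝓡∂ 3) j g) b ν s))) := by
  obtain ⟨N₀, hN₀⟩ : ∃ N₀ : EuclideanSpace ℝ (Fin 4), N₀ = N (j (b s)) := ⟨_, rfl⟩
  obtain ⟨n, hn⟩ : ∃ n : EuclideanSpace ℝ (Fin 4), n = mfderiv (𝓡∂ 3) (𝓡 4) j (b s) (ν s) :=
    ⟨_, rfl⟩
  obtain ⟨u, hu⟩ : ∃ u : Fin 2 → EuclideanSpace ℝ (Fin 2), u = e := ⟨_, rfl⟩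
  obtain ⟨z, hz⟩ : ∃ z : Fin 2 → EuclideanSpace ℝ (Fin 4),
    ∀ i, z i = differential (𝓡 2) (𝓡 4) (j ∘ b) s (u i) := ⟨_, fun _ => rfl⟩
  have hz' : ∀ i, mfderiv (𝓡 2) (𝓡 4) (j ∘ b) s (e i) = z i := by
    intro i; rw [hz, hu]; rfl
  have huI : LinearIndependent ℝ u := by rw [hu]; exact e.linearIndependent
  have hG := H.frame_gram s hN₀ hn hz
  have hV := H.ne_zero s
  have hdet : (Matrix.of fun i k => metricAt g (j (b s)) (z i) (z k)).det ≠ 0 := by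
    simp only [hz]
    exact H.det_gram_boundary_ne_zero s huI
  have h1 := cntForm_eq o N hN₀.symm (H.metricAt_eq s) (H.lorentz.symm _)
    (H.lorentz.smooth.differentiableWithinAt_metricCoeff _) (H.differentiableWithinAt_metricCoeff s)
    (neg_ne_zero.mpr (pow_ne_zero 2 hV)) hdet hG (by
      intro i v w
      rw [hz]
      exact H.lowerConnection_sub_skew s (u i) v w)
  rw [volumeAlternating_frame o hV hdet hG] at h1
  -- The orientation convention for S cancels the sign in the integral of a form against the sign of
  -- the volume of (N, n, z₀, z₁).
  have h2 : frameSign (oS s) e * frameSign (o (j (b s)))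
      (fun i => (![N₀, n, z 0, z 1] i : TangentSpace (𝓡 4) (j (b s)))) = 1 := by
    have h3 := frameSign_mul_frameSign_eq_one (o := oS s) (o' := o (j (b s)))
      (A := mfderiv (𝓡 2) (𝓡 4) (j ∘ b) s) (H.orientation s) e
    rw [hz', hz'] at h3
    rw [hN₀, hn]
    exact h3
  -- The mean curvature is computed in the chart centred at s, while the integral uses the frame e
  -- coming from another chart; the trace is the same in both.
  have h4 : ∑ i, ∑ k, (Matrix.of fun i k => metricAt g (j (b s)) (z i) (z k))⁻¹ i k *
      (lowerConnection g (j (b s)) (z i) (z k) n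
        - lowerConnection (pullback (𝓡 4) φ (staticMetric h V)) (j (b s)) (z i) (z k) n)
      = meanCurvature h (fun s : S => (φ (j (b s))).2) ν₀ s
        - meanCurvature (pullback (𝓡∂ 3) j g) b ν s := by
    rw [H.meanCurvature_sub s hn]
    simp only [hz]
    refine sum_gram_inv_mul_eq
      (β := fun x y => metricAt g (j (b s)) (differential (𝓡 2) (𝓡 4) (j ∘ b) s x)
        (differential (𝓡 2) (𝓡 4) (j ∘ b) s y))
      (L := fun x y => lowerConnection g (j (b s)) (differential (𝓡 2) (𝓡 4) (j ∘ b) s x)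
          (differential (𝓡 2) (𝓡 4) (j ∘ b) s y) n
        - lowerConnection (pullback (𝓡 4) φ (staticMetric h V)) (j (b s))
          (differential (𝓡 2) (𝓡 4) (j ∘ b) s x) (differential (𝓡 2) (𝓡 4) (j ∘ b) s y) n)
      (bilin_eq_sum ?_ ?_) (bilin_eq_sum ?_ ?_) huI
    · intro c x y
      simp
    · intro c x y
      simp
    · intro c x y
      simp only [map_sum, map_smul, lowerConnection_sum₁, mul_sub, Finset.sum_sub_distrib]
    · intro c x y
      simp only [map_sum, map_smul, lowerConnection_sum₂, mul_sub, Finset.sum_sub_distrib]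
  rw [h4] at h1
  rw [hz', hz']
  have h5 : (Matrix.of fun i k => g (j (b s)) (mfderiv (𝓡 2) (𝓡 4) (j ∘ b) s (e i))
      (mfderiv (𝓡 2) (𝓡 4) (j ∘ b) s (e k)))
      = Matrix.of fun i k => metricAt g (j (b s)) (z i) (z k) := by
    ext i k
    simp only [Matrix.of_apply]
    rw [hz', hz']
    rfl
  rw [h5]
  refine (congrArg (frameSign (oS s) e * ·) h1).trans ?_
  linear_combination (2 * (|V (φ (j (b s))).2|
    * √(Matrix.of fun i k => metricAt g (j (b s)) (z i) (z k)).det) *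
    (meanCurvature h (fun s : S => (φ (j (b s))).2) ν₀ s
      - meanCurvature (pullback (𝓡∂ 3) j g) b ν s)) * h2

end IsStaticReference

end Pointwise

/-! ### Integrals of forms and of functions over the surface. -/

section Surface

variable {S : Type*} [TopologicalSpace S] [ChartedSpace (EuclideanSpace ℝ (Fin 2)) S]
  [IsManifold (𝓡 2) ∞ S]

theorem linearIndependent_coordVec (c : S) {y : EuclideanSpace ℝ (Fin 2)}
    (hy : y ∈ (extChartAt (𝓡 2) c).target) : LinearIndependent ℝ (coordVec c y) := by
  set q := (extChartAt (𝓡 2) c).symm y with hq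
  have hqs : q ∈ (extChartAt (𝓡 2) c).source := (extChartAt (𝓡 2) c).map_target hy
  have hinv : ∀ v, tangentCoordChange (𝓡 2) q c q (tangentCoordChange (𝓡 2) c q q v) = v := by
    intro v
    rw [tangentCoordChange_comp ⟨⟨hqs, mem_extChartAt_source q⟩, hqs⟩,
      tangentCoordChange_self hqs]
  have h1 : LinearIndependent ℝ
      (fun i => tangentCoordChange (𝓡 2) c q q (stdVec i : EuclideanSpace ℝ (Fin 2))) :=
    linearIndependent_stdVec.map' (tangentCoordChange (𝓡 2) c q q).toLinearMap
      (LinearMap.ker_eq_bot.mpr (Function.LeftInverse.injective (g := tangentCoordChange (𝓡 2) q c q)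
        hinv))
  exact h1

/-- The frame of coordinate vectors of the chart centred at `c`. -/
theorem exists_basis_eq_coordVec (c : S) {y : EuclideanSpace ℝ (Fin 2)}
    (hy : y ∈ (extChartAt (𝓡 2) c).target) :
    ∃ e : Module.Basis (Fin 2) ℝ (TangentSpace (𝓡 2) ((extChartAt (𝓡 2) c).symm y)),
      ⇑e = coordVec c y := by
  have h1 : Fintype.card (Fin 2) = Module.finrank ℝ (EuclideanSpace ℝ (Fin 2)) := by simp
  exact ⟨basisOfLinearIndependentOfCardEqFinrank (V := EuclideanSpace ℝ (Fin 2))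
    (linearIndependent_coordVec c hy) h1, coe_basisOfLinearIndependentOfCardEqFinrank _ _⟩

variable [T2Space S] [CompactSpace S]

/-- Both integrals use the same charts and the same partition of unity, so it is enough to compare
integrands on coordinate frames. The constant r passes through the sum and the integrals without any
integrability condition. -/
theorem integralForm_eq_integralArea {oS : OrientationField (𝓡 2) S 2}
    {α : ∀ s : S, TangentSpace (𝓡 2) s → TangentSpace (𝓡 2) s → ℝ} {m : TwoTensor (𝓡 2) S}
    {f : S → ℝ} (r : ℝ)
    (h : ∀ (s : S) (e : Module.Basis (Fin 2) ℝ (TangentSpace (𝓡 2) s)),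
      frameSign (oS s) e * α s (e 0) (e 1)
        = r * (√(Matrix.of fun i k => m s (e i) (e k)).det * f s)) :
    integralForm oS α = r * integralArea m f := by
  unfold integralForm integralArea
  rw [← smul_eq_mul, smul_finsum]
  refine finsum_congr fun c => ?_
  rw [smul_eq_mul, ← integral_const_mul]
  refine setIntegral_congr_fun (isOpen_extChartAt_target c).measurableSet fun y hy => ?_
  obtain ⟨e, he⟩ := exists_basis_eq_coordVec c hy
  have h1 := h _ e
  rw [he] at h1
  have h2 : gram m c y = Matrix.of fun i k => m ((extChartAt (𝓡 2) c).symm y)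
      (coordVec c y i) (coordVec c y k) := rfl
  simp only [h1, h2]
  ring

end Surface

/-! ### The energy for a general static reference. -/

section Energy

variable {M : Type*} [TopologicalSpace M]
  [ChartedSpace (EuclideanSpace ℝ (Fin 4)) M] [IsManifold (𝓡 4) ∞ M]
  {S : Type*} [TopologicalSpace S] [T2Space S] [CompactSpace S]
  [ChartedSpace (EuclideanSpace ℝ (Fin 2)) S] [IsManifold (𝓡 2) ∞ S]
  {Ω : Type*} [TopologicalSpace Ω]
  [ChartedSpace (EuclideanHalfSpace 3) Ω] [IsManifold (𝓡∂ 3) ∞ Ω]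
  {P : Type*} [TopologicalSpace P] [ChartedSpace (EuclideanSpace ℝ (Fin 3)) P]
  [IsManifold (𝓡 3) 1 P]
  {g : TwoTensor (𝓡 4) M} {o : OrientationField (𝓡 4) M 4}
  {j : Ω → M} {b : S → Ω} {ν : ∀ s : S, TangentSpace (𝓡∂ 3) (b s)}
  {N : ∀ p : M, TangentSpace (𝓡 4) p} {oS : OrientationField (𝓡 2) S 2}
  {h : TwoTensor (𝓡 3) P} {V : P → ℝ} {o' : OrientationField staticModel (ℝ × P) 4} {U : Set M}
  {φ : M → ℝ × P} {ν₀ : ∀ s : S, TangentSpace (𝓡 3) (φ (j (b s))).2}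

/-- The energy with respect to a static reference is a mean curvature integral. -/
theorem IsStaticReference.cntEnergy_eq (H : IsStaticReference g o j b ν N oS h V o' U φ ν₀) :
    cntEnergy g o (staticMetric h V) (j ∘ b) oS N φ
      = 1 / (8 * Real.pi) * integralArea (pullback (𝓡 2) (j ∘ b) g) (fun s =>
          |V (φ (j (b s))).2| * (meanCurvature h (fun s : S => (φ (j (b s))).2) ν₀ s
            - meanCurvature (pullback (𝓡∂ 3) j g) b ν s)) := by
  unfold cntEnergy
  -- The factor 2, which comes from the two orderings in the contraction, cancels the 2 in 1/(2κ).
  rw [integralForm_eq_integralArea (m := pullback (𝓡 2) (j ∘ b) g) 2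
    (fun s e => H.frameSign_mul_cntForm s e)]
  have := Real.pi_ne_zero
  field_simp

end Energy

/-! ### The sphere, hyperbolic space and their static potentials. -/

theorem metricCoeff_const {E : Type*} [NormedAddCommGroup E] [NormedSpace ℝ E]
    [FiniteDimensional ℝ E] (B : E →ₗ[ℝ] E →ₗ[ℝ] ℝ) (p y : E) :
    metricCoeff (I := 𝓘(ℝ, E)) (M := E) (fun _ => B) p y = LinearMap.toContinuousBilinearMap B := by
  ext u v
  change B (tangentCoordChange 𝓘(ℝ, E) p y y u) (tangentCoordChange 𝓘(ℝ, E) p y y v) = B u v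
  rw [tangentCoordChange_model_space]
  rfl

theorem contMDiff_coe_sphere3 : ContMDiff (𝓡 3) 𝓘(ℝ, EuclideanSpace ℝ (Fin 4)) ∞
    ((↑) : Sphere3 → EuclideanSpace ℝ (Fin 4)) := by
  have : Fact (Module.finrank ℝ (EuclideanSpace ℝ (Fin 4)) = 3 + 1) := ⟨by simp⟩
  exact contMDiff_coe_sphere

theorem mfderiv_coe_sphere3_injective (x : Sphere3) : Function.Injective
    (mfderiv (𝓡 3) 𝓘(ℝ, EuclideanSpace ℝ (Fin 4))
      ((↑) : Sphere3 → EuclideanSpace ℝ (Fin 4)) x) := by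
  have : Fact (Module.finrank ℝ (EuclideanSpace ℝ (Fin 4)) = 3 + 1) := ⟨by simp⟩
  convert! injective_mvfderiv_subtypeVal_sphere x

/-- The round metric is the pull-back of a constant form under the smooth inclusion into ℝ⁴. -/
theorem differentiableWithinAt_sphereMetric (x : Sphere3) :
    DifferentiableWithinAt ℝ (metricCoeff sphereMetric x) (range (𝓡 3)) (extChartAt (𝓡 3) x x) := by
  have hc := contMDiff_coe_sphere3
  refine differentiableWithinAt_pullback (𝓡 3).uniqueDiffOn
    (extChartAt_target_subset_range _ (mem_extChartAt_target _))
    ((contDiffWithinAt_chartRep (hc x)).of_le ENat.LEInfty.out)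
    (fun y _ => chartRep_mem_range _ _ _) ?_
    (eventually_metricCoeff_pullback (I' := 𝓘(ℝ, EuclideanSpace ℝ (Fin 4)))
      (M' := EuclideanSpace ℝ (Fin 4)) (fun _ => innerₗ (EuclideanSpace ℝ (Fin 4)))
      (Filter.Eventually.of_forall (hc.mdifferentiable (by simp))))
  simp only [funext (metricCoeff_const (innerₗ (EuclideanSpace ℝ (Fin 4))) _)]
  exact differentiableWithinAt_const _

theorem sphereMetric_symm (x : Sphere3) (u v : EuclideanSpace ℝ (Fin 3)) :
    metricAt sphereMetric x u v = metricAt sphereMetric x v u :=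
  real_inner_comm (F := EuclideanSpace ℝ (Fin 4)) _ _

theorem sphereMetric_pos (x : Sphere3) (v : EuclideanSpace ℝ (Fin 3)) (hv : v ≠ 0) :
    0 < metricAt sphereMetric x v v := by
  refine real_inner_self_pos (F := EuclideanSpace ℝ (Fin 4)) |>.mpr fun h => hv ?_
  exact mfderiv_coe_sphere3_injective x (h.trans (map_zero (mfderiv (𝓡 3)
    𝓘(ℝ, EuclideanSpace ℝ (Fin 4)) ((↑) : Sphere3 → EuclideanSpace ℝ (Fin 4)) x)).symm)

theorem mdifferentiableAt_spherePotential (a : EuclideanSpace ℝ (Fin 4)) (x : Sphere3) :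
    MDifferentiableAt (𝓡 3) 𝓘(ℝ, ℝ) (spherePotential a) x := by
  have hc := contMDiff_coe_sphere3
  have h1 : MDifferentiableAt 𝓘(ℝ, EuclideanSpace ℝ (Fin 4)) 𝓘(ℝ, ℝ) (innerSL ℝ a)
      (x : EuclideanSpace ℝ (Fin 4)) :=
    (innerSL ℝ a).differentiableAt.mdifferentiableAt
  exact h1.comp x (hc.mdifferentiable (by simp) x)

theorem metricAt_hyperbolicMetric (x u v : EuclideanSpace ℝ (Fin 3)) :
    metricAt hyperbolicMetric x u v
      = inner ℝ u v - (1 + ‖x‖ ^ 2)⁻¹ * (inner ℝ x u * inner ℝ x v) := rfl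

theorem differentiableWithinAt_hyperbolicMetric (x : Hyperbolic3) :
    DifferentiableWithinAt ℝ (metricCoeff hyperbolicMetric x) (range (𝓡 3))
      (extChartAt (𝓡 3) x x) := by
  refine differentiableWithinAt_of_clm_apply fun u => differentiableWithinAt_of_clm_apply fun v => ?_
  have h1 : (fun y => metricCoeff hyperbolicMetric x y u v) = fun y : EuclideanSpace ℝ (Fin 3) =>
      inner ℝ u v - (1 + ‖y‖ ^ 2)⁻¹ * (inner ℝ y u * inner ℝ y v) := by
    funext y
    rw [metricCoeff_apply]
    unfold inChart
    rw [tangentCoordChange_model_space]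
    rfl
  rw [h1]
  refine DifferentiableAt.differentiableWithinAt ?_
  have h2 : ∀ y : EuclideanSpace ℝ (Fin 3), 1 + ‖y‖ ^ 2 ≠ 0 := fun y => by positivity
  have h3 : DifferentiableAt ℝ (fun y : EuclideanSpace ℝ (Fin 3) => 1 + ‖y‖ ^ 2)
      (extChartAt (𝓡 3) x x) := (differentiableAt_id.norm_sq ℝ).const_add 1
  exact (((h3.inv (h2 _)).mul ((differentiableAt_id.inner ℝ (differentiableAt_const u)).mul
    (differentiableAt_id.inner ℝ (differentiableAt_const v))))).const_sub _

theorem hyperbolicMetric_symm (x : Hyperbolic3) (u v : EuclideanSpace ℝ (Fin 3)) :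
    metricAt hyperbolicMetric x u v = metricAt hyperbolicMetric x v u := by
  rw [metricAt_hyperbolicMetric, metricAt_hyperbolicMetric, real_inner_comm, mul_comm (inner ℝ x u)]

/-- By Cauchy–Schwarz ⟨x, v⟩² ≤ |x|² |v|², which is less than (1 + |x|²) |v|². -/
theorem hyperbolicMetric_pos (x : Hyperbolic3) (v : EuclideanSpace ℝ (Fin 3)) (hv : v ≠ 0) :
    0 < metricAt hyperbolicMetric x v v := by
  rw [metricAt_hyperbolicMetric, real_inner_self_eq_norm_sq]
  have h1 : inner ℝ x v * inner ℝ x v ≤ ‖x‖ ^ 2 * ‖v‖ ^ 2 := by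
    have := abs_real_inner_le_norm x v
    rw [← abs_mul_abs_self, ← mul_pow, sq]
    exact mul_self_le_mul_self (abs_nonneg _) this
  have h2 : 0 < ‖v‖ ^ 2 := by positivity
  have h3 : (0 : ℝ) < 1 + ‖x‖ ^ 2 := by positivity
  rw [sub_pos, inv_mul_lt_iff₀ h3]
  linarith

theorem mdifferentiableAt_hyperbolicPotential (a₀ : ℝ) (a x : EuclideanSpace ℝ (Fin 3)) :
    MDifferentiableAt (𝓡 3) 𝓘(ℝ, ℝ) (hyperbolicPotential a₀ a) x := by
  refine DifferentiableAt.mdifferentiableAt ?_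
  have h1 : 1 + ‖x‖ ^ 2 ≠ 0 := by positivity
  have h2 : DifferentiableAt ℝ (fun y : EuclideanSpace ℝ (Fin 3) => 1 + ‖y‖ ^ 2) x :=
    (differentiableAt_id.norm_sq ℝ).const_add 1
  exact ((h2.sqrt h1).const_mul a₀).add (innerSL ℝ a).differentiableAt

end QuasiLocal

end

/-! ### The de Sitter and anti-de Sitter references as static references. -/

open QuasiLocal in
theorem corollary1p3
    -- the oriented and time-oriented physical spacetime
    {M : Type*} [TopologicalSpace M] [T2Space M] [SecondCountableTopology M]
    [ChartedSpace (EuclideanSpace ℝ (Fin 4)) M] [IsManifold (𝓡 4) ∞ M]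
    (g : TwoTensor (𝓡 4) M) (hg : IsLorentzMetric g)
    (o : OrientationField (𝓡 4) M 4) (ho : IsOrientationOn o univ)
    (τ : ∀ p : M, TangentSpace (𝓡 4) p) (hτ : IsTimeOrientation g τ)
    -- the closed surface `S` and the spacelike domain `Ω` that it encloses
    {S : Type*} [TopologicalSpace S] [T2Space S] [CompactSpace S]
    [ChartedSpace (EuclideanSpace ℝ (Fin 2)) S] [IsManifold (𝓡 2) ∞ S]
    {Ω : Type*} [TopologicalSpace Ω] [T2Space Ω] [SecondCountableTopology Ω]
    [ChartedSpace (EuclideanHalfSpace 3) Ω] [IsManifold (𝓡∂ 3) ∞ Ω]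
    (j : Ω → M) (b : S → Ω) (hΩ : IsSpacelikeDomain g j b)
    (ν : ∀ s : S, TangentSpace (𝓡∂ 3) (b s))
    (hν : IsOutwardUnitNormal (pullback (𝓡∂ 3) j g) b ν)
    -- the displacement vector field `N`, smooth near `S`, future-directed timelike on `S`,
    -- and orthogonal to `Ω` along `S`
    (N : ∀ p : M, TangentSpace (𝓡 4) p)
    (O : Set M) (hO : IsOpen O) (hSO : range (j ∘ b) ⊆ O)
    (hNsmooth : ContMDiffOn (𝓡 4) (𝓡 4).tangent ∞
      (fun p => (⟨p, N p⟩ : TangentBundle (𝓡 4) M)) O)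
    (hN : ∀ s : S, IsFutureTimelike g τ (j (b s)) (N (j (b s))))
    (hNΩ : ∀ (s : S) (w : TangentSpace (𝓡∂ 3) (b s)),
      g (j (b s)) (N (j (b s))) (mfderiv (𝓡∂ 3) (𝓡 4) j (b s) w) = 0)
    -- the orientation of `S`: `N`, the outward normal and a positive frame of `S` form a
    -- positive frame of `M`
    (oS : OrientationField (𝓡 2) S 2) (hoS : IsOrientationOn oS univ)
    (hor : ∀ (s : S) (u v : TangentSpace (𝓡 2) s), IsPositiveFrame (oS s) ![u, v] →
      IsPositiveFrame (o (j (b s)))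
        ![N (j (b s)), mfderiv (𝓡∂ 3) (𝓡 4) j (b s) (ν s),
          mfderiv (𝓡 2) (𝓡 4) (j ∘ b) s u, mfderiv (𝓡 2) (𝓡 4) (j ∘ b) s v]) :
    -- de Sitter reference
    (∀ (a : EuclideanSpace ℝ (Fin 4))
      (o' : OrientationField staticModel (ℝ × Sphere3) 4)
      (_ : IsOrientationOn o' (staticRegion (spherePotential a)))
      (U : Set M) (φ : M → ℝ × Sphere3)
      (_ : IsReference g o τ (staticMetric sphereMetric (spherePotential a)) o' timeField
        (staticRegion (spherePotential a)) (range (j ∘ b)) U φ)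
      (_ : IsIsometricMatching g (staticMetric sphereMetric (spherePotential a))
        (range (j ∘ b)) φ)
      (_ : ∀ s : S, mfderiv (𝓡 4) staticModel φ (j (b s)) (N (j (b s)))
        = timeField (φ (j (b s))))
      (T₀ : ℝ) (_ : ∀ s : S, (φ (j (b s))).1 = T₀)
      (ν₀ : ∀ s : S, TangentSpace (𝓡 3) (φ (j (b s))).2)
      (_ : IsUnitNormal sphereMetric (fun s : S => (φ (j (b s))).2) ν₀)
      (_ : ∀ (s : S) (u v : TangentSpace (𝓡 2) s), IsPositiveFrame (oS s) ![u, v] →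
        IsPositiveFrame (o' (φ (j (b s))))
          ![timeField (φ (j (b s))), staticVec (φ (j (b s))) 0 (ν₀ s),
            mfderiv (𝓡 4) staticModel φ (j (b s)) (mfderiv (𝓡 2) (𝓡 4) (j ∘ b) s u),
            mfderiv (𝓡 4) staticModel φ (j (b s)) (mfderiv (𝓡 2) (𝓡 4) (j ∘ b) s v)]),
      cntEnergy g o (staticMetric sphereMetric (spherePotential a)) (j ∘ b) oS N φ
        = 1 / (8 * Real.pi) * integralArea (pullback (𝓡 2) (j ∘ b) g) (fun s =>
            |spherePotential a (φ (j (b s))).2| *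
              (meanCurvature sphereMetric (fun s : S => (φ (j (b s))).2) ν₀ s
                - meanCurvature (pullback (𝓡∂ 3) j g) b ν s))) ∧
    -- anti-de Sitter reference
    (∀ (a₀ : ℝ) (a : EuclideanSpace ℝ (Fin 3))
      (o' : OrientationField staticModel (ℝ × Hyperbolic3) 4)
      (_ : IsOrientationOn o' (staticRegion (hyperbolicPotential a₀ a)))
      (U : Set M) (φ : M → ℝ × Hyperbolic3)
      (_ : IsReference g o τ (staticMetric hyperbolicMetric (hyperbolicPotential a₀ a)) o'
        timeField (staticRegion (hyperbolicPotential a₀ a)) (range (j ∘ b)) U φ)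
      (_ : IsIsometricMatching g (staticMetric hyperbolicMetric (hyperbolicPotential a₀ a))
        (range (j ∘ b)) φ)
      (_ : ∀ s : S, mfderiv (𝓡 4) staticModel φ (j (b s)) (N (j (b s)))
        = timeField (φ (j (b s))))
      (T₀ : ℝ) (_ : ∀ s : S, (φ (j (b s))).1 = T₀)
      (ν₀ : ∀ s : S, TangentSpace (𝓡 3) (φ (j (b s))).2)
      (_ : IsUnitNormal hyperbolicMetric (fun s : S => (φ (j (b s))).2) ν₀)
      (_ : ∀ (s : S) (u v : TangentSpace (𝓡 2) s), IsPositiveFrame (oS s) ![u, v] →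
        IsPositiveFrame (o' (φ (j (b s))))
          ![timeField (φ (j (b s))), staticVec (φ (j (b s))) 0 (ν₀ s),
            mfderiv (𝓡 4) staticModel φ (j (b s)) (mfderiv (𝓡 2) (𝓡 4) (j ∘ b) s u),
            mfderiv (𝓡 4) staticModel φ (j (b s)) (mfderiv (𝓡 2) (𝓡 4) (j ∘ b) s v)]),
      cntEnergy g o (staticMetric hyperbolicMetric (hyperbolicPotential a₀ a)) (j ∘ b) oS N φ
        = 1 / (8 * Real.pi) * integralArea (pullback (𝓡 2) (j ∘ b) g) (fun s =>
            |hyperbolicPotential a₀ a (φ (j (b s))).2| *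
              (meanCurvature hyperbolicMetric (fun s : S => (φ (j (b s))).2) ν₀ s
                - meanCurvature (pullback (𝓡∂ 3) j g) b ν s))) := by
  refine ⟨fun a o' _ U φ hφ hmatch hφN T₀ hT ν₀ hν₀ hor₀ => ?_,
    fun a₀ a o' _ U φ hφ hmatch hφN T₀ hT ν₀ hν₀ hor₀ => ?_⟩
  · exact IsStaticReference.cntEnergy_eq (U := U) (o' := o')
      { lorentz := hg
        domain := hΩ
        unit_normal := hν.1
        orthogonal := hNΩ
        orientation := hor
        metric_differentiable := differentiableWithinAt_sphereMetric
        metric_symm := sphereMetric_symm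
        metric_pos := sphereMetric_pos
        potential_differentiable := mdifferentiableAt_spherePotential a
        isOpen := hφ.isOpen
        subset := fun s => hφ.subset ⟨s, rfl⟩
        ne_zero := fun s => hφ.mapsTo (hφ.subset ⟨s, rfl⟩)
        smooth := hφ.smooth
        immersion := fun s => hφ.immersion _ (hφ.subset ⟨s, rfl⟩)
        orientation_preserving := fun s => hφ.orientation _ (hφ.subset ⟨s, rfl⟩)
        matching := hmatch
        map_normal := hφN
        slice := ⟨T₀, hT⟩
        unit_normal₀ := hν₀
        orientation₀ := hor₀ }
  · exact IsStaticReference.cntEnergy_eq (U := U) (o' := o')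
      { lorentz := hg
        domain := hΩ
        unit_normal := hν.1
        orthogonal := hNΩ
        orientation := hor
        metric_differentiable := differentiableWithinAt_hyperbolicMetric
        metric_symm := hyperbolicMetric_symm
        metric_pos := hyperbolicMetric_pos
        potential_differentiable := mdifferentiableAt_hyperbolicPotential a₀ a
        isOpen := hφ.isOpen
        subset := fun s => hφ.subset ⟨s, rfl⟩
        ne_zero := fun s => hφ.mapsTo (hφ.subset ⟨s, rfl⟩)
        smooth := hφ.smooth
        immersion := fun s => hφ.immersion _ (hφ.subset ⟨s, rfl⟩)
        orientation_preserving := fun s => hφ.orientation _ (hφ.subset ⟨s, rfl⟩)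
        matching := hmatch
        map_normal := hφN
        slice := ⟨T₀, hT⟩
        unit_normal₀ := hν₀
        orientation₀ := hor₀ }
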